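/- **Setting.** Let $Q:\mathbb{C}\to\mathbb{R}\cup\{+\infty\}$ be rotation invariant, lower semicontinuous and confining, $\liminf_{z\to\infty} Q(z)/(2\log|z|)>1$. For $n\ge 1$ let $(z_1,\dots,z_n)$ be the Coulomb gas with law $$d\mathbb{P}_n=\frac1{Z_n}\prod_{1\le j<k\le n}|z_k-z_j|^2\prod_{j=1}^n e^{-nQ(z_j)}\frac{d^2z_j}{\pi},$$ where $Z_n$ is the normalizing constant. Let $\check Q$ be the pointwise supremum of all subharmonic $s:\mathbb{C}\to\mathbb{R}$ with $s\le Q$ on $\mathbb{C}$ and $s(z)\le 2\log|z|+O(1)$ as $|z|\to\infty$, and let $S^*=\{z: Q(z)=\check Q(z)\}$ be the coincidence set. Let $\Delta=\frac14(\partial_x^2+\partial_y^2)$. Assume that $$S^*=\{a_0\le|z|\le b_0\}\cup\bigcup_{k=1}^m\{|z|=t_k\},\qquad 0\le a_0<b_0<t_1<\dots<t_m,$$ that $Q$ is finite and $C^6$-smooth in a neighbourhood of $S^*$, and that $\Delta Q>0$ on $S^*$. Being radial, $\Delta Q(z)$ is written $\Delta Q(|z|)$. Let $\eta(u)=e^{-1/u}$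 for $u>0$, $\eta(u)=0$ for $u\le 0$, and $\widehat\eta(u)=\frac{\eta(u)}{\eta(u)+\eta(1-u)}$. Let $\varepsilon>0$ be so small that the $2\varepsilon$-neighbourhoods of the circles $|z|=t_k$ intersect neither each other nor $\{a_0\le|z|\le b_0\}$, and put $$h_k(z)=\widehat\eta\Big(\frac{|z|-(t_k-\varepsilon)}{\varepsilon/2}\Big)\,\widehat\eta\Big(\frac{(t_k+\varepsilon)-|z|}{\varepsilon/2}\Big),\qquad N_{n,k}=\sum_{j=1}^n h_k(z_j),\qquad k=1,\dots,m.$$ For $\theta_1,\dots,\theta_m>0$ and $q_1,\dots,q_m\in(0,1)$, the multi-dimensional Heine distribution $\mathrm{He}(\theta_1,\dots,\theta_m;q_1,\dots,q_m)$ is the probability distribution on $\{0,1,2,\dots\}^m$ which gives $(\alpha_1,\dots,\alpha_m)$ the mass $$\frac{\theta_1^{\alpha_1}\cdots\theta_m^{\alpha_m}\ \sum_{J_1,\dots,J_m}\ \prod_{k=1}^m q_k^{\sum_{j\in J_k}j}}{\prod_{j=0}^\infty\big(1+\sum_{k=1}^m\theta_kq_k^j\big)},$$ where the sum is over all pairwise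 disjoint $J_1,\dots,J_m\subset\{0,1,2,\dots\}$ with $|J_k|=\alpha_k$. **Theorem (Case 1).** Let $\vartheta_k=\sqrt{\Delta Q(b_0)/\Delta Q(t_k)}$ and $\rho_k=b_0/t_k$. Then, for $s=(s_1,\dots,s_m)\in\mathbb{R}^m$, $$\lim_{n\to\infty}\mathbb{E}\Big[\prod_{k=1}^m e^{s_kN_{n,k}}\Big]=G(s):=\prod_{j=0}^\infty\frac{1+\sum_{k=1}^m e^{s_k}\vartheta_k\rho_k^{2j+1}}{1+\sum_{k=1}^m\vartheta_k\rho_k^{2j+1}},$$ locally uniformly in $s\in\mathbb{R}^m$, and moreover uniformly for $|s_k|\le\log n$, $k=1,\dots,m$, in the sense that $$\lim_{n\to\infty}\ \sup_{|s_1|,\dots,|s_m|\le\log n}\ \Big|\frac{\mathbb{E}\big[\prod_{k=1}^m e^{s_kN_{n,k}}\big]}{G(s)}-1\Big|=0 .$$ Consequently, as $n\to\infty$, $(N_{n,1},\dots,N_{n,m})$ converges in distribution to $\mathrm{He}(\vartheta_1\rho_1,\dots,\vartheta_m\rho_m;\rho_1^2,\dots,\rho_m^2)$. -/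

import Mathlib

open MeasureTheory Filter Topology ENNReal

namespace Coulomb

noncomputable section

/-! ### The Coulomb gas -/

/-- The area measure `d²z / π` on the complex plane. -/
def areaMeasure : Measure ℂ := (ENNReal.ofReal Real.pi)⁻¹ • volume

/-- The unnormalised density `∏_{j<k} |z_k - z_j|² ∏_j e^{-n Q(z_j)}` of `n` particles in the
external potential `Q`, which may take the value `+∞` (where the density vanishes). -/
def gasWeight (Q : ℂ → EReal) (n : ℕ) (z : Fin n → ℂ) : ℝ≥0∞ :=
  (∏ j, ∏ k ∈ Finset.Ioi j, ENNReal.ofReal (‖z k - z j‖ ^ 2)) *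
    ∏ j, EReal.exp (-(n : EReal) * Q (z j))

/-- The partition function `Z_n`. -/
def partitionFunction (Q : ℂ → EReal) (n : ℕ) : ℝ≥0∞ :=
  ∫⁻ z, gasWeight Q n z ∂(Measure.pi fun _ : Fin n => areaMeasure)

/-- The law of the `n`-particle Coulomb gas with external potential `Q`. -/
def gasLaw (Q : ℂ → EReal) (n : ℕ) : Measure (Fin n → ℂ) :=
  (partitionFunction Q n)⁻¹ •
    (Measure.pi fun _ : Fin n => areaMeasure).withDensity (gasWeight Q n)

/-! ### The obstacle problem -/

/-- Real-valued subharmonic functions on the complex plane: upper semicontinuous functions which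
satisfy the sub-mean value inequality on every circle. -/
def IsSubharmonic (s : ℂ → ℝ) : Prop :=
  UpperSemicontinuous s ∧
    ∀ (z : ℂ) (r : ℝ), 0 < r → CircleIntegrable s z r ∧ s z ≤ Real.circleAverage s z r

/-- The competitors of the obstacle problem: subharmonic functions `s ≤ Q` such that
`s(z) ≤ 2 log |z| + O(1)` as `|z| → ∞`. -/
def obstacleClass (Q : ℂ → EReal) : Set (ℂ → ℝ) :=
  {s | IsSubharmonic s ∧ (∀ z, (s z : EReal) ≤ Q z) ∧
    ∃ C : ℝ, ∀ᶠ z in Bornology.cobounded ℂ, s z ≤ 2 * Real.log ‖z‖ + C}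

/-- The obstacle function `Q̌`, the pointwise supremum of the competitors. -/
def obstacle (Q : ℂ → EReal) (z : ℂ) : EReal :=
  ⨆ s ∈ obstacleClass Q, ((s z : ℝ) : EReal)

/-- The coincidence set `S* = {Q = Q̌}`. -/
def coincidenceSet (Q : ℂ → EReal) : Set ℂ := {z | Q z = obstacle Q z}

/-- `Q` is finite and of class `C⁶` in a neighbourhood of the set `S`. -/
def IsC6Near (Q : ℂ → EReal) (S : Set ℂ) : Prop :=
  ∃ U : Set ℂ, IsOpen U ∧ S ⊆ U ∧ (∀ z ∈ U, Q z ≠ ⊤ ∧ Q z ≠ ⊥) ∧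
    ContDiffOn ℝ 6 (fun z => (Q z).toReal) U

/-- The quarter Laplacian `ΔQ = (∂_x² + ∂_y²) Q / 4` (used where `Q` is finite and smooth). -/
def quarterLaplacian (Q : ℂ → EReal) (z : ℂ) : ℝ :=
  (1 / 4) * Laplacian.laplacian (fun w : ℂ => (Q w).toReal) z

/-! ### Smoothed particle counts near the outposts -/

/-- The radial cutoff `χ` of width `ε` around `t`; `Real.smoothTransition u` is
`η(u) / (η(u) + η(1 - u))` with `η(u) = e^{-1/u}` for `u > 0` and `η(u) = 0` for `u ≤ 0`. -/
def cutoff (ε t r : ℝ) : ℝ :=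
  Real.smoothTransition ((r - (t - ε)) / (ε / 2)) *
    Real.smoothTransition (((t + ε) - r) / (ε / 2))

/-- The vector `(N_{n,1}, …, N_{n,m})` of linear statistics `N_{n,k} = ∑_j χ_k(|z_j|)`. -/
def outpostCount {m : ℕ} (ε : ℝ) (t : Fin m → ℝ) (n : ℕ) (z : Fin n → ℂ) (k : Fin m) : ℝ :=
  ∑ j, cutoff ε (t k) ‖z j‖

/-- The joint moment generating function `E[∏_k e^{s_k N_{n,k}}]`. -/
def outpostMGF {m : ℕ} (Q : ℂ → EReal) (ε : ℝ) (t : Fin m → ℝ) (n : ℕ) (s : Fin m → ℝ) : ℝ :=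
  ∫ z, ∏ k, Real.exp (s k * outpostCount ε t n z k) ∂(gasLaw Q n)

/-! ### The multi-dimensional Heine distribution -/

/-- Families `(J_1, …, J_m)` of pairwise disjoint sets of natural numbers with `|J_k| = α_k`. -/
def DisjointFamily {m : ℕ} (α : Fin m → ℕ) : Type :=
  {J : Fin m → Finset ℕ // (∀ k, (J k).card = α k) ∧ ∀ k l, k ≠ l → Disjoint (J k) (J l)}

/-- The probability of `α` under `He(θ_1, …, θ_m; q_1, …, q_m)`. -/
def heineMass {m : ℕ} (θ q : Fin m → ℝ) (α : Fin m → ℕ) : ℝ :=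
  (∏ k, θ k ^ α k) * (∑' J : DisjointFamily α, ∏ k, q k ^ (∑ j ∈ J.1 k, j)) /
    ∏' j : ℕ, (1 + ∑ k, θ k * q k ^ j)

/-- The multi-dimensional Heine distribution as a measure on `ℕ^m`. -/
def heineLaw {m : ℕ} (θ q : Fin m → ℝ) : Measure (Fin m → ℕ) :=
  Measure.sum fun α => ENNReal.ofReal (heineMass θ q α) • Measure.dirac α

/-! ### The constants of the limit -/

/-- `ϑ = √(ΔQ(b) / ΔQ(t))`. -/
def vartheta (Q : ℂ → EReal) (b t : ℝ) : ℝ :=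
  √(quarterLaplacian Q (b : ℂ) / quarterLaplacian Q (t : ℂ))

/-- `∏_{j ≥ 0} (1 + ∑_k e^{s_k} ϑ_k ρ_k^{2j+1}) / (1 + ∑_k ϑ_k ρ_k^{2j+1})`. -/
def limitMGF {m : ℕ} (ϑ ρ : Fin m → ℝ) (s : Fin m → ℝ) : ℝ :=
  ∏' j : ℕ, (1 + ∑ k, Real.exp (s k) * ϑ k * ρ k ^ (2 * j + 1)) /
    (1 + ∑ k, ϑ k * ρ k ^ (2 * j + 1))

end

end Coulomb

/-!
# Counting statistics at the outposts of a radial Coulomb gas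

For a radial potential the squared Vandermonde determinant can be expanded over permutations, and
distinct monomials are orthogonal. Hence the expectation of a product `∏_j F(|z_j|)` of radial
functions factorises, as if the moduli were independent (`OutpostPotential.integral_prod_gasLaw`).
The `l`-th factor, counted from the top degree `n - 1`, is the mean of `F` under the normalised
measure `ψ(r)^n r^{-2l-1} dr`, where `ψ(r) = r² e^{-Q(r)} / max` is the profile of the potential.
Exponentials of the counts `N_{n,k}` are such products, so everything reduces to the behaviour of
these means as `n → ∞`.

The peaks of the profile, the points where `ψ = 1`, are exactly `b₀` and the outposts `t_k`; this is
where the obstacle problem enters. Maximum points of `|z|² e^{-Q}` belong to the coincidence set, as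
truncated logarithms are admissible competitors (`mem_coincidenceSet_of_isMax`). Conversely, the
maximum principle in an exterior domain shows that all points of the coincidence set which lie
outside the innermost maximum circle are maximum points (`isMax_of_mem_coincidenceSet`). The
innermost circle has radius `b₀` (`OutpostPotential.isMax_b`): a smaller radius in the annulus would
force `Q` to be harmonic on a part of it, contradicting `ΔQ > 0`, and an outpost would also carry
the maximum points of `|z|^λ e^{-Q}` with `λ` slightly below `2`, which prescribes two values for
the derivative of `Q` there.

Laplace's method at a peak `p`, with `ψ ≈ exp (-2 ΔQ(p) (r - p)²)`, gives it asymptotically the mass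
`√(2π / (4 n ΔQ(p))) p^{-2l-1}`, with relative error `O((l + 1) / √n)`. So for fixed `l` the `l`-th
factor for `∏_k e^{s_k N_{n,k}}` tends to
`(1 + ∑_k e^{s_k} ϑ_k ρ_k^{2l+1}) / (1 + ∑_k ϑ_k ρ_k^{2l+1})`, the `l`-th factor of the limit. To
multiply infinitely many factors one needs a bound uniform in `l`: by monotonicity of `r^{-2l}`, the
proportion of mass outside the droplet is at most `C θ^l` with `θ < 1`, for all `l < n`
(`PeakProfile.exists_real_Ici_le`). For `(l + 1)^12 ≤ n` Laplace's method applies, and for larger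
`l` the factor `θ^l` beats any power of `n`, such as the size `n^m` of the test functions for
`|s_k| ≤ log n`. Together the relative errors of the factors are at most `n^{-1/4} D_l` with a
summable sequence `D_l` (`PeakProfile.exists_summable_relative_error`), which yields the relative
error estimate for the generating functions, and thereby their locally uniform convergence.

For imaginary `s` the same bounds and dominated convergence for infinite products give the limit of
the characteristic functions. Expanding `∏_j (1 + ∑_k θ_k q_k^j w_k)` over families of disjoint
finite sets (`hasSum_disjointFamily`) identifies it as the characteristic function of the Heine
distribution, and Lévy's continuity theorem concludes.
-/

namespace Coulomb

noncomputable section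

/-! ### Subharmonic functions and the maximum principle -/

open Real in
/-- The model subharmonic functions `d + λ log⁺(|z| / R)` are subharmonic. -/
theorem isSubharmonic_posLog {d lam R : ℝ} (hlam : 0 ≤ lam) (hR : 0 < R) :
    IsSubharmonic fun z : ℂ => d + lam * posLog (‖z‖ / R) := by
  have hc : Continuous fun z : ℂ => d + lam * posLog (‖z‖ / R) := by fun_prop
  refine ⟨hc.upperSemicontinuous, fun z r hr => ?_⟩
  have hint : CircleIntegrable (fun z : ℂ => d + lam * posLog (‖z‖ / R)) z r :=
    hc.continuousOn.circleIntegrable hr.le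
  refine ⟨hint, ?_⟩
  -- the constant `d` is a minorant; it settles the case `|z| ≤ R`
  have h1 : d ≤ circleAverage (fun z : ℂ => d + lam * posLog (‖z‖ / R)) z r := by
    refine (circleAverage_const d z r).ge.trans ?_
    refine circleAverage_mono (continuous_const.continuousOn.circleIntegrable hr.le) hint
      fun x _ => ?_
    have := mul_nonneg hlam (posLog_nonneg (x := ‖x‖ / R))
    linarith
  rcases le_or_gt ‖z‖ R with hz | hz
  · have : posLog (‖z‖ / R) = 0 := by
      rw [posLog_eq_zero_iff, abs_of_nonneg (by positivity), div_le_one hR]; exact hz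
    simpa [this] using h1
  · -- outside the disc, the minorant `d + λ log (|z| / R)` is harmonic up to its pole
    have hz0 : 0 < ‖z‖ := hR.trans hz
    have hlog : posLog (‖z‖ / R) = log ‖z‖ - log R := by
      rw [posLog_eq_log, log_div hz0.ne' hR.ne']
      rw [abs_of_nonneg (by positivity), one_le_div hR]; exact hz.le
    have hI : CircleIntegrable (fun w : ℂ => log ‖w - 0‖) z r :=
      circleIntegrable_log_norm_sub_const r
    have havg : circleAverage (fun w : ℂ => log ‖w - 0‖) z r = log r + posLog (r⁻¹ * ‖z - 0‖) :=
      circleAverage_log_norm_sub_const_eq_log_radius_add_posLog hr.ne'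
    have hge : log ‖z‖ ≤ circleAverage (fun w : ℂ => log ‖w - 0‖) z r := by
      rw [havg, sub_zero, posLog_apply]
      have : log (r⁻¹ * ‖z‖) = -log r + log ‖z‖ := by
        rw [log_mul (by positivity) hz0.ne', Real.log_inv]
      have := le_max_right 0 (log (r⁻¹ * ‖z‖))
      linarith
    have hC : CircleIntegrable (fun _ : ℂ => d - lam * log R) z r :=
      continuous_const.continuousOn.circleIntegrable hr.le
    have hI' : CircleIntegrable (fun w : ℂ => lam • log ‖w - 0‖) z r := hI.const_fun_smul
    have hsum : circleAverage (fun w : ℂ => lam • log ‖w - 0‖ + (d - lam * log R)) z r =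
        lam * circleAverage (fun w : ℂ => log ‖w - 0‖) z r + (d - lam * log R) := by
      rw [circleAverage_fun_add hI' hC, circleAverage_const, circleAverage_fun_smul, smul_eq_mul]
    have hcod : (fun w : ℂ => lam • log ‖w - 0‖ + (d - lam * log R))
        =ᶠ[codiscreteWithin (Metric.sphere z |r|)] fun w : ℂ => d + lam * log (‖w‖ / R) := by
      filter_upwards [compl_singleton_mem_codiscreteWithin (0 : ℂ)] with w hw
      have hw0 : ‖w‖ ≠ 0 := norm_ne_zero_iff.2 hw
      rw [log_div hw0 hR.ne', sub_zero, smul_eq_mul]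
      ring
    have hmono : circleAverage (fun w : ℂ => lam • log ‖w - 0‖ + (d - lam * log R)) z r ≤
        circleAverage (fun z : ℂ => d + lam * posLog (‖z‖ / R)) z r := by
      rw [circleAverage_congr_codiscreteWithin hcod hr.ne']
      refine circleAverage_mono ((circleIntegrable_congr_codiscreteWithin hcod).1
        (CircleIntegrable.add hI' hC)) hint fun x _ => ?_
      have : log (‖x‖ / R) ≤ posLog (‖x‖ / R) := by
        rw [posLog_apply]; exact le_max_right _ _
      gcongr
    have := mul_le_mul_of_nonneg_left hge hlam
    rw [hsum] at hmono
    change d + lam * posLog (‖z‖ / R) ≤ _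
    rw [hlog]
    linarith

open Real in
/-- Mean value of `|·|²` over circles: the function is strictly subharmonic. -/
theorem circleAverage_norm_sq (w : ℂ) {r : ℝ} (hr : 0 < r) :
    circleAverage (fun z : ℂ => ‖z‖ ^ 2) w r = ‖w‖ ^ 2 + r ^ 2 := by
  set f : ℂ → ℂ := fun z => (starRingEnd ℂ) w * (z - w) with hf
  have hfc : Continuous f := by fun_prop
  have h1 : circleAverage f w r = 0 := by
    have hd : DiffContOnCl ℂ f (Metric.ball w |r|) := by
      apply Differentiable.diffContOnCl; fun_prop
    rw [hd.circleAverage]; simp [f]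
  have h2 : circleAverage (fun z => (f z).re) w r = 0 := by
    have := Complex.reCLM.circleAverage_comp_comm (f := f) (c := w) (R := r)
      (hfc.continuousOn.circleIntegrable hr.le)
    rw [h1] at this
    simpa [Function.comp_def] using this
  have h3 : circleAverage (fun z : ℂ => ‖z‖ ^ 2) w r =
      circleAverage (fun z : ℂ => (2 : ℝ) • (f z).re + (‖w‖ ^ 2 + r ^ 2)) w r := by
    apply circleAverage_congr_sphere
    intro z hz
    have hz' : ‖z - w‖ = r := by simpa [abs_of_pos hr, dist_eq_norm] using hz
    have : ‖z‖ ^ 2 = ‖(z - w) + w‖ ^ 2 := by simp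
    simp only [f, smul_eq_mul]
    rw [this, ← Complex.normSq_eq_norm_sq, Complex.normSq_add, Complex.normSq_eq_norm_sq,
      Complex.normSq_eq_norm_sq, hz', mul_comm ((starRingEnd ℂ) w)]
    ring
  have hI : CircleIntegrable (fun z : ℂ => (2 : ℝ) • (f z).re) w r := by
    apply ContinuousOn.circleIntegrable hr.le
    fun_prop
  rw [h3, circleAverage_fun_add hI (continuous_const.continuousOn.circleIntegrable hr.le),
    circleAverage_fun_smul, h2, circleAverage_const]
  simp

open Real in
/-- **Maximum principle in the exterior of a disc.** A subharmonic function which is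
`≤ 2 log |z| + O(1)` at infinity and `≤ 2 log |z| + B` on the circle `|z| = r₀` satisfies the latter
bound in the whole exterior of the circle. -/
theorem IsSubharmonic.le_two_log_of_le_on_circle {s : ℂ → ℝ} (hs : IsSubharmonic s) {C B r₀ : ℝ}
    (hr₀ : 0 < r₀) (hinf : ∀ᶠ z in Bornology.cobounded ℂ, s z ≤ 2 * log ‖z‖ + C)
    (hcirc : ∀ z, ‖z‖ = r₀ → s z ≤ 2 * log ‖z‖ + B) (z₁ : ℂ) (hz₁ : r₀ ≤ ‖z₁‖) :
    s z₁ ≤ 2 * log ‖z₁‖ + B := by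
  by_contra! hcon
  obtain ⟨P, hP⟩ : ∃ P : ℝ, ∀ z : ℂ, P ≤ ‖z‖ → s z ≤ 2 * log ‖z‖ + C := by
    rw [← comap_norm_atTop, eventually_comap] at hinf
    obtain ⟨P, hP⟩ := eventually_atTop.1 hinf
    exact ⟨P, fun z hz => hP _ hz z rfl⟩
  have hz₁0 : 0 < ‖z₁‖ := hr₀.trans_le hz₁
  -- tilt by a small multiple of `log |z|`, to gain decay at infinity
  set D := s z₁ - (2 * log ‖z₁‖ + B) with hD
  have hD0 : 0 < D := by linarith
  have hlr : log r₀ ≤ log ‖z₁‖ := log_le_log hr₀ hz₁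
  set L := log ‖z₁‖ - log r₀ with hL
  obtain ⟨η, hη, hηD⟩ : ∃ η : ℝ, 0 < η ∧ η * L < D / 2 := by
    refine ⟨D / (4 * (L + 1)), by positivity, ?_⟩
    rw [div_mul_eq_mul_div, div_lt_div_iff₀ (by positivity) (by norm_num)]
    nlinarith
  set R₁ := max (max P ‖z₁‖) (r₀ * exp (|C - B| / η)) with hR₁
  have hR₁z : ‖z₁‖ ≤ R₁ := (le_max_right _ _).trans (le_max_left _ _)
  have hR₁0 : 0 < R₁ := hz₁0.trans_le hR₁z
  obtain ⟨κ, hκ, hκD⟩ : ∃ κ : ℝ, 0 < κ ∧ κ * R₁ ^ 2 < D / 2 := by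
    refine ⟨D / (4 * R₁ ^ 2), by positivity, ?_⟩
    rw [div_mul_eq_mul_div, div_lt_div_iff₀ (by positivity) (by norm_num)]
    nlinarith [sq_pos_of_pos hR₁0]
  -- the strictly subharmonic comparison function
  set v : ℂ → ℝ := fun z => s z + (-(2 + η) * log ‖z‖ + κ * ‖z‖ ^ 2) with hv
  set A : Set ℂ := {z | r₀ ≤ ‖z‖ ∧ ‖z‖ ≤ R₁} with hA
  have hAc : IsCompact A := by
    refine (isCompact_closedBall (0 : ℂ) R₁).of_isClosed_subset ?_ ?_
    · exact (isClosed_le continuous_const continuous_norm).inter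
        (isClosed_le continuous_norm continuous_const)
    · intro z hz; simpa using hz.2
  have hvusc : UpperSemicontinuousOn v A := by
    refine UpperSemicontinuousOn.add (hs.1.upperSemicontinuousOn A) ?_
    apply ContinuousOn.upperSemicontinuousOn
    refine ContinuousOn.add (ContinuousOn.mul continuousOn_const
      (ContinuousOn.log continuous_norm.continuousOn fun z hz => ?_)) (by fun_prop)
    exact (hr₀.trans_le hz.1).ne'
  obtain ⟨w, hwA, hw⟩ := UpperSemicontinuousOn.exists_isMaxOn (⟨z₁, hz₁, hR₁z⟩ : A.Nonempty) hAc hvusc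
  have hwz : v z₁ ≤ v w := hw (show z₁ ∈ A from ⟨hz₁, hR₁z⟩)
  have hvz : B - η * log r₀ + D / 2 < v z₁ := by
    have : v z₁ = B + D - η * log ‖z₁‖ + κ * ‖z₁‖ ^ 2 := by simp only [hv, hD]; ring
    have h2 : 0 ≤ κ * ‖z₁‖ ^ 2 := by positivity
    have h3 : η * log ‖z₁‖ = η * L + η * log r₀ := by rw [hL]; ring
    linarith
  have hw1 : r₀ < ‖w‖ := by
    refine lt_of_le_of_ne hwA.1 fun h => ?_
    have h1 := hcirc w h.symm
    have h2 : κ * ‖w‖ ^ 2 ≤ κ * R₁ ^ 2 := by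
      have := hwA.2; gcongr
    have h3 : v w = s w - 2 * log ‖w‖ - η * log ‖w‖ + κ * ‖w‖ ^ 2 := by simp only [hv]; ring
    rw [← h] at h1 h2 h3
    linarith
  have hw2 : ‖w‖ < R₁ := by
    refine lt_of_le_of_ne hwA.2 fun h => ?_
    have h1 := hP w (by rw [h]; exact (le_max_left _ _).trans (le_max_left _ _))
    have h3 : v w = s w - 2 * log ‖w‖ - η * log ‖w‖ + κ * ‖w‖ ^ 2 := by simp only [hv]; ring
    have h4 : log r₀ + |C - B| / η ≤ log ‖w‖ := by
      rw [h, ← log_exp (|C - B| / η), ← log_mul hr₀.ne' (exp_pos _).ne']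
      exact log_le_log (by positivity) (le_max_right _ _)
    have h5 : η * log r₀ + |C - B| ≤ η * log ‖w‖ := by
      have := mul_le_mul_of_nonneg_left h4 hη.le
      rwa [mul_add, mul_div_cancel₀ _ hη.ne'] at this
    have := le_abs_self (C - B)
    rw [← h] at hκD
    linarith
  -- the mean value over a small circle about the maximum point is too large
  set ρ := min (‖w‖ - r₀) (R₁ - ‖w‖) with hρ
  have hρ0 : 0 < ρ := lt_min (by linarith) (by linarith)
  have hw0 : 0 < ‖w‖ := hr₀.trans hw1
  obtain ⟨hsI, hsavg⟩ := hs.2 w ρ hρ0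
  have hlI : CircleIntegrable (fun z : ℂ => log ‖z - 0‖) w ρ :=
    circleIntegrable_log_norm_sub_const ρ
  have hlavg : circleAverage (fun z : ℂ => log ‖z - 0‖) w ρ = log ‖w‖ := by
    have : circleAverage (fun z : ℂ => log ‖z - 0‖) w ρ = log ρ + posLog (ρ⁻¹ * ‖w - 0‖) :=
      circleAverage_log_norm_sub_const_eq_log_radius_add_posLog hρ0.ne'
    have hρw : ρ ≤ ‖w‖ := (min_le_left _ _).trans (by linarith)
    rw [this, sub_zero, posLog_eq_log, log_mul (by positivity) hw0.ne', Real.log_inv]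
    · ring
    · rw [abs_of_nonneg (by positivity), inv_mul_eq_div, one_le_div hρ0]; exact hρw
  have hlI' : CircleIntegrable (fun z : ℂ => (-(2 + η)) • log ‖z - 0‖) w ρ := hlI.const_fun_smul
  have hqI : CircleIntegrable (fun z : ℂ => κ • ‖z‖ ^ 2) w ρ :=
    ContinuousOn.circleIntegrable hρ0.le (by fun_prop)
  have hveq : v = fun z => s z + ((-(2 + η)) • log ‖z - 0‖ + κ • ‖z‖ ^ 2) := by
    funext z; simp [hv]
  have hlq : CircleIntegrable (fun z : ℂ => (-(2 + η)) • log ‖z - 0‖ + κ • ‖z‖ ^ 2) w ρ :=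
    CircleIntegrable.add hlI' hqI
  have havg : circleAverage v w ρ =
      circleAverage s w ρ + (-(2 + η) * log ‖w‖ + κ * (‖w‖ ^ 2 + ρ ^ 2)) := by
    rw [hveq, circleAverage_fun_add hsI hlq, circleAverage_fun_add hlI' hqI,
      circleAverage_fun_smul, circleAverage_fun_smul, hlavg, circleAverage_norm_sq w hρ0]
    simp only [smul_eq_mul]
  have hle : circleAverage v w ρ ≤ v w := by
    refine circleAverage_mono_on_of_le_circle (by rw [hveq]; exact CircleIntegrable.add hsI hlq)
      fun z hz => hw ?_
    have hzw : ‖z - w‖ = ρ := by simpa [abs_of_pos hρ0, dist_eq_norm] using hz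
    have h1 := norm_sub_norm_le w z
    have h2 := norm_sub_norm_le z w
    rw [norm_sub_rev] at h1
    have h3 : ρ ≤ ‖w‖ - r₀ := min_le_left _ _
    have h4 : ρ ≤ R₁ - ‖w‖ := min_le_right _ _
    constructor <;> linarith
  have h6 : v w = s w + (-(2 + η) * log ‖w‖ + κ * ‖w‖ ^ 2) := rfl
  have : 0 < κ * ρ ^ 2 := by positivity
  nlinarith

/-! ### The Boltzmann factor and the coincidence set -/

/-- The Boltzmann factor `e^{-Q}`, a real-valued function; it vanishes where `Q = +∞`. -/
def boltzmann (Q : ℂ → EReal) (z : ℂ) : ℝ := (EReal.exp (-Q z)).toReal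

theorem boltzmann_nonneg (Q : ℂ → EReal) (z : ℂ) : 0 ≤ boltzmann Q z := ENNReal.toReal_nonneg

theorem boltzmann_of_eq_top {Q : ℂ → EReal} {z : ℂ} (h : Q z = ⊤) : boltzmann Q z = 0 := by
  simp [boltzmann, h]

theorem boltzmann_of_eq_coe {Q : ℂ → EReal} {z : ℂ} {x : ℝ} (h : Q z = x) :
    boltzmann Q z = Real.exp (-x) := by
  rw [boltzmann, h, ← EReal.coe_neg, EReal.exp_coe, ENNReal.toReal_ofReal (Real.exp_pos _).le]

theorem coe_le_iff_boltzmann_le {Q : ℂ → EReal} {z : ℂ} (hbot : Q z ≠ ⊥) (c : ℝ) :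
    (c : EReal) ≤ Q z ↔ boltzmann Q z ≤ Real.exp (-c) := by
  rcases eq_or_ne (Q z) ⊤ with h | h
  · rw [h]
    simp [boltzmann_of_eq_top h, (Real.exp_pos _).le]
  · have h' := (EReal.coe_toReal h hbot).symm
    rw [boltzmann_of_eq_coe h', h']; simp

theorem coe_lt_iff_boltzmann_lt {Q : ℂ → EReal} {z : ℂ} (hbot : Q z ≠ ⊥) (c : ℝ) :
    (c : EReal) < Q z ↔ boltzmann Q z < Real.exp (-c) := by
  rcases eq_or_ne (Q z) ⊤ with h | h
  · rw [h]
    simp [boltzmann_of_eq_top h, Real.exp_pos]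
  · have h' := (EReal.coe_toReal h hbot).symm
    rw [boltzmann_of_eq_coe h', h']; simp

theorem boltzmann_eq_exp_neg_toReal {Q : ℂ → EReal} {z : ℂ} (hbot : Q z ≠ ⊥) (htop : Q z ≠ ⊤) :
    boltzmann Q z = Real.exp (-(Q z).toReal) :=
  boltzmann_of_eq_coe (EReal.coe_toReal htop hbot).symm

theorem upperSemicontinuous_boltzmann {Q : ℂ → EReal} (hbot : ∀ z, Q z ≠ ⊥)
    (hlsc : LowerSemicontinuous Q) : UpperSemicontinuous (boltzmann Q) := by
  intro z y hy
  have hy0 : 0 < y := (boltzmann_nonneg Q z).trans_lt hy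
  have hy' : y = Real.exp (-(-Real.log y)) := by rw [neg_neg, Real.exp_log hy0]
  have hy2 : boltzmann Q z < y := hy
  rw [hy', ← coe_lt_iff_boltzmann_lt (hbot z)] at hy2
  filter_upwards [hlsc z _ hy2] with w hw
  rw [hy', ← coe_lt_iff_boltzmann_lt (hbot w)]
  exact hw

/-- Confinement of the potential, as a power decay of the Boltzmann factor. -/
theorem exists_boltzmann_le_rpow {Q : ℂ → EReal} (hbot : ∀ z, Q z ≠ ⊥)
    (hconf : 1 < Filter.liminf (fun z : ℂ => Q z / ((2 * Real.log ‖z‖ : ℝ) : EReal))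
      (Bornology.cobounded ℂ)) :
    ∃ a R : ℝ, 1 < a ∧ 1 < R ∧ ∀ z : ℂ, R ≤ ‖z‖ → boltzmann Q z ≤ ‖z‖ ^ (-(2 * a)) := by
  obtain ⟨a, ha1, ha2⟩ := EReal.lt_iff_exists_real_btwn.1 hconf
  have hev := Filter.eventually_lt_of_lt_liminf ha2
  rw [← comap_norm_atTop, eventually_comap] at hev
  obtain ⟨R, hR⟩ := eventually_atTop.1 hev
  refine ⟨a, max R 2, by exact_mod_cast ha1, lt_max_of_lt_right (by norm_num), fun z hz => ?_⟩
  have h1 := hR ‖z‖ ((le_max_left _ _).trans hz) z rfl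
  have hz2 : (2 : ℝ) ≤ ‖z‖ := (le_max_right _ _).trans hz
  have hz0 : 0 < ‖z‖ := by linarith
  have hlog : 0 < 2 * Real.log ‖z‖ := mul_pos two_pos (Real.log_pos (by linarith))
  have h2 : ‖z‖ ^ (-(2 * a)) = Real.exp (-(2 * Real.log ‖z‖ * a)) := by
    rw [Real.rpow_def_of_pos hz0]; congr 1; ring
  rw [h2]
  rcases eq_or_ne (Q z) ⊤ with h | h
  · rw [boltzmann_of_eq_top h]; exact (Real.exp_pos _).le
  · obtain ⟨x, h⟩ : ∃ x : ℝ, Q z = x := ⟨_, (EReal.coe_toReal h (hbot z)).symm⟩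
    rw [boltzmann_of_eq_coe h]
    rw [h, ← EReal.coe_div, EReal.coe_lt_coe_iff, lt_div_iff₀ hlog] at h1
    apply Real.exp_le_exp.2
    linarith

theorem exists_boltzmann_le {Q : ℂ → EReal} (hbot : ∀ z, Q z ≠ ⊥)
    (hlsc : LowerSemicontinuous Q)
    (hconf : 1 < Filter.liminf (fun z : ℂ => Q z / ((2 * Real.log ‖z‖ : ℝ) : EReal))
      (Bornology.cobounded ℂ)) :
    ∃ K : ℝ, 0 < K ∧ ∀ z, boltzmann Q z ≤ K := by
  obtain ⟨a, R, ha, hR, h⟩ := exists_boltzmann_le_rpow hbot hconf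
  obtain ⟨K, hK⟩ := UpperSemicontinuousOn.bddAbove_of_isCompact (isCompact_closedBall (0 : ℂ) R)
    ((upperSemicontinuous_boltzmann hbot hlsc).upperSemicontinuousOn _)
  refine ⟨max K 1, by positivity, fun z => ?_⟩
  rcases le_total ‖z‖ R with hz | hz
  · exact (hK ⟨z, by simpa using hz, rfl⟩).trans (le_max_left _ _)
  · refine (h z hz).trans ((Real.rpow_le_one_of_one_le_of_nonpos ?_ ?_).trans (le_max_right _ _))
    · linarith
    · linarith

theorem upperSemicontinuous_rpow_norm_mul_boltzmann {Q : ℂ → EReal} (hbot : ∀ z, Q z ≠ ⊥)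
    (hlsc : LowerSemicontinuous Q) {lam : ℝ} (hlam : 0 ≤ lam) :
    UpperSemicontinuous fun z => ‖z‖ ^ lam * boltzmann Q z := by
  intro z y hy
  have hc : ContinuousAt (fun p : ℝ × ℝ => p.1 * p.2) (‖z‖ ^ lam, boltzmann Q z) := by fun_prop
  obtain ⟨δ, hδ, hball⟩ := Metric.eventually_nhds_iff.1 (hc.eventually_lt_const hy)
  have h1 := (upperSemicontinuous_boltzmann hbot hlsc) z (boltzmann Q z + δ / 2) (by linarith)
  have hcn : Continuous fun w : ℂ => ‖w‖ ^ lam :=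
    continuous_norm.rpow_const fun _ => Or.inr hlam
  have h2 := hcn.continuousAt.eventually_lt_const
    (show ‖z‖ ^ lam < ‖z‖ ^ lam + δ / 2 by linarith)
  filter_upwards [h1, h2] with w hw1 hw2
  have h3 : (‖z‖ ^ lam + δ / 2) * (boltzmann Q z + δ / 2) < y := by
    refine hball (y := (‖z‖ ^ lam + δ / 2, boltzmann Q z + δ / 2)) ?_
    rw [Prod.dist_eq, max_lt_iff]
    simp [abs_of_pos hδ, hδ]
  refine lt_of_le_of_lt ?_ h3
  have := boltzmann_nonneg Q w
  have : 0 ≤ ‖w‖ ^ lam := by positivity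
  gcongr

/-- For `0 < λ ≤ 2` the function `|z|^λ e^{-Q}` attains a positive maximum. -/
theorem exists_max_rpow_norm_mul_boltzmann {Q : ℂ → EReal} (hbot : ∀ z, Q z ≠ ⊥)
    (hlsc : LowerSemicontinuous Q)
    (hconf : 1 < Filter.liminf (fun z : ℂ => Q z / ((2 * Real.log ‖z‖ : ℝ) : EReal))
      (Bornology.cobounded ℂ)) {p : ℂ} (hp : p ≠ 0) (hpQ : 0 < boltzmann Q p)
    {lam : ℝ} (hlam : 0 < lam) (hlam2 : lam ≤ 2) :
    ∃ z₀, 0 < ‖z₀‖ ^ lam * boltzmann Q z₀ ∧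
      ∀ z, ‖z‖ ^ lam * boltzmann Q z ≤ ‖z₀‖ ^ lam * boltzmann Q z₀ := by
  obtain ⟨a, R, ha, hR, h⟩ := exists_boltzmann_le_rpow hbot hconf
  have hv : 0 < ‖p‖ ^ lam * boltzmann Q p := by positivity
  have ht : Tendsto (fun r : ℝ => r ^ (-(2 * a - 2))) atTop (𝓝 0) :=
    tendsto_rpow_neg_atTop (by linarith)
  obtain ⟨R', hR'⟩ := eventually_atTop.1 (ht.eventually_lt_const hv)
  set R₁ := max (max R R') ‖p‖
  obtain ⟨z₀, hz₀, hmax⟩ := UpperSemicontinuousOn.exists_isMaxOn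
    (⟨p, by simp [R₁]⟩ : (Metric.closedBall (0 : ℂ) R₁).Nonempty) (isCompact_closedBall (0 : ℂ) R₁)
    ((upperSemicontinuous_rpow_norm_mul_boltzmann hbot hlsc hlam.le).upperSemicontinuousOn _)
  have hp₀ : ‖p‖ ^ lam * boltzmann Q p ≤ ‖z₀‖ ^ lam * boltzmann Q z₀ :=
    hmax (show p ∈ Metric.closedBall (0 : ℂ) R₁ by simp [R₁])
  refine ⟨z₀, hv.trans_le hp₀, fun z => ?_⟩
  rcases le_total ‖z‖ R₁ with hz | hz
  · exact hmax (show z ∈ Metric.closedBall (0 : ℂ) R₁ by simpa using hz)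
  · have hzR : R ≤ ‖z‖ := ((le_max_left _ _).trans (le_max_left _ _)).trans hz
    have hzR' : R' ≤ ‖z‖ := ((le_max_right _ _).trans (le_max_left _ _)).trans hz
    have hz1 : 1 ≤ ‖z‖ := by linarith
    refine le_trans ?_ ((hR' _ hzR').le.trans hp₀)
    calc ‖z‖ ^ lam * boltzmann Q z ≤ ‖z‖ ^ (2 : ℝ) * ‖z‖ ^ (-(2 * a)) := by
          gcongr
          · exact boltzmann_nonneg Q z
          · exact h z hzR
      _ = ‖z‖ ^ (-(2 * a - 2)) := by
          rw [← Real.rpow_add (by linarith)]; congr 1; ring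

theorem obstacle_le (Q : ℂ → EReal) (z : ℂ) : obstacle Q z ≤ Q z :=
  iSup₂_le fun _ hs => hs.2.1 z

/-- A maximum point of `|z|^λ e^{-Q}`, `0 < λ ≤ 2`, lies in the coincidence set: the competitor
`max (λ log |z| - c, -C)`, with constants `c` and `C`, touches `Q` from below there. -/
theorem mem_coincidenceSet_of_isMax {Q : ℂ → EReal} (hbot : ∀ z, Q z ≠ ⊥)
    (hlsc : LowerSemicontinuous Q)
    (hconf : 1 < Filter.liminf (fun z : ℂ => Q z / ((2 * Real.log ‖z‖ : ℝ) : EReal))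
      (Bornology.cobounded ℂ)) {lam : ℝ} (hlam : 0 < lam) (hlam2 : lam ≤ 2) {z₀ : ℂ}
    (hpos : 0 < ‖z₀‖ ^ lam * boltzmann Q z₀)
    (hmax : ∀ z, ‖z‖ ^ lam * boltzmann Q z ≤ ‖z₀‖ ^ lam * boltzmann Q z₀) :
    z₀ ∈ coincidenceSet Q := by
  obtain ⟨K, hK0, hK⟩ := exists_boltzmann_le hbot hlsc hconf
  set V := ‖z₀‖ ^ lam * boltzmann Q z₀ with hV
  set k := Real.log K with hk
  have hKe : Real.exp k = K := Real.exp_log hK0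
  set R := Real.exp ((Real.log V - k) / lam) with hR
  have hR0 : 0 < R := Real.exp_pos _
  have hlogR : lam * Real.log R = Real.log V - k := by
    rw [hR, Real.log_exp]; field_simp
  -- the competitor `max (λ log |z| - log V, -log K)`; the two branches meet on `|z| = R`
  set s : ℂ → ℝ := fun z => -k + lam * Real.posLog (‖z‖ / R) with hs
  have hs_out : ∀ z : ℂ, R ≤ ‖z‖ → s z = lam * Real.log ‖z‖ - Real.log V := by
    intro z hz
    have hz0 := hR0.trans_le hz
    simp only [hs]
    rw [Real.posLog_eq_log, Real.log_div hz0.ne' hR0.ne', mul_sub, hlogR]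
    · ring
    · rw [abs_of_nonneg (by positivity), one_le_div hR0]; exact hz
  have hexp : ∀ z : ℂ, 0 < ‖z‖ →
      Real.exp (-(lam * Real.log ‖z‖ - Real.log V)) = V / ‖z‖ ^ lam := by
    intro z hz
    rw [neg_sub, Real.exp_sub, Real.exp_log hpos, Real.rpow_def_of_pos hz, mul_comm lam]
  have hsQ : ∀ z, (s z : EReal) ≤ Q z := by
    intro z
    rw [coe_le_iff_boltzmann_le (hbot z)]
    rcases le_total R ‖z‖ with hz | hz
    · have hz0 := hR0.trans_le hz
      rw [hs_out z hz, hexp z hz0, le_div_iff₀ (by positivity), mul_comm]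
      exact hmax z
    · have : Real.posLog (‖z‖ / R) = 0 := by
        rw [Real.posLog_eq_zero_iff, abs_of_nonneg (by positivity), div_le_one hR0]; exact hz
      simp only [hs, this, mul_zero, add_zero, neg_neg, hKe]
      exact hK z
  have hmem : s ∈ obstacleClass Q := by
    refine ⟨isSubharmonic_posLog hlam.le hR0, hsQ, -Real.log V, ?_⟩
    rw [← comap_norm_atTop, eventually_comap]
    filter_upwards [eventually_ge_atTop R, eventually_ge_atTop 1] with x hx1 hx2 z hz
    subst hz
    rw [hs_out z hx1]
    have := Real.log_nonneg hx2
    nlinarith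
  refine le_antisymm ?_ (obstacle_le Q z₀)
  refine le_trans ?_ (le_iSup₂ (f := fun s _ => ((s z₀ : ℝ) : EReal)) s hmem)
  have hz₀ : 0 < ‖z₀‖ := by
    rcases (norm_nonneg z₀).eq_or_lt with h | h
    · rw [hV, ← h, Real.zero_rpow hlam.ne'] at hpos; simp at hpos
    · exact h
  have hb0 : 0 < boltzmann Q z₀ := by
    by_contra hcon
    have := le_antisymm (not_lt.1 hcon) (boltzmann_nonneg Q z₀)
    rw [hV, this] at hpos; simp at hpos
  have htop : Q z₀ ≠ ⊤ := fun h => by rw [boltzmann_of_eq_top h] at hb0; exact lt_irrefl _ hb0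
  have hRz : R ≤ ‖z₀‖ := by
    rw [← Real.log_le_log_iff hR0 hz₀]
    have h1 : Real.log V = lam * Real.log ‖z₀‖ + Real.log (boltzmann Q z₀) := by
      rw [hV, Real.log_mul (by positivity) hb0.ne', Real.log_rpow hz₀]
    have h2 : Real.log (boltzmann Q z₀) ≤ k := Real.log_le_log hb0 (hK z₀)
    have : lam * Real.log R ≤ lam * Real.log ‖z₀‖ := by linarith
    exact le_of_mul_le_mul_left this hlam
  rw [hs_out z₀ hRz, ← EReal.coe_toReal htop (hbot z₀), EReal.coe_le_coe_iff]
  have h3 := boltzmann_eq_exp_neg_toReal (hbot z₀) htop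
  have h4 : Real.log V = lam * Real.log ‖z₀‖ - (Q z₀).toReal := by
    rw [hV, Real.log_mul (by positivity) hb0.ne', Real.log_rpow hz₀, h3, Real.log_exp]; ring
  rw [h4]; linarith

/-- If `|z|² e^{-Q}` is maximal at `z₀`, then it is maximal at every point of the coincidence set
farther away from the origin. This is the maximum principle in the exterior domain. -/
theorem isMax_of_mem_coincidenceSet {Q : ℂ → EReal} (hbot : ∀ z, Q z ≠ ⊥)
    (hrad : ∀ z w : ℂ, ‖z‖ = ‖w‖ → Q z = Q w) {z₀ z₁ : ℂ}
    (hpos : 0 < ‖z₀‖ ^ (2 : ℝ) * boltzmann Q z₀)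
    (hle : ‖z₀‖ ≤ ‖z₁‖) (hz₁ : z₁ ∈ coincidenceSet Q) :
    ‖z₀‖ ^ (2 : ℝ) * boltzmann Q z₀ ≤ ‖z₁‖ ^ (2 : ℝ) * boltzmann Q z₁ := by
  set V := ‖z₀‖ ^ (2 : ℝ) * boltzmann Q z₀ with hV
  have hz₀ : 0 < ‖z₀‖ := by
    rcases (norm_nonneg z₀).eq_or_lt with h | h
    · rw [hV, ← h, Real.zero_rpow two_ne_zero] at hpos; simp at hpos
    · exact h
  have hz₁0 : 0 < ‖z₁‖ := hz₀.trans_le hle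
  have hb0 : 0 < boltzmann Q z₀ := by
    by_contra hcon
    have := le_antisymm (not_lt.1 hcon) (boltzmann_nonneg Q z₀)
    rw [hV, this] at hpos; simp at hpos
  have htop : Q z₀ ≠ ⊤ := fun h => by rw [boltzmann_of_eq_top h] at hb0; exact lt_irrefl _ hb0
  have h4 : (Q z₀).toReal = 2 * Real.log ‖z₀‖ + -Real.log V := by
    rw [hV, Real.log_mul (by positivity) hb0.ne', Real.log_rpow hz₀,
      boltzmann_eq_exp_neg_toReal (hbot z₀) htop, Real.log_exp]; ring
  have hub : obstacle Q z₁ ≤ ((2 * Real.log ‖z₁‖ + -Real.log V : ℝ) : EReal) := by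
    refine iSup₂_le fun s hs => ?_
    obtain ⟨hs1, hs2, C, hC⟩ := hs
    rw [EReal.coe_le_coe_iff]
    refine hs1.le_two_log_of_le_on_circle hz₀ hC (fun z hz => ?_) z₁ hle
    have h5 := hs2 z
    rw [hrad z z₀ hz, ← EReal.coe_toReal htop (hbot z₀), EReal.coe_le_coe_iff, h4] at h5
    rwa [hz]
  have hQ1 : Q z₁ = obstacle Q z₁ := hz₁
  rw [← hQ1] at hub
  have htop1 : Q z₁ ≠ ⊤ := ne_top_of_le_ne_top (EReal.coe_ne_top _) hub
  rw [← EReal.coe_toReal htop1 (hbot z₁), EReal.coe_le_coe_iff] at hub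
  rw [boltzmann_eq_exp_neg_toReal (hbot z₁) htop1]
  calc V = ‖z₁‖ ^ (2 : ℝ) * Real.exp (-(2 * Real.log ‖z₁‖ + -Real.log V)) := by
        rw [Real.rpow_def_of_pos hz₁0, ← Real.exp_add]
        conv_lhs => rw [← Real.exp_log hpos]
        congr 1; ring
    _ ≤ _ := by gcongr

/-! ### Calculus of radial functions -/

/-- The second differential on the diagonal, as a second derivative along a line. -/
theorem iteratedFDeriv_two_eq_deriv_deriv_line {u : ℂ → ℝ} {z : ℂ} (hu : ContDiffAt ℝ 2 u z)
    (v : ℂ) :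
    iteratedFDeriv ℝ 2 u z ![v, v] = deriv (deriv fun s : ℝ => u (z + s • v)) 0 := by
  have hline : ∀ t : ℝ, HasDerivAt (fun s : ℝ => z + s • v) v t := fun t => by
    simpa using ((hasDerivAt_id t).smul_const v).const_add z
  have hcont : Tendsto (fun s : ℝ => z + s • v) (𝓝 0) (𝓝 z) := by
    have : Continuous fun s : ℝ => z + s • v := by fun_prop
    simpa using this.tendsto 0
  have h1 : (deriv fun s : ℝ => u (z + s • v)) =ᶠ[𝓝 0] fun t => fderiv ℝ u (z + t • v) v := by
    have hev : ∀ᶠ w in 𝓝 z, ContDiffAt ℝ 2 u w := hu.eventually (by simp)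
    filter_upwards [hcont.eventually hev] with t ht
    exact ((ht.differentiableAt two_ne_zero).hasFDerivAt.comp_hasDerivAt t (hline t)).deriv
  rw [h1.deriv_eq, iteratedFDeriv_two_apply]
  have h2 : HasFDerivAt (fderiv ℝ u) (fderiv ℝ (fderiv ℝ u) z) (z + (0 : ℝ) • v) := by
    have := ((hu.fderiv_right (m := 1) (by norm_num)).differentiableAt one_ne_zero).hasFDerivAt
    rwa [zero_smul, add_zero]
  have h3 : HasDerivAt (fun t : ℝ => fderiv ℝ u (z + t • v)) (fderiv ℝ (fderiv ℝ u) z v) 0 :=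
    h2.comp_hasDerivAt (0 : ℝ) (hline 0)
  have h4 : HasDerivAt (fun t : ℝ => fderiv ℝ u (z + t • v) v) (fderiv ℝ (fderiv ℝ u) z v v) 0 :=
    (ContinuousLinearMap.apply ℝ ℝ v).hasFDerivAt.comp_hasDerivAt (0 : ℝ) h3
  rw [h4.deriv]
  rfl

/-- The Laplacian of a radial function in polar coordinates. -/
theorem laplacian_of_radial {u : ℂ → ℝ} (hrad : ∀ z w : ℂ, ‖z‖ = ‖w‖ → u z = u w) {p : ℝ}
    (hp : 0 < p) (hu : ContDiffAt ℝ 2 u (p : ℂ)) :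
    Laplacian.laplacian u (p : ℂ) =
      deriv (deriv fun r : ℝ => u r) p + deriv (fun r : ℝ => u r) p / p := by
  have hg : ContDiffAt ℝ 2 (fun r : ℝ => u r) p :=
    hu.comp p Complex.ofRealCLM.contDiff.contDiffAt
  set g : ℝ → ℝ := fun r : ℝ => u r with hgdef
  have hg1 : ContDiffAt ℝ 1 (deriv g) p := hg.derivWithin (by norm_num)
  rw [InnerProductSpace.laplacian_eq_iteratedFDeriv_complexPlane]
  simp only
  rw [iteratedFDeriv_two_eq_deriv_deriv_line hu, iteratedFDeriv_two_eq_deriv_deriv_line hu]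
  congr 1
  · have h1 : (fun s : ℝ => u (p + s • (1 : ℂ))) = fun s => g (p + s) := by
      funext s; simp [g]
    have h2 : (deriv fun s => g (p + s)) = fun s => deriv g (p + s) := by
      funext s; exact deriv_comp_const_add g p s
    rw [h1, h2, deriv_comp_const_add (deriv g) p 0, add_zero]
  · set N : ℝ → ℝ := fun s => √(p ^ 2 + s ^ 2) with hN
    have h1 : (fun s : ℝ => u (p + s • Complex.I)) = fun s => g (N s) := by
      funext s
      apply hrad
      rw [Complex.norm_real, Real.norm_of_nonneg (Real.sqrt_nonneg _), Complex.norm_eq_sqrt_sq_add_sq]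
      simp
    have hN0 : N 0 = p := by simp [N, Real.sqrt_sq hp.le]
    have hNpos : ∀ s, 0 < p ^ 2 + s ^ 2 := fun s => by positivity
    have hNd : ∀ s, HasDerivAt N (s / N s) s := by
      intro s
      have h := ((hasDerivAt_pow 2 s).const_add (p ^ 2)).sqrt (hNpos s).ne'
      convert! h using 1
      simp only [N]
      have := Real.sqrt_pos.2 (hNpos s)
      field_simp
      push_cast
      ring
    have hNc : Tendsto N (𝓝 0) (𝓝 p) := by
      have : Continuous N := by fun_prop
      simpa [hN0] using this.tendsto 0
    have h2 : (deriv fun s => g (N s)) =ᶠ[𝓝 0] fun s => s * (deriv g (N s) / N s) := by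
      have hev : ∀ᶠ w in 𝓝 p, ContDiffAt ℝ 2 g w := hg.eventually (by simp)
      filter_upwards [hNc.eventually hev] with s hs
      have := ((hs.differentiableAt two_ne_zero).hasDerivAt.comp s (hNd s)).deriv
      rw [Function.comp_def] at this
      rw [this]; ring
    rw [h1, h2.deriv_eq]
    have hk : DifferentiableAt ℝ (fun s => deriv g (N s) / N s) 0 := by
      refine DifferentiableAt.div ?_ (hNd 0).differentiableAt (by rw [hN0]; exact hp.ne')
      refine DifferentiableAt.comp (0 : ℝ) (g := deriv g) ?_ (hNd 0).differentiableAt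
      rw [hN0]; exact hg1.differentiableAt one_ne_zero
    have h3 := ((hasDerivAt_id (0 : ℝ)).mul hk.hasDerivAt).deriv
    have h4 : (fun s => s * (deriv g (N s) / N s)) = id * fun s => deriv g (N s) / N s := by
      funext s; simp
    rw [h4, h3]
    simp [hN0]

/-- Integration of a power bound on the derivative. -/
theorem abs_le_pow_succ_of_abs_deriv_le {g : ℝ → ℝ} {p δ M : ℝ} {k : ℕ}
    (hg : ∀ r, |r - p| < δ → DifferentiableAt ℝ g r)
    (hM : ∀ r, |r - p| < δ → |deriv g r| ≤ M * |r - p| ^ k) (h0 : g p = 0) (hM0 : 0 ≤ M)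
    {r : ℝ} (hr : |r - p| < δ) : |g r| ≤ M * |r - p| ^ (k + 1) := by
  have h := (convex_closedBall p |r - p|).norm_image_sub_le_of_norm_deriv_le
    (f := g) (C := M * |r - p| ^ k) (x := p) (y := r) (fun x hx => ?_) (fun x hx => ?_) ?_ ?_
  · rw [h0, sub_zero, Real.norm_eq_abs, Real.norm_eq_abs] at h
    rw [pow_succ, ← mul_assoc]; exact h
  · rw [Metric.mem_closedBall, Real.dist_eq] at hx
    exact hg x (hx.trans_lt hr)
  · rw [Metric.mem_closedBall, Real.dist_eq] at hx
    rw [Real.norm_eq_abs]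
    refine (hM x (hx.trans_lt hr)).trans ?_
    gcongr
  · simp
  · simp [Real.dist_eq]

/-- Second order Taylor expansion with cubic remainder at a critical point. -/
theorem exists_taylor_bound_of_deriv_eq_zero {f : ℝ → ℝ} {p : ℝ} (hf : ContDiffAt ℝ 3 f p)
    (h0 : f p = 0) (h1 : deriv f p = 0) :
    ∃ δ C : ℝ, 0 < δ ∧ 0 ≤ C ∧ ∀ r, |r - p| < δ →
      |f r - deriv (deriv f) p / 2 * (r - p) ^ 2| ≤ C * |r - p| ^ 3 := by
  set κ := deriv (deriv f) p with hκ
  have hf1 : ContDiffAt ℝ 2 (deriv f) p := hf.derivWithin (by norm_num)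
  have hf2 : ContDiffAt ℝ 1 (deriv (deriv f)) p := hf1.derivWithin (by norm_num)
  have hO := (hf2.differentiableAt one_ne_zero).hasDerivAt.hasFDerivAt.isBigO_sub
  obtain ⟨C, hC0, hC⟩ := hO.exists_pos
  rw [Asymptotics.isBigOWith_iff] at hC
  have e0 : ∀ᶠ w in 𝓝 p, ContDiffAt ℝ 3 f w := hf.eventually (by simp)
  have e1 : ∀ᶠ w in 𝓝 p, ContDiffAt ℝ 2 (deriv f) w := hf1.eventually (by simp)
  obtain ⟨δ, hδ, h⟩ := Metric.eventually_nhds_iff.1 (hC.and (e0.and e1))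
  simp only [Real.dist_eq, Real.norm_eq_abs] at h
  refine ⟨δ, C, hδ, hC0.le, fun r hr => ?_⟩
  have hd1 : ∀ r, |r - p| < δ → HasDerivAt (fun r => deriv f r - κ * (r - p))
      (deriv (deriv f) r - κ) r := fun r hr => by
    have := ((h hr).2.2.differentiableAt two_ne_zero).hasDerivAt.sub
      (((hasDerivAt_id r).sub_const p).const_mul κ)
    convert! this using 1
    simp
  have hd0 : ∀ r, |r - p| < δ → HasDerivAt (fun r => f r - κ / 2 * (r - p) ^ 2)
      (deriv f r - κ * (r - p)) r := fun r hr => by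
    have := ((h hr).2.1.differentiableAt three_ne_zero).hasDerivAt.sub
      ((((hasDerivAt_id r).sub_const p).pow 2).const_mul (κ / 2))
    convert! this using 1
    simp; ring
  have b1 : ∀ r, |r - p| < δ → |deriv f r - κ * (r - p)| ≤ C * |r - p| ^ 2 := fun r hr =>
    abs_le_pow_succ_of_abs_deriv_le (g := fun r => deriv f r - κ * (r - p)) (k := 1)
      (fun r hr => (hd1 r hr).differentiableAt)
      (fun r hr => by rw [(hd1 r hr).deriv, pow_one]; exact (h hr).1) (by simp [h1]) hC0.le hr
  exact abs_le_pow_succ_of_abs_deriv_le (g := fun r => f r - κ / 2 * (r - p) ^ 2) (k := 2)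
      (fun r hr => (hd0 r hr).differentiableAt)
      (fun r hr => by rw [(hd0 r hr).deriv]; exact b1 r hr) (by simp [h0]) hC0.le hr

/-! ### Location of the maximum of the radial weight -/

/-- The standing assumptions on the potential: it is radial, lower semicontinuous and confining, its
coincidence set is the annulus `a₀ ≤ |z| ≤ b₀` together with the circles `|z| = t k`, it is smooth
and strictly subharmonic there, and `ε` is admissible for the cutoffs. -/
structure OutpostPotential (Q : ℂ → EReal) {m : ℕ} (a₀ b₀ : ℝ) (t : Fin m → ℝ) (ε : ℝ) :
    Prop where
  ne_bot : ∀ z, Q z ≠ ⊥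
  rad : ∀ z w : ℂ, ‖z‖ = ‖w‖ → Q z = Q w
  lsc : LowerSemicontinuous Q
  conf : 1 < Filter.liminf (fun z : ℂ => Q z / ((2 * Real.log ‖z‖ : ℝ) : EReal))
    (Bornology.cobounded ℂ)
  a_nonneg : 0 ≤ a₀
  a_lt_b : a₀ < b₀
  b_lt : ∀ k, b₀ < t k
  coincidence : coincidenceSet Q =
    {z : ℂ | a₀ ≤ ‖z‖ ∧ ‖z‖ ≤ b₀} ∪ ⋃ k, {z : ℂ | ‖z‖ = t k}
  smooth : IsC6Near Q (coincidenceSet Q)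
  lap_pos : ∀ z ∈ coincidenceSet Q, 0 < quarterLaplacian Q z
  eps_pos : 0 < ε
  sep_b : ∀ k, b₀ + 2 * ε ≤ t k
  sep_t : ∀ k l, k < l → t k + 2 * ε ≤ t l - 2 * ε

namespace OutpostPotential

variable {Q : ℂ → EReal} {m : ℕ} {a₀ b₀ : ℝ} {t : Fin m → ℝ} {ε : ℝ}

theorem b_pos (h : OutpostPotential Q a₀ b₀ t ε) : 0 < b₀ := h.a_nonneg.trans_lt h.a_lt_b

theorem t_pos (h : OutpostPotential Q a₀ b₀ t ε) (k : Fin m) : 0 < t k := h.b_pos.trans (h.b_lt k)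

theorem mem_iff (h : OutpostPotential Q a₀ b₀ t ε) (z : ℂ) :
    z ∈ coincidenceSet Q ↔ (a₀ ≤ ‖z‖ ∧ ‖z‖ ≤ b₀) ∨ ∃ k, ‖z‖ = t k := by
  rw [h.coincidence]; simp

theorem norm_ofReal {r : ℝ} (hr : 0 ≤ r) : ‖(r : ℂ)‖ = r := by
  rw [Complex.norm_real, Real.norm_of_nonneg hr]

theorem b_mem (h : OutpostPotential Q a₀ b₀ t ε) : (b₀ : ℂ) ∈ coincidenceSet Q := by
  rw [h.mem_iff, norm_ofReal h.b_pos.le]; exact Or.inl ⟨h.a_lt_b.le, le_rfl⟩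

theorem t_mem (h : OutpostPotential Q a₀ b₀ t ε) (k : Fin m) : (t k : ℂ) ∈ coincidenceSet Q := by
  rw [h.mem_iff, norm_ofReal (h.t_pos k).le]; exact Or.inr ⟨k, rfl⟩

theorem eventually_ne_top (h : OutpostPotential Q a₀ b₀ t ε) {z : ℂ} (hz : z ∈ coincidenceSet Q) :
    ∀ᶠ w in 𝓝 z, Q w ≠ ⊤ := by
  obtain ⟨U, hU, hSU, hfin, -⟩ := h.smooth
  filter_upwards [hU.mem_nhds (hSU hz)] with w hw using (hfin w hw).1

theorem contDiffAt (h : OutpostPotential Q a₀ b₀ t ε) {z : ℂ} (hz : z ∈ coincidenceSet Q) :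
    ContDiffAt ℝ 6 (fun w => (Q w).toReal) z := by
  obtain ⟨U, hU, hSU, -, hsm⟩ := h.smooth
  exact hsm.contDiffAt (hU.mem_nhds (hSU hz))

theorem contDiffAt_ofReal (h : OutpostPotential Q a₀ b₀ t ε) {r : ℝ}
    (hr : (r : ℂ) ∈ coincidenceSet Q) : ContDiffAt ℝ 6 (fun x : ℝ => (Q (x : ℂ)).toReal) r :=
  (h.contDiffAt hr).comp r Complex.ofRealCLM.contDiff.contDiffAt

theorem eventually_ne_top_ofReal (h : OutpostPotential Q a₀ b₀ t ε) {r : ℝ}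
    (hr : (r : ℂ) ∈ coincidenceSet Q) : ∀ᶠ x : ℝ in 𝓝 r, Q (x : ℂ) ≠ ⊤ :=
  (Complex.continuous_ofReal.tendsto r).eventually (h.eventually_ne_top hr)

theorem boltzmann_pos (h : OutpostPotential Q a₀ b₀ t ε) {z : ℂ} (hz : z ∈ coincidenceSet Q) :
    0 < boltzmann Q z := by
  rw [boltzmann_eq_exp_neg_toReal (h.ne_bot z) (h.eventually_ne_top hz).self_of_nhds]
  exact Real.exp_pos _

theorem boltzmann_radial (h : OutpostPotential Q a₀ b₀ t ε) (z : ℂ) :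
    boltzmann Q z = boltzmann Q (‖z‖ : ℂ) := by
  simp only [boltzmann]
  rw [h.rad z (‖z‖ : ℂ) (norm_ofReal (norm_nonneg z)).symm]

/-- At a maximum point of `r^λ e^{-Q(r)}` in the coincidence set, `Q' = λ / r`. -/
theorem deriv_of_isMax (h : OutpostPotential Q a₀ b₀ t ε) {p : ℝ} (hp : 0 < p)
    (hpS : (p : ℂ) ∈ coincidenceSet Q) {lam : ℝ}
    (hmax : ∀ z, ‖z‖ ^ lam * boltzmann Q z ≤ p ^ lam * boltzmann Q (p : ℂ)) :
    deriv (fun x : ℝ => (Q (x : ℂ)).toReal) p = lam / p := by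
  have hloc : IsLocalMax (fun x : ℝ => lam * Real.log x - (Q (x : ℂ)).toReal) p := by
    have key : ∀ x : ℝ, 0 < x → Q (x : ℂ) ≠ ⊤ →
        x ^ lam * boltzmann Q (x : ℂ) = Real.exp (lam * Real.log x - (Q (x : ℂ)).toReal) := by
      intro x hx hxQ
      rw [boltzmann_eq_exp_neg_toReal (h.ne_bot _) hxQ, Real.rpow_def_of_pos hx, ← Real.exp_add]
      congr 1; ring
    filter_upwards [h.eventually_ne_top_ofReal hpS, lt_mem_nhds hp] with x hx hx0
    have := hmax (x : ℂ)
    rw [norm_ofReal hx0.le, key x hx0 hx, key p hp (h.eventually_ne_top hpS).self_of_nhds] at this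
    exact Real.exp_le_exp.1 this
  have h0 := hloc.deriv_eq_zero
  have hd := ((Real.hasDerivAt_log hp.ne').const_mul lam).sub
    ((h.contDiffAt_ofReal hpS).differentiableAt (by norm_num)).hasDerivAt
  have h1 := hd.deriv
  have h2 : (fun x : ℝ => lam * Real.log x - (Q (x : ℂ)).toReal) =
    (fun y => lam * Real.log y) - fun x : ℝ => (Q (x : ℂ)).toReal := rfl
  rw [h2, h1] at h0
  rw [div_eq_mul_inv]; linarith

/-- An outpost cannot be the innermost maximum circle of `|z|² e^{-Q}`: otherwise, for `λ` slightly
below `2`, the maximum points of `|z|^λ e^{-Q}` would lie on the same circle, since further inside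
`|z|² e^{-Q}` stays strictly below its maximum and the region next to the circle contains no other
point of the coincidence set. This prescribes two different values for `Q'`. -/
theorem innermost_ne_outpost (h : OutpostPotential Q a₀ b₀ t ε) {z₀ : ℂ}
    (hpos : 0 < ‖z₀‖ ^ (2 : ℝ) * boltzmann Q z₀)
    (hmax : ∀ z, ‖z‖ ^ (2 : ℝ) * boltzmann Q z ≤ ‖z₀‖ ^ (2 : ℝ) * boltzmann Q z₀)
    (hmin : ∀ z, ‖z₀‖ ^ (2 : ℝ) * boltzmann Q z₀ ≤ ‖z‖ ^ (2 : ℝ) * boltzmann Q z → ‖z₀‖ ≤ ‖z‖)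
    (k : Fin m) : ‖z₀‖ ≠ t k := by
  intro hk
  set V := ‖z₀‖ ^ (2 : ℝ) * boltzmann Q z₀ with hV
  have hz₀ : 0 < ‖z₀‖ := by rw [hk]; exact h.t_pos k
  have hb0 : 0 < boltzmann Q z₀ := by
    refine h.boltzmann_pos ?_
    rw [h.mem_iff]; exact Or.inr ⟨k, hk⟩
  obtain ⟨K, hK0, hK⟩ := exists_boltzmann_le h.ne_bot h.lsc h.conf
  -- on the disc well inside the outpost the function stays below its maximum `V`
  have hgap0 : 0 ≤ t k - 2 * ε := by have := h.sep_b k; have := h.b_pos; linarith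
  obtain ⟨z', hz', hmax'⟩ := UpperSemicontinuousOn.exists_isMaxOn
    (⟨0, by simpa using hgap0⟩ : (Metric.closedBall (0 : ℂ) (t k - 2 * ε)).Nonempty)
    (isCompact_closedBall _ _)
    ((upperSemicontinuous_rpow_norm_mul_boltzmann h.ne_bot h.lsc
      (zero_le_two (α := ℝ))).upperSemicontinuousOn _)
  set V' := ‖z'‖ ^ (2 : ℝ) * boltzmann Q z' with hV'
  have hV'V : V' < V := by
    by_contra hcon
    have h1 := hmin z' (not_lt.1 hcon)
    have h2 : ‖z'‖ ≤ t k - 2 * ε := by simpa using hz'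
    have := h.eps_pos
    linarith
  set c := boltzmann Q z₀ / K with hc
  have hc0 : 0 < c := by positivity
  have hclim : Tendsto (fun δ : ℝ => c ^ δ) (𝓝[>] 0) (𝓝 1) := by
    have : Tendsto (fun δ : ℝ => c ^ δ) (𝓝 0) (𝓝 (c ^ (0 : ℝ))) :=
      (Real.continuous_const_rpow hc0.ne').tendsto 0
    rw [Real.rpow_zero] at this
    exact this.mono_left nhdsWithin_le_nhds
  have hev := hclim.eventually_const_lt ((div_lt_one hpos).2 hV'V)
  obtain ⟨δ, hδc, hδ0, hδ1⟩ := (hev.and (Ioo_mem_nhdsGT (zero_lt_one (α := ℝ)))).exists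
  obtain ⟨w, hwpos, hwmax⟩ := exists_max_rpow_norm_mul_boltzmann h.ne_bot h.lsc h.conf
    (p := z₀) (norm_pos_iff.1 hz₀) hb0 (lam := 2 - δ) (by linarith) (by linarith)
  have hwS := mem_coincidenceSet_of_isMax h.ne_bot h.lsc h.conf (lam := 2 - δ) (by linarith)
    (by linarith) hwpos hwmax
  have hw0 : 0 < ‖w‖ := by
    rcases (norm_nonneg w).eq_or_lt with h' | h'
    · rw [← h', Real.zero_rpow (by linarith)] at hwpos; simp at hwpos
    · exact h'
  have hsplit : ∀ z : ℂ, 0 < ‖z‖ → ‖z‖ ^ (2 : ℝ) * boltzmann Q z =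
      ‖z‖ ^ δ * (‖z‖ ^ (2 - δ) * boltzmann Q z) := by
    intro z hz
    rw [← mul_assoc, ← Real.rpow_add hz]; congr 2; ring
  have hVs : V = ‖z₀‖ ^ δ * (‖z₀‖ ^ (2 - δ) * boltzmann Q z₀) := hsplit z₀ hz₀
  have hwz := hwmax z₀
  have hwle : ‖w‖ ≤ ‖z₀‖ := by
    by_contra! hcon
    have h1 := hmax w
    rw [hsplit w hw0, hVs] at h1
    have h2 : ‖z₀‖ ^ δ < ‖w‖ ^ δ := Real.rpow_lt_rpow hz₀.le hcon hδ0
    have h3 : 0 < ‖z₀‖ ^ (2 - δ) * boltzmann Q z₀ := by positivity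
    have h4 : ‖w‖ ^ δ * (‖z₀‖ ^ (2 - δ) * boltzmann Q z₀) ≤
      ‖w‖ ^ δ * (‖w‖ ^ (2 - δ) * boltzmann Q w) := by gcongr
    nlinarith
  have hwne : ‖w‖ ≠ ‖z₀‖ := by
    intro heq
    have hp : 0 < t k := h.t_pos k
    have hbw : boltzmann Q w = boltzmann Q (t k : ℂ) := by
      rw [h.boltzmann_radial w, heq, hk]
    have hbz : boltzmann Q z₀ = boltzmann Q (t k : ℂ) := by
      rw [h.boltzmann_radial z₀, hk]
    have d1 := h.deriv_of_isMax hp (h.t_mem k) (lam := 2) (by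
      intro z; have := hmax z; rwa [hV, hk, hbz] at this)
    have d2 := h.deriv_of_isMax hp (h.t_mem k) (lam := 2 - δ) (by
      intro z; have := hwmax z; rwa [heq, hk, hbw] at this)
    rw [d1, div_left_inj' hp.ne'] at d2
    linarith
  have hwgap : ‖w‖ ≤ t k - 2 * ε := by
    have hε := h.eps_pos
    rcases (h.mem_iff w).1 hwS with h1 | ⟨l, hl⟩
    · have := h.sep_b k; linarith [h1.2]
    · rcases lt_trichotomy l k with hlk | hlk | hlk
      · have := h.sep_t l k hlk; linarith
      · rw [hlk, ← hk] at hl; exact absurd hl hwne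
      · have := h.sep_t k l hlk; linarith
  have hwV' : ‖w‖ ^ (2 : ℝ) * boltzmann Q w ≤ V' :=
    hmax' (show w ∈ Metric.closedBall (0 : ℂ) (t k - 2 * ε) by simpa using hwgap)
  have hx1 : ‖w‖ / ‖z₀‖ ≤ 1 := (div_le_one hz₀).2 hwle
  have hx0 : 0 < ‖w‖ / ‖z₀‖ := by positivity
  have hcx : c ≤ ‖w‖ / ‖z₀‖ := by
    have h1 : c ≤ (‖w‖ / ‖z₀‖) ^ (2 - δ) := by
      rw [Real.div_rpow hw0.le hz₀.le, hc, div_le_div_iff₀ hK0 (by positivity)]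
      calc boltzmann Q z₀ * ‖z₀‖ ^ (2 - δ) = ‖z₀‖ ^ (2 - δ) * boltzmann Q z₀ := mul_comm _ _
        _ ≤ ‖w‖ ^ (2 - δ) * boltzmann Q w := hwz
        _ ≤ ‖w‖ ^ (2 - δ) * K := by have := hK w; gcongr
    refine h1.trans ?_
    calc (‖w‖ / ‖z₀‖) ^ (2 - δ) ≤ (‖w‖ / ‖z₀‖) ^ (1 : ℝ) :=
          Real.rpow_le_rpow_of_exponent_ge hx0 hx1 (by linarith)
      _ = _ := Real.rpow_one _
  have hfin : c ^ δ ≤ V' / V := by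
    rw [le_div_iff₀ hpos]
    calc c ^ δ * V ≤ (‖w‖ / ‖z₀‖) ^ δ * V := by gcongr
      _ = ‖w‖ ^ δ * (‖z₀‖ ^ (2 - δ) * boltzmann Q z₀) := by
          rw [hVs, Real.div_rpow hw0.le hz₀.le]
          have : ‖z₀‖ ^ δ ≠ 0 := (Real.rpow_pos_of_pos hz₀ _).ne'
          field_simp
      _ ≤ ‖w‖ ^ δ * (‖w‖ ^ (2 - δ) * boltzmann Q w) := by gcongr
      _ = ‖w‖ ^ (2 : ℝ) * boltzmann Q w := (hsplit w hw0).symm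
      _ ≤ V' := hwV'
  linarith

/-- The Laplacian of `Q` in polar coordinates; the factor is `4` as `ΔQ` is a quarter of the usual
Laplacian. -/
theorem quarterLaplacian_eq (h : OutpostPotential Q a₀ b₀ t ε) {p : ℝ} (hp : 0 < p)
    (hpS : (p : ℂ) ∈ coincidenceSet Q) :
    4 * quarterLaplacian Q (p : ℂ) =
      deriv (deriv fun x : ℝ => (Q (x : ℂ)).toReal) p +
        deriv (fun x : ℝ => (Q (x : ℂ)).toReal) p / p := by
  rw [quarterLaplacian, laplacian_of_radial (fun z w hzw => by rw [h.rad z w hzw]) hp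
    ((h.contDiffAt hpS).of_le (by norm_num))]
  ring

/-- `|z|² e^{-Q}` attains its maximum on the circle `|z| = b₀`, and not inside of it. -/
theorem isMax_b (h : OutpostPotential Q a₀ b₀ t ε) :
    (∀ z, ‖z‖ ^ (2 : ℝ) * boltzmann Q z ≤ b₀ ^ (2 : ℝ) * boltzmann Q b₀) ∧
      ∀ z, b₀ ^ (2 : ℝ) * boltzmann Q b₀ ≤ ‖z‖ ^ (2 : ℝ) * boltzmann Q z → b₀ ≤ ‖z‖ := by
  obtain ⟨z₁, hpos₁, hmax₁⟩ := exists_max_rpow_norm_mul_boltzmann h.ne_bot h.lsc h.conf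
    (p := (b₀ : ℂ)) (by exact_mod_cast h.b_pos.ne') (h.boltzmann_pos h.b_mem) (lam := 2)
    two_pos le_rfl
  set V := ‖z₁‖ ^ (2 : ℝ) * boltzmann Q z₁ with hV
  -- the innermost maximum circle
  have hclosed : IsClosed {z : ℂ | V ≤ ‖z‖ ^ (2 : ℝ) * boltzmann Q z} :=
    (upperSemicontinuous_rpow_norm_mul_boltzmann h.ne_bot h.lsc
      (zero_le_two (α := ℝ))).isClosed_preimage V
  obtain ⟨z₀, hz₀mem, hz₀dist⟩ := hclosed.exists_infDist_eq_dist
    ⟨z₁, show V ≤ ‖z₁‖ ^ (2 : ℝ) * boltzmann Q z₁ from le_rfl⟩ 0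
  have hVz : ‖z₀‖ ^ (2 : ℝ) * boltzmann Q z₀ = V := le_antisymm (hmax₁ z₀) hz₀mem
  have hmin : ∀ z, V ≤ ‖z‖ ^ (2 : ℝ) * boltzmann Q z → ‖z₀‖ ≤ ‖z‖ := by
    intro z hz
    have : dist (0 : ℂ) z₀ ≤ dist 0 z := by
      rw [← hz₀dist]; exact Metric.infDist_le_dist_of_mem hz
    simpa using this
  have hpos : 0 < ‖z₀‖ ^ (2 : ℝ) * boltzmann Q z₀ := by rw [hVz]; exact hpos₁
  have hmax : ∀ z, ‖z‖ ^ (2 : ℝ) * boltzmann Q z ≤ ‖z₀‖ ^ (2 : ℝ) * boltzmann Q z₀ := by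
    rw [hVz]; exact hmax₁
  have hz₀S := mem_coincidenceSet_of_isMax h.ne_bot h.lsc h.conf two_pos le_rfl hpos hmax
  have hz₀0 : 0 < ‖z₀‖ := by
    rcases (norm_nonneg z₀).eq_or_lt with h' | h'
    · rw [← h', Real.zero_rpow two_ne_zero] at hpos; simp at hpos
    · exact h'
  have hann : a₀ ≤ ‖z₀‖ ∧ ‖z₀‖ ≤ b₀ := by
    rcases (h.mem_iff z₀).1 hz₀S with h1 | ⟨k, hk⟩
    · exact h1
    · exact absurd hk (h.innermost_ne_outpost hpos hmax (by rw [hVz]; exact hmin) k)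
  have heq : ‖z₀‖ = b₀ := by
    by_contra hne
    have hlt : ‖z₀‖ < b₀ := lt_of_le_of_ne hann.2 hne
    -- on the annulus between, `Q = 2 log |z| + const` is harmonic
    have hconst : ∀ r : ℝ, ‖z₀‖ ≤ r → r ≤ b₀ →
        (Q (r : ℂ)).toReal = 2 * Real.log r - Real.log V := by
      intro r hr1 hr2
      have hr0 : 0 < r := hz₀0.trans_le hr1
      have hrS : (r : ℂ) ∈ coincidenceSet Q := by
        rw [h.mem_iff, norm_ofReal hr0.le]; exact Or.inl ⟨hann.1.trans hr1, hr2⟩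
      have h1 := isMax_of_mem_coincidenceSet h.ne_bot h.rad hpos
        (by rw [norm_ofReal hr0.le]; exact hr1) hrS
      have h2 : V = r ^ (2 : ℝ) * boltzmann Q (r : ℂ) := by
        have := hmax (r : ℂ)
        rw [norm_ofReal hr0.le] at this h1
        rw [← hVz]; exact le_antisymm h1 this
      rw [h2, Real.log_mul (by positivity) (h.boltzmann_pos hrS).ne', Real.log_rpow hr0,
        boltzmann_eq_exp_neg_toReal (h.ne_bot _) (h.eventually_ne_top hrS).self_of_nhds,
        Real.log_exp]
      ring
    obtain ⟨p, hp1, hp2⟩ := exists_between hlt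
    have hp0 : 0 < p := hz₀0.trans hp1
    have hpS : (p : ℂ) ∈ coincidenceSet Q := by
      rw [h.mem_iff, norm_ofReal hp0.le]; exact Or.inl ⟨hann.1.trans hp1.le, hp2.le⟩
    have hd : ∀ r ∈ Set.Ioo ‖z₀‖ b₀, deriv (fun x : ℝ => (Q (x : ℂ)).toReal) r = 2 * r⁻¹ := by
      intro r hr
      have h1 : (fun x : ℝ => (Q (x : ℂ)).toReal) =ᶠ[𝓝 r]
          fun x => 2 * Real.log x - Real.log V := by
        filter_upwards [Ioo_mem_nhds hr.1 hr.2] with x hx using hconst x hx.1.le hx.2.le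
      rw [h1.deriv_eq, deriv_sub_const, deriv_const_mul_field, Real.deriv_log]
    have hdd : deriv (deriv fun x : ℝ => (Q (x : ℂ)).toReal) p = 2 * (-(p ^ 2)⁻¹) := by
      have h1 : (deriv fun x : ℝ => (Q (x : ℂ)).toReal) =ᶠ[𝓝 p] fun x => 2 * x⁻¹ := by
        filter_upwards [Ioo_mem_nhds hp1 hp2] with x hx using hd x hx
      rw [h1.deriv_eq, deriv_const_mul_field, deriv_inv]
    have h1 := h.quarterLaplacian_eq hp0 hpS
    have h2 := h.lap_pos _ hpS
    rw [hdd, hd p ⟨hp1, hp2⟩] at h1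
    have h3 : 2 * (-(p ^ 2)⁻¹) + 2 * p⁻¹ / p = 0 := by field_simp; ring
    rw [h3] at h1
    linarith
  have hVb : b₀ ^ (2 : ℝ) * boltzmann Q b₀ = V := by
    rw [← hVz, h.boltzmann_radial z₀, heq]
  rw [hVb, ← heq]
  exact ⟨hmax₁, hmin⟩

end OutpostPotential

/-! ### The radial profile and its peaks -/

/-- A nonnegative function `ψ ≤ 1` on `(0, ∞)` which reaches the value `1` in finitely many
nondegenerate peaks `pos i`, with `-log ψ ≈ κ i (r - pos i)² / 2` there, and which is integrable with
respect to `dr / r`, with `ψ = O(r²)` at `0`. -/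
structure PeakProfile {ι : Type*} (ψ : ℝ → ℝ) (pos κ : ι → ℝ) : Prop where
  measurable : Measurable ψ
  nonneg : ∀ r, 0 ≤ ψ r
  pos_pos : ∀ i, 0 < pos i
  κ_pos : ∀ i, 0 < κ i
  le_one : ∀ r, 0 < r → ψ r ≤ 1
  gap : ∀ η, 0 < η → ∃ c, 0 < c ∧ ∀ r, 0 < r → (∀ i, η ≤ |r - pos i|) → ψ r ≤ Real.exp (-c)
  peak : ∀ i, ∃ δ C : ℝ, 0 < δ ∧ 0 ≤ C ∧ ∀ r, |r - pos i| < δ →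
    ∃ φ : ℝ, ψ r = Real.exp (-φ) ∧ |φ - κ i / 2 * (r - pos i) ^ 2| ≤ C * |r - pos i| ^ 3
  small : ∃ A, 0 < A ∧ ∀ r, 0 < r → ψ r ≤ A * r ^ 2
  integrable : IntegrableOn (fun r => ψ r / r) (Set.Ioi 0)

/-- The positions of the peaks: the outer boundary of the annulus, and the outposts. -/
def peakPos {m : ℕ} (b₀ : ℝ) (t : Fin m → ℝ) : Option (Fin m) → ℝ := fun i => i.elim b₀ t

namespace OutpostPotential

variable {Q : ℂ → EReal} {m : ℕ} {a₀ b₀ : ℝ} {t : Fin m → ℝ} {ε : ℝ}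

/-- The maximum value of `|z|² e^{-Q}`. -/
def topValue (Q : ℂ → EReal) (b₀ : ℝ) : ℝ := b₀ ^ 2 * boltzmann Q b₀

/-- The normalised radial profile `r² e^{-Q(r)} / max`. -/
def profile (Q : ℂ → EReal) (b₀ : ℝ) (r : ℝ) : ℝ := r ^ 2 * boltzmann Q r / topValue Q b₀

theorem topValue_pos (h : OutpostPotential Q a₀ b₀ t ε) : 0 < topValue Q b₀ :=
  mul_pos (pow_pos h.b_pos 2) (h.boltzmann_pos h.b_mem)

theorem profile_le_one (h : OutpostPotential Q a₀ b₀ t ε) (r : ℝ) : profile Q b₀ r ≤ 1 := by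
  rw [profile, div_le_one h.topValue_pos, topValue]
  have := h.isMax_b.1 (r : ℂ)
  rw [Real.rpow_two, Real.rpow_two, Complex.norm_real, Real.norm_eq_abs, sq_abs] at this
  exact this

theorem peakPos_mem (h : OutpostPotential Q a₀ b₀ t ε) (i : Option (Fin m)) :
    (peakPos b₀ t i : ℂ) ∈ coincidenceSet Q := by
  rcases i with _ | k
  · exact h.b_mem
  · exact h.t_mem k

theorem peakPos_pos (h : OutpostPotential Q a₀ b₀ t ε) (i : Option (Fin m)) :
    0 < peakPos b₀ t i := by
  rcases i with _ | k
  · exact h.b_pos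
  · exact h.t_pos k

/-- At the outposts this is the maximum principle: they lie outside the maximum circle `|z| = b₀`. -/
theorem profile_peakPos (h : OutpostPotential Q a₀ b₀ t ε) (i : Option (Fin m)) :
    profile Q b₀ (peakPos b₀ t i) = 1 := by
  refine le_antisymm (h.profile_le_one _) ?_
  rw [profile, one_le_div h.topValue_pos, topValue]
  rcases i with _ | k
  · exact le_rfl
  · have hb := h.topValue_pos
    have := isMax_of_mem_coincidenceSet (Q := Q) h.ne_bot h.rad (z₀ := (b₀ : ℂ)) (z₁ := (t k : ℂ))
      (by rw [norm_ofReal h.b_pos.le, Real.rpow_two]; exact hb)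
      (by rw [norm_ofReal h.b_pos.le, norm_ofReal (h.t_pos k).le]; exact (h.b_lt k).le) (h.t_mem k)
    rwa [norm_ofReal h.b_pos.le, norm_ofReal (h.t_pos k).le, Real.rpow_two, Real.rpow_two] at this

theorem measurable_profile (h : OutpostPotential Q a₀ b₀ t ε) : Measurable (profile Q b₀) := by
  have h1 : Measurable (boltzmann Q) :=
    (upperSemicontinuous_boltzmann h.ne_bot h.lsc).measurable
  have h2 : Measurable fun r : ℝ => boltzmann Q (r : ℂ) := h1.comp Complex.measurable_ofReal
  exact ((measurable_id.pow_const 2).mul h2).div_const _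

theorem profile_nonneg (h : OutpostPotential Q a₀ b₀ t ε) (r : ℝ) : 0 ≤ profile Q b₀ r :=
  div_nonneg (mul_nonneg (sq_nonneg r) (boltzmann_nonneg Q r)) h.topValue_pos.le

/-- Away from the peaks the profile stays below `1`: by upper semicontinuity the supremum is attained,
and maximum points belong to the coincidence set but not to the interior of the disc `|z| ≤ b₀`. -/
theorem profile_gap (h : OutpostPotential Q a₀ b₀ t ε) {η : ℝ} (hη : 0 < η) :
    ∃ c, 0 < c ∧ ∀ r, 0 < r → (∀ i, η ≤ |r - peakPos b₀ t i|) →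
      profile Q b₀ r ≤ Real.exp (-c) := by
  have hV := h.topValue_pos
  obtain ⟨a, R, ha, hR, hdec⟩ := exists_boltzmann_le_rpow h.ne_bot h.conf
  have ht : Tendsto (fun r : ℝ => r ^ (-(2 * a - 2))) atTop (𝓝 0) :=
    tendsto_rpow_neg_atTop (by linarith)
  obtain ⟨R', hR'⟩ := eventually_atTop.1 (ht.eventually_lt_const (half_pos hV))
  set R₁ := max R R'
  set S : Set ℂ := Metric.closedBall (0 : ℂ) R₁ ∩ {z | ∀ i, η ≤ |‖z‖ - peakPos b₀ t i|} with hS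
  have hSc : IsCompact S := by
    refine (isCompact_closedBall _ _).inter_right ?_
    simp only [Set.ofPred_forall]
    exact isClosed_iInter fun i => isClosed_le continuous_const (by fun_prop)
  -- the supremum over the compact part is below `1`
  obtain ⟨q, hq1, hq⟩ : ∃ q, q < topValue Q b₀ ∧
      ∀ z ∈ S, ‖z‖ ^ (2 : ℝ) * boltzmann Q z ≤ q := by
    rcases S.eq_empty_or_nonempty with hE | hne
    · exact ⟨0, hV, fun z hz => by rw [hE] at hz; exact absurd hz (Set.notMem_empty z)⟩
    · obtain ⟨w, hwS, hwmax⟩ := UpperSemicontinuousOn.exists_isMaxOn hne hSc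
        ((upperSemicontinuous_rpow_norm_mul_boltzmann h.ne_bot h.lsc
          (zero_le_two (α := ℝ))).upperSemicontinuousOn _)
      refine ⟨_, ?_, fun z hz => hwmax hz⟩
      by_contra! hcon
      have hb := h.isMax_b
      rw [topValue, ← Real.rpow_two] at hcon
      have hwb := hb.2 w hcon
      have hwpos : 0 < ‖w‖ ^ (2 : ℝ) * boltzmann Q w := by
        refine lt_of_lt_of_le ?_ hcon
        rw [Real.rpow_two]; exact hV
      have hwS' := mem_coincidenceSet_of_isMax h.ne_bot h.lsc h.conf two_pos le_rfl hwpos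
        fun z => (hb.1 z).trans hcon
      rcases (h.mem_iff w).1 hwS' with h1 | ⟨k, hk⟩
      · have h2 : ‖w‖ = b₀ := le_antisymm h1.2 hwb
        have := hwS.2 none
        simp only [peakPos, Option.elim, h2, sub_self, abs_zero] at this
        linarith
      · have := hwS.2 (some k)
        simp only [peakPos, Option.elim, hk, sub_self, abs_zero] at this
        linarith
  set q' := max q (topValue Q b₀ / 2)
  have hq'0 : 0 < q' := (half_pos hV).trans_le (le_max_right _ _)
  have hq'1 : q' < topValue Q b₀ := max_lt hq1 (half_lt_self hV)
  refine ⟨-Real.log (q' / topValue Q b₀), ?_, fun r hr hri => ?_⟩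
  · have := Real.log_neg (div_pos hq'0 hV) ((div_lt_one hV).2 hq'1)
    linarith
  · rw [neg_neg, Real.exp_log (div_pos hq'0 hV), profile]
    gcongr
    have hn : ‖(r : ℂ)‖ = r := norm_ofReal hr.le
    rcases le_total r R₁ with hrR | hrR
    · have := hq (r : ℂ) ⟨by simpa [abs_of_pos hr] using hrR, by
        simp only [Set.mem_ofPred_eq, hn]; exact hri⟩
      rw [hn, Real.rpow_two] at this
      exact this.trans (le_max_left _ _)
    · have h1 := hdec (r : ℂ) (by rw [hn]; exact (le_max_left _ _).trans hrR)
      have h2 := hR' r ((le_max_right _ _).trans hrR)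
      rw [hn] at h1
      refine le_trans ?_ (h2.le.trans (le_max_right _ _))
      calc r ^ 2 * boltzmann Q r ≤ r ^ 2 * r ^ (-(2 * a)) := by gcongr
        _ = r ^ (-(2 * a - 2)) := by
          rw [← Real.rpow_two, ← Real.rpow_add hr]; congr 1; ring

/-- At a peak `Q - 2 log r` is critical, so its second derivative there is `Q'' + Q' / r = 4 ΔQ`. -/
theorem profile_peak (h : OutpostPotential Q a₀ b₀ t ε) (i : Option (Fin m)) :
    ∃ δ C : ℝ, 0 < δ ∧ 0 ≤ C ∧ ∀ r, |r - peakPos b₀ t i| < δ →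
      ∃ φ : ℝ, profile Q b₀ r = Real.exp (-φ) ∧
        |φ - 4 * quarterLaplacian Q (peakPos b₀ t i) / 2 * (r - peakPos b₀ t i) ^ 2| ≤
          C * |r - peakPos b₀ t i| ^ 3 := by
  set p := peakPos b₀ t i with hp
  have hp0 : 0 < p := h.peakPos_pos i
  have hpS : (p : ℂ) ∈ coincidenceSet Q := h.peakPos_mem i
  have hV := h.topValue_pos
  set g : ℝ → ℝ := fun x => (Q (x : ℂ)).toReal with hg
  set f : ℝ → ℝ := fun x => g x - 2 * Real.log x + Real.log (topValue Q b₀) with hf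
  have hev : ∀ᶠ x : ℝ in 𝓝 p, 0 < x ∧ Q (x : ℂ) ≠ ⊤ :=
    (lt_mem_nhds hp0).and (h.eventually_ne_top_ofReal hpS)
  have key : ∀ x : ℝ, 0 < x → Q (x : ℂ) ≠ ⊤ → profile Q b₀ x = Real.exp (-f x) := by
    intro x hx hxQ
    rw [profile, boltzmann_eq_exp_neg_toReal (h.ne_bot _) hxQ]
    have h1 : -f x = Real.log x + Real.log x + -(Q (x : ℂ)).toReal - Real.log (topValue Q b₀) := by
      simp only [hf, hg]; ring
    rw [h1, Real.exp_sub, Real.exp_add, Real.exp_add, Real.exp_log hx, Real.exp_log hV, sq]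
  have hf0 : f p = 0 := by
    have h1 := key p hp0 hev.self_of_nhds.2
    rw [hp, h.profile_peakPos i, ← hp] at h1
    have := Real.exp_eq_one_iff (-f p)
    linarith [this.1 h1.symm]
  have hgd : ContDiffAt ℝ 6 g p := h.contDiffAt_ofReal hpS
  have hlog : ContDiffAt ℝ 6 Real.log p := Real.contDiffAt_log.2 hp0.ne'
  have hfd : ContDiffAt ℝ 6 f p := (hgd.sub (contDiffAt_const.mul hlog)).add contDiffAt_const
  have hloc : IsLocalMin f p := by
    filter_upwards [hev] with x hx
    have h1 := h.profile_le_one x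
    rw [key x hx.1 hx.2, Real.exp_le_one_iff] at h1
    linarith
  have hf1 : deriv f p = 0 := hloc.deriv_eq_zero
  have hderiv : ∀ x, 0 < x → DifferentiableAt ℝ g x → deriv f x = deriv g x - 2 * x⁻¹ := by
    intro x hx hgx
    exact ((hgx.hasDerivAt.sub ((Real.hasDerivAt_log hx.ne').const_mul 2)).add_const _).deriv
  have hgev : ∀ᶠ x in 𝓝 p, ContDiffAt ℝ 6 g x := hgd.eventually (by simp)
  have hf2 : deriv (deriv f) p = 4 * quarterLaplacian Q (p : ℂ) := by
    have h1 : deriv f =ᶠ[𝓝 p] fun x => deriv g x - 2 * x⁻¹ := by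
      filter_upwards [hgev, lt_mem_nhds hp0] with x hx hx0
      exact hderiv x hx0 (hx.differentiableAt (by norm_num))
    have hg1 : ContDiffAt ℝ 1 (deriv g) p := hgd.derivWithin (by norm_num)
    have h2 := (hg1.differentiableAt one_ne_zero).hasDerivAt.sub
      ((hasDerivAt_inv hp0.ne').const_mul 2)
    have h3 := hderiv p hp0 (hgd.differentiableAt (by norm_num))
    rw [hf1] at h3
    have h4 : deriv g p = 2 * p⁻¹ := by linarith
    rw [h1.deriv_eq, h.quarterLaplacian_eq hp0 hpS]
    refine h2.deriv.trans ?_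
    change _ = deriv (deriv g) p + deriv g p / p
    rw [h4]
    field_simp
    ring
  obtain ⟨δ₁, C, hδ₁, hC, hbound⟩ :=
    exists_taylor_bound_of_deriv_eq_zero (hfd.of_le (by norm_num)) hf0 hf1
  obtain ⟨δ₂, hδ₂, hball⟩ := Metric.eventually_nhds_iff.1 hev
  refine ⟨min δ₁ δ₂, C, lt_min hδ₁ hδ₂, hC, fun r hr => ⟨f r, ?_, ?_⟩⟩
  · have := hball (y := r) (by rw [Real.dist_eq]; exact hr.trans_le (min_le_right _ _))
    exact key r this.1 this.2
  · rw [← hf2]; exact hbound r (hr.trans_le (min_le_left _ _))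

theorem integrableOn_profile_div (h : OutpostPotential Q a₀ b₀ t ε) :
    IntegrableOn (fun r => profile Q b₀ r / r) (Set.Ioi 0) := by
  have hV := h.topValue_pos
  obtain ⟨a, R, ha, hR, hdec⟩ := exists_boltzmann_le_rpow h.ne_bot h.conf
  obtain ⟨K, hK0, hK⟩ := exists_boltzmann_le h.ne_bot h.lsc h.conf
  have hm : Measurable fun r => profile Q b₀ r / r := h.measurable_profile.div measurable_id
  have hform : ∀ r : ℝ, 0 < r → profile Q b₀ r / r = r * boltzmann Q r / topValue Q b₀ := by
    intro r hr
    rw [profile]; field_simp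
  have h1 : IntegrableOn (fun r => profile Q b₀ r / r) (Set.Ioc 0 R) := by
    refine Measure.integrableOn_of_bounded (M := R * K / topValue Q b₀) (by simp)
      hm.aestronglyMeasurable ?_
    filter_upwards [ae_restrict_mem measurableSet_Ioc] with r hr
    rw [Real.norm_of_nonneg (div_nonneg (h.profile_nonneg r) hr.1.le), hform r hr.1]
    have := boltzmann_nonneg Q r
    have := hK r
    have := hr.2
    have := hr.1
    gcongr
  have h2 : IntegrableOn (fun r => profile Q b₀ r / r) (Set.Ioi R) := by
    have hi : IntegrableOn (fun r : ℝ => r ^ (1 - 2 * a) / topValue Q b₀) (Set.Ioi R) :=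
      (integrableOn_Ioi_rpow_of_lt (by linarith) (by linarith)).div_const _
    refine hi.mono' hm.aestronglyMeasurable ?_
    filter_upwards [ae_restrict_mem measurableSet_Ioi] with r hr
    have hr' : R < r := hr
    have hr0 : 0 < r := by linarith
    rw [Real.norm_of_nonneg (div_nonneg (h.profile_nonneg r) hr0.le), hform r hr0]
    have h3 := hdec (r : ℂ) (by rw [norm_ofReal hr0.le]; exact hr'.le)
    rw [norm_ofReal hr0.le] at h3
    have h4 : r ^ (1 - 2 * a) = r * r ^ (-(2 * a)) := by
      rw [sub_eq_add_neg, Real.rpow_add hr0, Real.rpow_one]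
    rw [h4]
    gcongr
  have := h1.union h2
  rwa [Set.Ioc_union_Ioi_eq_Ioi (by linarith)] at this

theorem peakProfile (h : OutpostPotential Q a₀ b₀ t ε) :
    PeakProfile (profile Q b₀) (peakPos b₀ t)
      (fun i => 4 * quarterLaplacian Q (peakPos b₀ t i : ℂ)) where
  measurable := h.measurable_profile
  nonneg := h.profile_nonneg
  pos_pos := h.peakPos_pos
  κ_pos i := mul_pos (by norm_num) (h.lap_pos _ (h.peakPos_mem i))
  le_one r _ := h.profile_le_one r
  gap _ hη := h.profile_gap hη
  peak := h.profile_peak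
  small := by
    obtain ⟨K, hK0, hK⟩ := exists_boltzmann_le h.ne_bot h.lsc h.conf
    have hV := h.topValue_pos
    refine ⟨K / topValue Q b₀, by positivity, fun r _ => ?_⟩
    rw [profile, div_mul_eq_mul_div, mul_comm]
    have := hK r
    gcongr
  integrable := h.integrableOn_profile_div

end OutpostPotential

/-! ### Integration against the squared Vandermonde determinant -/

instance isAddHaarMeasure_areaMeasure : areaMeasure.IsAddHaarMeasure :=
  Measure.IsAddHaarMeasure.smul volume
    (ENNReal.inv_ne_zero.2 ENNReal.ofReal_ne_top)
    (ENNReal.inv_ne_top.2 (ENNReal.ofReal_pos.2 Real.pi_pos).ne')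

theorem measurePreserving_rotation_areaMeasure (c : Circle) :
    MeasurePreserving (fun z : ℂ => (c : ℂ) * z) areaMeasure areaMeasure :=
  ((rotation c).measurePreserving).smul_measure _

/-- Distinct monomials are orthogonal with respect to a radial weight: a rotation which changes the
sign of `z^a conj(z)^b` preserves the measure. -/
theorem integral_monomial_mul_radial_eq_zero {g : ℂ → ℂ} (hg : ∀ z w : ℂ, ‖z‖ = ‖w‖ → g z = g w)
    {a b : ℕ} (hab : a ≠ b) :
    ∫ z, z ^ a * (starRingEnd ℂ) z ^ b * g z ∂areaMeasure = 0 := by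
  set θ : ℝ := Real.pi / ((a : ℝ) - b) with hθ
  have hab' : ((a : ℝ) - b) ≠ 0 := sub_ne_zero.2 (by exact_mod_cast hab)
  set c : Circle := Circle.exp θ with hc
  have hcab : (c : ℂ) ^ a * (starRingEnd ℂ) (c : ℂ) ^ b = -1 := by
    rw [← Circle.coe_inv_eq_conj, ← Circle.coe_pow, ← Circle.coe_pow, ← Circle.coe_mul]
    have : c ^ a * c⁻¹ ^ b = Circle.exp Real.pi := by
      rw [hc, ← Circle.exp_neg, ← Circle.exp_natCast_mul, ← Circle.exp_natCast_mul,
        ← Circle.exp_add]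
      congr 1
      rw [hθ]; field_simp; ring
    rw [this, Circle.coe_exp, Complex.exp_pi_mul_I]
  have hemb : MeasurableEmbedding fun z : ℂ => (c : ℂ) * z :=
    (rotation c).toHomeomorph.measurableEmbedding
  have h1 := (measurePreserving_rotation_areaMeasure c).integral_comp hemb
    (fun z => z ^ a * (starRingEnd ℂ) z ^ b * g z)
  have h2 : (fun z : ℂ => ((c : ℂ) * z) ^ a * (starRingEnd ℂ) ((c : ℂ) * z) ^ b * g ((c : ℂ) * z)) =
      fun z => -(z ^ a * (starRingEnd ℂ) z ^ b * g z) := by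
    funext z
    rw [hg ((c : ℂ) * z) z (by rw [norm_mul, Circle.norm_coe, one_mul]), map_mul, mul_pow, mul_pow]
    linear_combination (z ^ a * (starRingEnd ℂ) z ^ b * g z) * hcab
  rw [h2, integral_neg] at h1
  exact self_eq_neg.1 h1.symm

/-- The squared Vandermonde determinant as a double sum over permutations. -/
theorem prod_norm_sub_sq_eq_sum {n : ℕ} (z : Fin n → ℂ) :
    ((∏ j, ∏ k ∈ Finset.Ioi j, ‖z k - z j‖ ^ 2 : ℝ) : ℂ) =
      ∑ σ : Equiv.Perm (Fin n), ∑ τ : Equiv.Perm (Fin n),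
        ((Equiv.Perm.sign σ : ℤ) : ℂ) * ((Equiv.Perm.sign τ : ℤ) : ℂ) *
          ∏ i, (z i ^ (σ i : ℕ) * (starRingEnd ℂ) (z i) ^ (τ i : ℕ)) := by
  have hdet : (Matrix.vandermonde z).det =
      ∑ σ : Equiv.Perm (Fin n), ((Equiv.Perm.sign σ : ℤ) : ℂ) * ∏ i, z i ^ (σ i : ℕ) := by
    rw [← Matrix.det_transpose, Matrix.det_apply']
    simp [Matrix.vandermonde_apply]
  have h1 : ((∏ j, ∏ k ∈ Finset.Ioi j, ‖z k - z j‖ ^ 2 : ℝ) : ℂ) =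
      (Matrix.vandermonde z).det * (starRingEnd ℂ) (Matrix.vandermonde z).det := by
    rw [Matrix.det_vandermonde, map_prod, ← Finset.prod_mul_distrib]
    push_cast
    refine Finset.prod_congr rfl fun j _ => ?_
    rw [map_prod, ← Finset.prod_mul_distrib]
    refine Finset.prod_congr rfl fun k _ => ?_
    rw [Complex.mul_conj, Complex.normSq_eq_norm_sq]
    push_cast; rfl
  rw [h1, hdet, map_sum, Finset.sum_mul_sum]
  refine Finset.sum_congr rfl fun σ _ => Finset.sum_congr rfl fun τ _ => ?_
  rw [map_mul, map_prod, Finset.prod_mul_distrib]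
  simp only [map_pow, map_intCast]
  ring

theorem integrable_prod_norm_sub_sq_mul {n : ℕ} {g : ℂ → ℂ}
    (hint : ∀ a b : ℕ, a < n → b < n →
      Integrable (fun z => z ^ a * (starRingEnd ℂ) z ^ b * g z) areaMeasure) :
    Integrable (fun z : Fin n → ℂ =>
      ((∏ j, ∏ k ∈ Finset.Ioi j, ‖z k - z j‖ ^ 2 : ℝ) : ℂ) * ∏ j, g (z j))
      (Measure.pi fun _ : Fin n => areaMeasure) := by
  simp_rw [prod_norm_sub_sq_eq_sum, Finset.sum_mul]
  refine integrable_finsetSum _ fun σ _ => integrable_finsetSum _ fun τ _ => ?_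
  simp_rw [mul_assoc _ (∏ i, _) (∏ i, _), ← Finset.prod_mul_distrib]
  exact (Integrable.fintype_prod (f := fun i z => z ^ (σ i : ℕ) * (starRingEnd ℂ) z ^ (τ i : ℕ) * g z)
    fun i => hint _ _ (σ i).2 (τ i).2).const_mul _

/-- Integrals of multiplicative radial statistics against the squared Vandermonde determinant are
products of one-dimensional integrals. -/
theorem integral_prod_norm_sub_sq_mul {n : ℕ} {g : ℂ → ℂ}
    (hg : ∀ z w : ℂ, ‖z‖ = ‖w‖ → g z = g w)
    (hint : ∀ a b : ℕ, a < n → b < n →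
      Integrable (fun z => z ^ a * (starRingEnd ℂ) z ^ b * g z) areaMeasure) :
    ∫ z : Fin n → ℂ, ((∏ j, ∏ k ∈ Finset.Ioi j, ‖z k - z j‖ ^ 2 : ℝ) : ℂ) * ∏ j, g (z j)
      ∂(Measure.pi fun _ : Fin n => areaMeasure) =
    (n.factorial : ℂ) * ∏ j : Fin n, ∫ z, (‖z‖ : ℂ) ^ (2 * (j : ℕ)) * g z ∂areaMeasure := by
  have hI : ∀ σ τ : Equiv.Perm (Fin n), Integrable (fun z : Fin n → ℂ =>
      ((Equiv.Perm.sign σ : ℤ) : ℂ) * ((Equiv.Perm.sign τ : ℤ) : ℂ) *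
        ∏ i, (z i ^ (σ i : ℕ) * (starRingEnd ℂ) (z i) ^ (τ i : ℕ) * g (z i)))
      (Measure.pi fun _ : Fin n => areaMeasure) := fun σ τ =>
    (Integrable.fintype_prod (f := fun i z => z ^ (σ i : ℕ) * (starRingEnd ℂ) z ^ (τ i : ℕ) * g z)
      fun i => hint _ _ (σ i).2 (τ i).2).const_mul _
  simp_rw [prod_norm_sub_sq_eq_sum, Finset.sum_mul, mul_assoc _ (∏ i, _) (∏ i, _),
    ← Finset.prod_mul_distrib]
  rw [integral_finsetSum _ fun σ _ => integrable_finsetSum _ fun τ _ => hI σ τ]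
  have hterm : ∀ σ τ : Equiv.Perm (Fin n), ∫ z : Fin n → ℂ,
      ((Equiv.Perm.sign σ : ℤ) : ℂ) * ((Equiv.Perm.sign τ : ℤ) : ℂ) *
        ∏ i, (z i ^ (σ i : ℕ) * (starRingEnd ℂ) (z i) ^ (τ i : ℕ) * g (z i))
      ∂(Measure.pi fun _ : Fin n => areaMeasure) =
      if σ = τ then ∏ j : Fin n, ∫ z, (‖z‖ : ℂ) ^ (2 * (j : ℕ)) * g z ∂areaMeasure else 0 := by
    intro σ τ
    rw [integral_const_mul, integral_fintype_prod_eq_prod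
      (fun i z => z ^ (σ i : ℕ) * (starRingEnd ℂ) z ^ (τ i : ℕ) * g z)]
    split_ifs with h
    · subst h
      have hs : ((Equiv.Perm.sign σ : ℤ) : ℂ) * ((Equiv.Perm.sign σ : ℤ) : ℂ) = 1 := by
        rcases Int.units_eq_one_or (Equiv.Perm.sign σ) with h | h <;> simp [h]
      rw [hs, one_mul]
      rw [← Equiv.prod_comp σ fun j : Fin n =>
        ∫ z, (‖z‖ : ℂ) ^ (2 * (j : ℕ)) * g z ∂areaMeasure]
      refine Finset.prod_congr rfl fun i _ => integral_congr_ae (Eventually.of_forall fun z => ?_)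
      simp only
      rw [← mul_pow, Complex.mul_conj, Complex.normSq_eq_norm_sq, pow_mul]
      push_cast; rfl
    · obtain ⟨i, hi⟩ : ∃ i, σ i ≠ τ i := by
        by_contra! hcon; exact h (Equiv.ext hcon)
      rw [Finset.prod_eq_zero (Finset.mem_univ i), mul_zero]
      exact integral_monomial_mul_radial_eq_zero hg fun h' => hi (Fin.ext h')
  have hsum : ∀ σ : Equiv.Perm (Fin n), ∫ z : Fin n → ℂ, ∑ τ : Equiv.Perm (Fin n),
      ((Equiv.Perm.sign σ : ℤ) : ℂ) * ((Equiv.Perm.sign τ : ℤ) : ℂ) *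
        ∏ i, (z i ^ (σ i : ℕ) * (starRingEnd ℂ) (z i) ^ (τ i : ℕ) * g (z i))
      ∂(Measure.pi fun _ : Fin n => areaMeasure) =
      ∏ j : Fin n, ∫ z, (‖z‖ : ℂ) ^ (2 * (j : ℕ)) * g z ∂areaMeasure := by
    intro σ
    rw [integral_finsetSum _ fun τ _ => hI σ τ]
    simp_rw [hterm]
    simp
  simp_rw [hsum]
  simp [Finset.card_univ, Fintype.card_perm]

/-! ### Factorisation of radial statistics -/

/-- The measure `ψ(r)^n r^{-2l-1} dr` on the half-line. For the profile `ψ` of the potential it is,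
up to a constant, the radial part of the weight `|z|^{2j} e^{-nQ}` with `j = n - 1 - l`. -/
def peakMeasure (ψ : ℝ → ℝ) (n l : ℕ) : Measure ℝ :=
  (volume.restrict (Set.Ioi 0)).withDensity fun r => ENNReal.ofReal (ψ r ^ n / r ^ (2 * l + 1))

namespace PeakProfile

variable {ι : Type*} {ψ : ℝ → ℝ} {pos κ : ι → ℝ}

theorem measurable_density (h : PeakProfile ψ pos κ) (n l : ℕ) :
    Measurable fun r => ψ r ^ n / r ^ (2 * l + 1) :=
  (h.measurable.pow_const n).div (measurable_id.pow_const _)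

theorem density_nonneg (h : PeakProfile ψ pos κ) (n l : ℕ) {r : ℝ} (hr : 0 < r) :
    0 ≤ ψ r ^ n / r ^ (2 * l + 1) :=
  div_nonneg (pow_nonneg (h.nonneg r) _) (pow_nonneg hr.le _)

theorem integrableOn_pow_div (h : PeakProfile ψ pos κ) {n l : ℕ} (hl : l < n) :
    IntegrableOn (fun r => ψ r ^ n / r ^ (2 * l + 1)) (Set.Ioi 0) := by
  obtain ⟨A, hA0, hA⟩ := h.small
  refine (h.integrable.const_mul (1 + A ^ (n - 1))).mono'
    (h.measurable_density n l).aestronglyMeasurable ?_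
  filter_upwards [ae_restrict_mem measurableSet_Ioi] with r hr
  have hr0 : 0 < r := hr
  have hψ := h.nonneg r
  have hψ1 := h.le_one r hr0
  rw [Real.norm_of_nonneg (h.density_nonneg n l hr0), div_le_iff₀ (by positivity)]
  have hn : ψ r ^ n = ψ r * ψ r ^ (n - 1) := by rw [← pow_succ']; congr 1; omega
  have hr2 : (1 + A ^ (n - 1)) * (ψ r / r) * r ^ (2 * l + 1) =
      ψ r * ((1 + A ^ (n - 1)) * r ^ (2 * l)) := by
    rw [pow_succ]; field_simp
  rw [hr2, hn]
  refine mul_le_mul_of_nonneg_left ?_ hψ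
  rcases le_total r 1 with h1 | h1
  · calc ψ r ^ (n - 1) ≤ (A * r ^ 2) ^ (n - 1) := by gcongr; exact hA r hr0
      _ = A ^ (n - 1) * r ^ (2 * (n - 1)) := by rw [mul_pow, ← pow_mul]
      _ ≤ (1 + A ^ (n - 1)) * r ^ (2 * l) := by
        have h2 : r ^ (2 * (n - 1)) ≤ r ^ (2 * l) :=
          pow_le_pow_of_le_one hr0.le h1 (by omega)
        have h3 : A ^ (n - 1) ≤ 1 + A ^ (n - 1) := by linarith
        gcongr
  · have h2 : 1 ≤ r ^ (2 * l) := one_le_pow₀ h1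
    have h3 : 0 ≤ A ^ (n - 1) := by positivity
    have h4 : ψ r ^ (n - 1) ≤ 1 := pow_le_one₀ hψ hψ1
    nlinarith

theorem isFiniteMeasure_peakMeasure (h : PeakProfile ψ pos κ) {n l : ℕ} (hl : l < n) :
    IsFiniteMeasure (peakMeasure ψ n l) := by
  refine isFiniteMeasure_withDensity_ofReal (Integrable.hasFiniteIntegral ?_)
  exact h.integrableOn_pow_div hl

theorem integral_peakMeasure {E : Type*} [NormedAddCommGroup E] [NormedSpace ℝ E]
    (h : PeakProfile ψ pos κ) (n l : ℕ) (F : ℝ → E) :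
    ∫ r, F r ∂(peakMeasure ψ n l) =
      ∫ r in Set.Ioi (0 : ℝ), (ψ r ^ n / r ^ (2 * l + 1)) • F r := by
  rw [peakMeasure, integral_withDensity_eq_integral_toReal_smul
    (h.measurable_density n l).ennreal_ofReal (Eventually.of_forall fun _ => ENNReal.ofReal_lt_top)]
  refine setIntegral_congr_fun measurableSet_Ioi fun r hr => ?_
  rw [ENNReal.toReal_ofReal (h.density_nonneg n l hr)]

theorem real_peakMeasure (h : PeakProfile ψ pos κ) (n l : ℕ) {S : Set ℝ} (hS : MeasurableSet S) :
    (peakMeasure ψ n l).real S =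
      ∫ r in Set.Ioi (0 : ℝ) ∩ S, ψ r ^ n / r ^ (2 * l + 1) := by
  have h1 : (peakMeasure ψ n l).real S = ∫ r, S.indicator (fun _ => (1 : ℝ)) r
      ∂(peakMeasure ψ n l) := by
    rw [integral_indicator hS]; simp
  rw [h1, h.integral_peakMeasure, ← setIntegral_indicator hS]
  refine setIntegral_congr_fun measurableSet_Ioi fun r _ => ?_
  by_cases hr : r ∈ S <;> simp [hr]

theorem real_univ_pos [Nonempty ι] (h : PeakProfile ψ pos κ) {n l : ℕ} (hl : l < n) :
    0 < (peakMeasure ψ n l).real Set.univ := by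
  rw [h.real_peakMeasure n l MeasurableSet.univ, Set.inter_univ]
  rw [setIntegral_pos_iff_support_of_nonneg_ae _ (h.integrableOn_pow_div hl)]
  · obtain ⟨i⟩ := ‹Nonempty ι›
    obtain ⟨δ, C, hδ, -, hφ⟩ := h.peak i
    have hp := h.pos_pos i
    refine lt_of_lt_of_le ?_ (measure_mono (s := Set.Ioo (pos i) (pos i + δ)) fun r hr => ?_)
    · simp [hδ]
    · have hr0 : 0 < r := hp.trans hr.1
      refine ⟨?_, hr0⟩
      obtain ⟨φ, hφ, -⟩ := hφ r (by rw [abs_of_pos (by linarith [hr.1])]; linarith [hr.2])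
      rw [Function.mem_support, hφ]
      positivity
  · filter_upwards [ae_restrict_mem measurableSet_Ioi] with r hr using h.density_nonneg n l hr

end PeakProfile

namespace OutpostPotential

variable {Q : ℂ → EReal} {m : ℕ} {a₀ b₀ : ℝ} {t : Fin m → ℝ} {ε : ℝ}

theorem gasWeight_eq (h : OutpostPotential Q a₀ b₀ t ε) (n : ℕ) (z : Fin n → ℂ) :
    gasWeight Q n z = ENNReal.ofReal
      ((∏ j, ∏ k ∈ Finset.Ioi j, ‖z k - z j‖ ^ 2) * ∏ j, boltzmann Q (z j) ^ n) := by
  have hexp : ∀ j : Fin n, EReal.exp (-(n : EReal) * Q (z j)) =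
      ENNReal.ofReal (boltzmann Q (z j) ^ n) := by
    intro j
    have hn : n ≠ 0 := fun hn => by subst hn; exact j.elim0
    rcases eq_or_ne (Q (z j)) ⊤ with hQ | hQ
    · have hneg : -(n : EReal) < 0 := by
        rw [EReal.neg_lt_comm, neg_zero]; exact_mod_cast Nat.pos_of_ne_zero hn
      rw [boltzmann_of_eq_top hQ, hQ, EReal.mul_top_of_neg hneg]
      simp [hn]
    · obtain ⟨x, hx⟩ : ∃ x : ℝ, Q (z j) = x := ⟨_, (EReal.coe_toReal hQ (h.ne_bot _)).symm⟩
      have hcast : -(n : EReal) * Q (z j) = ((-(n : ℝ) * x : ℝ) : EReal) := by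
        rw [hx]; push_cast; rfl
      rw [boltzmann_of_eq_coe hx, hcast, EReal.exp_coe, ← Real.exp_nat_mul]
      congr 2; ring
  rw [gasWeight, ENNReal.ofReal_mul (by positivity),
    ENNReal.ofReal_prod_of_nonneg fun j _ => by positivity,
    ENNReal.ofReal_prod_of_nonneg fun j _ => pow_nonneg (boltzmann_nonneg _ _) _]
  congr 1
  · refine Finset.prod_congr rfl fun j _ => ?_
    rw [ENNReal.ofReal_prod_of_nonneg fun j _ => by positivity]
  · exact Finset.prod_congr rfl fun j _ => hexp j

theorem measurable_boltzmann (h : OutpostPotential Q a₀ b₀ t ε) : Measurable (boltzmann Q) :=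
  (upperSemicontinuous_boltzmann h.ne_bot h.lsc).measurable

/-- The radial density of the weight of degree `j = n - 1 - l`, in terms of the profile. -/
theorem radial_weight_eq (h : OutpostPotential Q a₀ b₀ t ε) {n j l : ℕ} (hjl : j + l + 1 = n)
    {r : ℝ} (hr : 0 < r) :
    r * (r ^ (2 * j) * boltzmann Q (r : ℂ) ^ n) =
      topValue Q b₀ ^ n * (profile Q b₀ r ^ n / r ^ (2 * l + 1)) := by
  have hV := h.topValue_pos
  rw [profile, div_pow, mul_pow, ← pow_mul]
  have : r ^ (2 * n) = r * r ^ (2 * j) * r ^ (2 * l + 1) := by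
    rw [← pow_succ', ← pow_add]; congr 1; omega
  rw [this]
  field_simp

/-- The constant which relates integration over the plane to integration over the half-line. -/
def radialConst : ℝ := 2 * areaMeasure.real (Metric.ball 0 1)

theorem radialConst_pos : 0 < radialConst := by
  refine mul_pos two_pos (ENNReal.toReal_pos ?_ measure_ball_lt_top.ne)
  exact (Metric.measure_ball_pos areaMeasure 0 one_pos).ne'

/-- Integration in polar coordinates against the weight of degree `j = n - 1 - l`. -/
theorem integral_moment_eq (h : OutpostPotential Q a₀ b₀ t ε) {n j l : ℕ} (hjl : j + l + 1 = n)
    (F : ℝ → ℂ) :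
    ∫ z, (‖z‖ : ℂ) ^ (2 * j) * ((boltzmann Q z ^ n : ℝ) * F ‖z‖) ∂areaMeasure =
      ((radialConst * topValue Q b₀ ^ n : ℝ) : ℂ) *
        ∫ r, F r ∂(peakMeasure (profile Q b₀) n l) := by
  have h1 : (fun z : ℂ => (‖z‖ : ℂ) ^ (2 * j) * ((boltzmann Q z ^ n : ℝ) * F ‖z‖)) =
      fun z : ℂ => (fun r : ℝ => (r : ℂ) ^ (2 * j) * ((boltzmann Q (r : ℂ) ^ n : ℝ) * F r)) ‖z‖ := by
    funext z
    simp only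
    rw [h.boltzmann_radial z]
  rw [h1, integral_fun_norm_addHaar areaMeasure
    (fun r : ℝ => (r : ℂ) ^ (2 * j) * ((boltzmann Q (r : ℂ) ^ n : ℝ) * F r)), h.peakProfile.integral_peakMeasure,
    Complex.finrank_real_complex, ← integral_const_mul, nsmul_eq_mul, ← integral_smul,
    ← integral_const_mul]
  refine setIntegral_congr_fun measurableSet_Ioi fun r hr => ?_
  have h2 := congrArg (fun x : ℝ => (x : ℂ)) (h.radial_weight_eq hjl (show 0 < r from hr))
  simp only [Complex.real_smul, radialConst, Nat.add_one_sub_one, pow_one] at h2 ⊢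
  push_cast at h2 ⊢
  linear_combination (2 * (areaMeasure.real (Metric.ball 0 1) : ℂ) * F r) * h2

theorem integrable_norm_pow_mul_boltzmann (h : OutpostPotential Q a₀ b₀ t ε) {n j : ℕ}
    (hj : j < n) :
    Integrable (fun z : ℂ => ‖z‖ ^ (2 * j) * boltzmann Q z ^ n) areaMeasure := by
  have h1 : (fun z : ℂ => ‖z‖ ^ (2 * j) * boltzmann Q z ^ n) =
      fun z : ℂ => (fun r : ℝ => r ^ (2 * j) * boltzmann Q (r : ℂ) ^ n) ‖z‖ := by
    funext z
    simp only
    rw [h.boltzmann_radial z]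
  rw [h1]
  refine (integrable_fun_norm_addHaar areaMeasure
    (f := fun r : ℝ => r ^ (2 * j) * boltzmann Q (r : ℂ) ^ n)).2 ?_
  rw [Complex.finrank_real_complex]
  refine ((h.peakProfile.integrableOn_pow_div (n := n) (l := n - 1 - j) (by omega)).const_mul
    (topValue Q b₀ ^ n)).congr ?_
  filter_upwards [ae_restrict_mem measurableSet_Ioi] with r hr
  rw [← h.radial_weight_eq (n := n) (j := j) (l := n - 1 - j) (by omega) hr]
  simp

theorem integrable_monomial (h : OutpostPotential Q a₀ b₀ t ε) {n a b : ℕ} (ha : a < n)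
    (hb : b < n) {F : ℝ → ℂ} (hF : Measurable F) {C : ℝ} (hFC : ∀ r, ‖F r‖ ≤ C) :
    Integrable (fun z : ℂ => z ^ a * (starRingEnd ℂ) z ^ b *
      ((boltzmann Q z ^ n : ℝ) * F ‖z‖)) areaMeasure := by
  have hm : Measurable fun z : ℂ => z ^ a * (starRingEnd ℂ) z ^ b *
      ((boltzmann Q z ^ n : ℝ) * F ‖z‖) := by
    have h1 := h.measurable_boltzmann
    have h2 : Measurable fun z : ℂ => F ‖z‖ := hF.comp measurable_norm
    have h3 : Measurable fun z : ℂ => (starRingEnd ℂ) z := Complex.continuous_conj.measurable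
    fun_prop
  refine (((h.integrable_norm_pow_mul_boltzmann ha).add
    (h.integrable_norm_pow_mul_boltzmann hb)).const_mul C).mono' hm.aestronglyMeasurable
    (Eventually.of_forall fun z => ?_)
  have hbz : 0 ≤ boltzmann Q z ^ n := pow_nonneg (boltzmann_nonneg Q z) n
  rw [norm_mul, norm_mul, norm_mul, norm_pow, norm_pow, RCLike.norm_conj, Complex.norm_real,
    Real.norm_of_nonneg hbz]
  have h1 : ‖z‖ ^ a * ‖z‖ ^ b ≤ ‖z‖ ^ (2 * a) + ‖z‖ ^ (2 * b) := by
    have := sq_nonneg (‖z‖ ^ a - ‖z‖ ^ b)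
    have h2 : 0 ≤ ‖z‖ ^ a * ‖z‖ ^ b := by positivity
    rw [mul_comm 2 a, mul_comm 2 b, pow_mul, pow_mul]
    nlinarith
  calc ‖z‖ ^ a * ‖z‖ ^ b * (boltzmann Q z ^ n * ‖F ‖z‖‖)
      ≤ (‖z‖ ^ (2 * a) + ‖z‖ ^ (2 * b)) * (boltzmann Q z ^ n * C) := by
        have := hFC ‖z‖
        gcongr
    _ = _ := by simp only [Pi.add_apply]; ring

/-- The density of the gas, as a real number. -/
def realWeight (Q : ℂ → EReal) (n : ℕ) (z : Fin n → ℂ) : ℝ :=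
  (∏ j, ∏ k ∈ Finset.Ioi j, ‖z k - z j‖ ^ 2) * ∏ j, boltzmann Q (z j) ^ n

theorem realWeight_nonneg (Q : ℂ → EReal) (n : ℕ) (z : Fin n → ℂ) : 0 ≤ realWeight Q n z :=
  mul_nonneg (by positivity) (Finset.prod_nonneg fun j _ => pow_nonneg (boltzmann_nonneg _ _) _)

theorem measurable_realWeight (h : OutpostPotential Q a₀ b₀ t ε) (n : ℕ) :
    Measurable (realWeight Q n) := by
  have h1 := h.measurable_boltzmann
  unfold realWeight
  refine Measurable.mul ?_ ?_
  · exact Finset.measurable_prod _ fun j _ => Finset.measurable_prod _ fun k _ => by fun_prop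
  · exact Finset.measurable_prod _ fun j _ => (h1.comp (measurable_pi_apply j)).pow_const n

theorem ofReal_realWeight_mul (n : ℕ) (F : ℝ → ℂ) (z : Fin n → ℂ) :
    (realWeight Q n z : ℂ) * ∏ j, F ‖z j‖ =
      ((∏ j, ∏ k ∈ Finset.Ioi j, ‖z k - z j‖ ^ 2 : ℝ) : ℂ) *
        ∏ j, ((boltzmann Q (z j) ^ n : ℝ) * F ‖z j‖) := by
  rw [realWeight, Finset.prod_mul_distrib]
  push_cast
  ring

theorem integral_realWeight_mul (h : OutpostPotential Q a₀ b₀ t ε) (n : ℕ) {F : ℝ → ℂ}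
    (hF : Measurable F) {C : ℝ} (hFC : ∀ r, ‖F r‖ ≤ C) :
    ∫ z : Fin n → ℂ, (realWeight Q n z : ℂ) * ∏ j, F ‖z j‖
      ∂(Measure.pi fun _ : Fin n => areaMeasure) =
    (n.factorial : ℂ) * ((radialConst * topValue Q b₀ ^ n : ℝ) : ℂ) ^ n *
      ∏ l ∈ Finset.range n, ∫ r, F r ∂(peakMeasure (profile Q b₀) n l) := by
  simp_rw [ofReal_realWeight_mul]
  rw [integral_prod_norm_sub_sq_mul (g := fun z => (boltzmann Q z ^ n : ℝ) * F ‖z‖)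
    (fun z w hzw => by rw [h.boltzmann_radial z, h.boltzmann_radial w, hzw])
    fun a b ha hb => h.integrable_monomial ha hb hF hFC]
  have h1 : ∀ j : Fin n, ∫ z, (‖z‖ : ℂ) ^ (2 * (j : ℕ)) * ((boltzmann Q z ^ n : ℝ) * F ‖z‖)
      ∂areaMeasure = ((radialConst * topValue Q b₀ ^ n : ℝ) : ℂ) *
        ∫ r, F r ∂(peakMeasure (profile Q b₀) n (n - 1 - j)) := fun j =>
    h.integral_moment_eq (by have := j.2; omega) F
  simp_rw [h1]
  rw [Finset.prod_mul_distrib, Finset.prod_const, Finset.card_univ, Fintype.card_fin, mul_assoc]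
  congr 2
  rw [Fin.prod_univ_eq_prod_range fun j => ∫ r, F r ∂(peakMeasure (profile Q b₀) n (n - 1 - j)),
    Finset.prod_range_reflect fun l => ∫ r, F r ∂(peakMeasure (profile Q b₀) n l)]

theorem integrable_realWeight (h : OutpostPotential Q a₀ b₀ t ε) (n : ℕ) :
    Integrable (realWeight Q n) (Measure.pi fun _ : Fin n => areaMeasure) := by
  have h0 : ∀ a b : ℕ, a < n → b < n → Integrable (fun z : ℂ => z ^ a * (starRingEnd ℂ) z ^ b *
      ((boltzmann Q z ^ n : ℝ) * (1 : ℂ))) areaMeasure := fun a b ha hb =>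
    h.integrable_monomial ha hb (F := fun _ => 1) measurable_const (C := 1) fun _ => norm_one.le
  have h1 := (integrable_prod_norm_sub_sq_mul h0).re
  refine h1.congr (Eventually.of_forall fun z => ?_)
  have h2 := ofReal_realWeight_mul (Q := Q) n (fun _ : ℝ => (1 : ℂ)) z
  refine (congrArg RCLike.re h2.symm).trans ?_
  rw [Finset.prod_const_one, mul_one]
  exact Complex.ofReal_re _

theorem integral_realWeight (h : OutpostPotential Q a₀ b₀ t ε) (n : ℕ) :
    ∫ z, realWeight Q n z ∂(Measure.pi fun _ : Fin n => areaMeasure) =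
      n.factorial * (radialConst * topValue Q b₀ ^ n) ^ n *
      ∏ l ∈ Finset.range n, (peakMeasure (profile Q b₀) n l).real Set.univ := by
  have h1 := h.integral_realWeight_mul n (F := fun _ => 1) measurable_const (C := 1) (by simp)
  simp only [Finset.prod_const_one, mul_one, integral_const, Complex.real_smul] at h1
  rw [integral_complex_ofReal] at h1
  exact_mod_cast h1

theorem integral_realWeight_pos (h : OutpostPotential Q a₀ b₀ t ε) (n : ℕ) :
    0 < ∫ z, realWeight Q n z ∂(Measure.pi fun _ : Fin n => areaMeasure) := by
  rw [h.integral_realWeight]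
  have hV := h.topValue_pos
  have hc := radialConst_pos
  have : 0 < ∏ l ∈ Finset.range n, (peakMeasure (profile Q b₀) n l).real Set.univ :=
    Finset.prod_pos fun l hl => h.peakProfile.real_univ_pos (Finset.mem_range.1 hl)
  positivity

theorem partitionFunction_eq (h : OutpostPotential Q a₀ b₀ t ε) (n : ℕ) :
    partitionFunction Q n = ENNReal.ofReal
      (∫ z, realWeight Q n z ∂(Measure.pi fun _ : Fin n => areaMeasure)) := by
  rw [partitionFunction, ofReal_integral_eq_lintegral_ofReal (h.integrable_realWeight n)
    (Eventually.of_forall fun z => realWeight_nonneg Q n z)]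
  exact lintegral_congr fun z => h.gasWeight_eq n z

theorem isProbabilityMeasure_gasLaw (h : OutpostPotential Q a₀ b₀ t ε) (n : ℕ) :
    IsProbabilityMeasure (gasLaw Q n) := by
  constructor
  rw [gasLaw, Measure.smul_apply, withDensity_apply _ MeasurableSet.univ, Measure.restrict_univ]
  change (partitionFunction Q n)⁻¹ * partitionFunction Q n = 1
  rw [h.partitionFunction_eq]
  exact ENNReal.inv_mul_cancel (ENNReal.ofReal_pos.2 (h.integral_realWeight_pos n)).ne'
    ENNReal.ofReal_ne_top

/-- Under the gas law, a product of radial functions integrates like a product over independent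
radii, with laws the normalised measures `peakMeasure`. -/
theorem integral_prod_gasLaw (h : OutpostPotential Q a₀ b₀ t ε) (n : ℕ) {F : ℝ → ℂ}
    (hF : Measurable F) {C : ℝ} (hFC : ∀ r, ‖F r‖ ≤ C) :
    ∫ z : Fin n → ℂ, ∏ j, F ‖z j‖ ∂(gasLaw Q n) =
      ∏ l ∈ Finset.range n, (∫ r, F r ∂(peakMeasure (profile Q b₀) n l)) /
        (peakMeasure (profile Q b₀) n l).real Set.univ := by
  have hw : gasWeight Q n = fun z => ENNReal.ofReal (realWeight Q n z) :=
    funext fun z => h.gasWeight_eq n z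
  have hI := h.integral_realWeight_pos n
  rw [gasLaw, integral_smul_measure, hw, integral_withDensity_eq_integral_toReal_smul
    (h.measurable_realWeight n).ennreal_ofReal (Eventually.of_forall fun _ => ENNReal.ofReal_lt_top),
    h.partitionFunction_eq]
  simp_rw [ENNReal.toReal_ofReal (realWeight_nonneg Q n _), Complex.real_smul]
  rw [h.integral_realWeight_mul n hF hFC, ENNReal.toReal_inv, ENNReal.toReal_ofReal hI.le,
    Finset.prod_div_distrib]
  rw [h.integral_realWeight] at hI ⊢
  have hV := h.topValue_pos
  have hc := radialConst_pos
  have hP : 0 < ∏ l ∈ Finset.range n, (peakMeasure (profile Q b₀) n l).real Set.univ :=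
    Finset.prod_pos fun l hl => h.peakProfile.real_univ_pos (Finset.mem_range.1 hl)
  have hP' : (∏ l ∈ Finset.range n, ((peakMeasure (profile Q b₀) n l).real Set.univ : ℂ)) ≠ 0 := by
    exact_mod_cast hP.ne'
  have hf : (n.factorial : ℂ) ≠ 0 := by exact_mod_cast n.factorial_ne_zero
  have hV' : (topValue Q b₀ : ℂ) ≠ 0 := by exact_mod_cast hV.ne'
  have hc' : (radialConst : ℂ) ≠ 0 := by exact_mod_cast hc.ne'
  push_cast
  field_simp

end OutpostPotential

/-! ### Laplace's method at the peaks -/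

theorem abs_exp_neg_sub_exp_neg_le {a b c : ℝ} (ha : c ≤ a) (hb : c ≤ b) :
    |Real.exp (-a) - Real.exp (-b)| ≤ |a - b| * Real.exp (-c) := by
  wlog hab : a ≤ b generalizing a b
  · rw [abs_sub_comm, abs_sub_comm a]
    exact this hb ha (le_of_not_ge hab)
  have h1 : Real.exp (-b) ≤ Real.exp (-a) := Real.exp_le_exp.2 (by linarith)
  have h2 : Real.exp (-b) = Real.exp (-a) * Real.exp (a - b) := by rw [← Real.exp_add]; ring_nf
  have h3 := Real.add_one_le_exp (a - b)
  have h4 : Real.exp (-a) ≤ Real.exp (-c) := Real.exp_le_exp.2 (by linarith)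
  have h5 := Real.exp_pos (-a)
  rw [abs_of_nonneg (by linarith), abs_of_nonpos (by linarith)]
  calc Real.exp (-a) - Real.exp (-b) ≤ Real.exp (-a) * (b - a) := by rw [h2]; nlinarith
    _ ≤ Real.exp (-c) * (b - a) := by
      have : 0 ≤ b - a := by linarith
      gcongr
    _ = -(a - b) * Real.exp (-c) := by ring

theorem abs_log_one_add_le {y : ℝ} (hy : |y| ≤ 1 / 2) : |Real.log (1 + y)| ≤ 2 * |y| := by
  obtain ⟨h1, h2⟩ := abs_le.1 hy
  have hpos : 0 < 1 + y := by linarith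
  have hu := Real.log_le_sub_one_of_pos hpos
  have hl := Real.one_sub_inv_le_log_of_pos hpos
  have h3 : 1 - (1 + y)⁻¹ = y / (1 + y) := by field_simp; ring
  rw [abs_le]
  constructor
  · refine le_trans ?_ hl
    rw [h3, le_div_iff₀ hpos]
    rcases abs_cases y with ⟨h, _⟩ | ⟨h, _⟩ <;> rw [h] <;> nlinarith
  · have := le_abs_self y
    have := abs_nonneg y
    linarith

/-- The linear term is absorbed by a part of the Gaussian exponent. -/
theorem two_mul_abs_le {k : ℝ} (hk : 0 < k) (u : ℝ) : 2 * |u| ≤ 8 / k + k / 8 * u ^ 2 := by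
  rw [← sq_abs u, div_add' _ _ _ hk.ne', le_div_iff₀ hk]
  nlinarith [sq_nonneg (k * |u| - 8)]

theorem cubic_le_mul_exp {C D x : ℝ} (hC : 0 ≤ C) (hD : 0 ≤ D) (hx : 0 ≤ x) :
    C * x ^ 3 + D * x ≤ (6 * C + D) * Real.exp x := by
  have h1 := Real.pow_div_factorial_le_exp x hx 3
  have h2 := Real.pow_div_factorial_le_exp x hx 1
  have h3 : x ^ 3 ≤ 6 * Real.exp x := by
    have : ((3 : ℕ).factorial : ℝ) = 6 := by norm_num [Nat.factorial]
    rw [this, div_le_iff₀ (by norm_num)] at h1; linarith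
  have h4 : x ≤ Real.exp x := by simpa using h2
  calc C * x ^ 3 + D * x ≤ C * (6 * Real.exp x) + D * Real.exp x := by gcongr
    _ = _ := by ring

/-- The pointwise estimate behind Laplace's method, in the scaled variable `u = √n (r - p)`. -/
theorem abs_peak_integrand_sub_le {p κ δ C : ℝ} (hp : 0 < p) (hκ : 0 < κ)
    (hC : 0 ≤ C) (hδp : δ ≤ p / 2) (hδκ : C * δ ≤ κ / 4) {n l : ℕ} (hn : 0 < n)
    (hl : 4 * ((l : ℝ) + 1) ≤ p * √n) {u φ : ℝ} (hu : |u / √n| < δ)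
    (hφ : |φ - κ / 2 * (u / √n) ^ 2| ≤ C * |u / √n| ^ 3) :
    |p ^ (2 * l + 1) * (Real.exp (-φ) ^ n / (p + u / √n) ^ (2 * l + 1)) -
      Real.exp (-(κ / 2) * u ^ 2)| ≤
    (6 * C + 4 / p) * Real.exp (8 / κ) * (((l : ℝ) + 1) / √n) * Real.exp (-(κ / 8) * u ^ 2) := by
  have hn0 : (0 : ℝ) < n := by exact_mod_cast hn
  set s := √(n : ℝ) with hs
  have hs0 : 0 < s := Real.sqrt_pos.2 hn0
  have hss : s ^ 2 = n := Real.sq_sqrt hn0.le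
  have hs1 : 1 ≤ s := by
    rw [hs]; exact Real.one_le_sqrt.2 (by exact_mod_cast hn)
  set x := u / s with hx
  have hux : u = s * x := by rw [hx]; field_simp
  have hl0 : (0 : ℝ) ≤ l := Nat.cast_nonneg l
  have hax : |u| = s * |x| := by rw [hux, abs_mul, abs_of_pos hs0]
  have hxp : |x / p| ≤ 1 / 2 := by
    rw [abs_div, abs_of_pos hp, div_le_iff₀ hp]; linarith
  have hpos1 : 0 < 1 + x / p := by linarith [(abs_le.1 hxp).1]
  set lg := Real.log (1 + x / p) with hlg
  have hlgb : |lg| ≤ 2 * (|x| / p) := by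
    have := abs_log_one_add_le hxp
    rwa [abs_div, abs_of_pos hp] at this
  -- both terms as exponentials
  set a := n * φ + (2 * l + 1) * lg with ha
  set b := κ / 2 * u ^ 2 with hb
  have e1 : p ^ (2 * l + 1) * (Real.exp (-φ) ^ n / (p + x) ^ (2 * l + 1)) = Real.exp (-a) := by
    have h1 : p + x = p * Real.exp lg := by rw [hlg, Real.exp_log hpos1]; field_simp
    have h2 : Real.exp (-a) = Real.exp (-φ) ^ n / Real.exp lg ^ (2 * l + 1) := by
      rw [← Real.exp_nat_mul, ← Real.exp_nat_mul, ← Real.exp_sub, ha]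
      congr 1; push_cast; ring
    rw [h1, h2, mul_pow]
    have : 0 < p ^ (2 * l + 1) := by positivity
    field_simp
  have e2 : Real.exp (-(κ / 2) * u ^ 2) = Real.exp (-b) := by rw [hb]; ring_nf
  rw [e1, e2]
  have hnx : (n : ℝ) * x ^ 2 = u ^ 2 := by rw [hux, ← hss]; ring
  have hab1 : |a - b| ≤ n * (C * |x| ^ 3) + (2 * l + 1) * (2 * (|x| / p)) := by
    have h1 : a - b = n * (φ - κ / 2 * x ^ 2) + (2 * l + 1) * lg := by
      rw [ha, hb, ← hnx]; ring
    rw [h1]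
    refine (abs_add_le _ _).trans ?_
    rw [abs_mul, abs_mul, abs_of_pos hn0, abs_of_nonneg (by positivity : (0 : ℝ) ≤ 2 * l + 1)]
    gcongr
  have hab2 : |a - b| ≤ (((l : ℝ) + 1) / s) * (C * |u| ^ 3 + 4 / p * |u|) := by
    refine hab1.trans ?_
    have h1 : (n : ℝ) * (C * |x| ^ 3) = 1 / s * (C * |u| ^ 3) := by
      rw [hax, ← hss]; field_simp
    have h2 : (2 * (l : ℝ) + 1) * (2 * (|x| / p)) = (4 * l + 2) / s * (1 / p * |u|) := by
      rw [hax]; field_simp; ring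
    have h3 : (((l : ℝ) + 1) / s) * (C * |u| ^ 3 + 4 / p * |u|) =
        ((l : ℝ) + 1) / s * (C * |u| ^ 3) + (4 * (l : ℝ) + 4) / s * (1 / p * |u|) := by ring
    rw [h1, h2, h3]
    have h4 : 0 ≤ C * |u| ^ 3 := by positivity
    have h5 : 0 ≤ 1 / p * |u| := by positivity
    gcongr
    · linarith
    · norm_num
  have hab3 : C * |u| ^ 3 + 4 / p * |u| ≤ (6 * C + 4 / p) * Real.exp |u| := by
    exact cubic_le_mul_exp hC (by positivity) (abs_nonneg u)
  have hca : κ / 4 * u ^ 2 - |u| ≤ a := by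
    have h1 : κ / 4 * x ^ 2 ≤ φ := by
      have h2 : C * |x| ^ 3 ≤ κ / 4 * x ^ 2 := by
        have h3 : C * |x| ≤ κ / 4 := le_trans (by gcongr) hδκ
        have h4 : C * |x| ^ 3 = C * |x| * x ^ 2 := by rw [← sq_abs x]; ring
        rw [h4]; gcongr
      have := (abs_le.1 hφ).1
      linarith
    have h5 : κ / 4 * u ^ 2 ≤ n * φ := by
      rw [← hnx]
      calc κ / 4 * (n * x ^ 2) = n * (κ / 4 * x ^ 2) := by ring
        _ ≤ n * φ := by gcongr
    have h6 : |(2 * (l : ℝ) + 1) * lg| ≤ |u| := by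
      rw [abs_mul, abs_of_nonneg (by positivity : (0 : ℝ) ≤ 2 * l + 1)]
      calc (2 * (l : ℝ) + 1) * |lg| ≤ (2 * l + 2) * (2 * (|x| / p)) := by
            gcongr; norm_num
        _ = (4 * ((l : ℝ) + 1)) * (|x| / p) := by ring
        _ ≤ (p * s) * (|x| / p) := by gcongr
        _ = |u| := by rw [hax]; field_simp
    have := (abs_le.1 h6).1
    rw [ha]; linarith
  have hcb : κ / 4 * u ^ 2 - |u| ≤ b := by
    have := abs_nonneg u
    have h1 : κ / 4 * u ^ 2 ≤ κ / 2 * u ^ 2 := by gcongr; norm_num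
    rw [hb]; linarith
  refine (abs_exp_neg_sub_exp_neg_le hca hcb).trans ?_
  have hq : |u| + -(κ / 4 * u ^ 2 - |u|) ≤ 8 / κ + -(κ / 8) * u ^ 2 := by
    have h1 := two_mul_abs_le hκ u
    linarith
  calc |a - b| * Real.exp (-(κ / 4 * u ^ 2 - |u|))
      ≤ ((((l : ℝ) + 1) / s) * ((6 * C + 4 / p) * Real.exp |u|)) *
        Real.exp (-(κ / 4 * u ^ 2 - |u|)) := by
        gcongr
        exact hab2.trans (by gcongr)
    _ = (((l : ℝ) + 1) / s) * (6 * C + 4 / p) *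
        Real.exp (|u| + -(κ / 4 * u ^ 2 - |u|)) := by rw [Real.exp_add]; ring
    _ ≤ (((l : ℝ) + 1) / s) * (6 * C + 4 / p) * Real.exp (8 / κ + -(κ / 8) * u ^ 2) := by
        gcongr
    _ = _ := by rw [Real.exp_add]; ring

namespace PeakProfile

variable {ι : Type*} {ψ : ℝ → ℝ} {pos κ : ι → ℝ}

/-- **Laplace's method at a peak**, uniformly in the exponent `l`. -/
theorem abs_real_peak_sub_le (h : PeakProfile ψ pos κ) (i : ι) :
    ∃ δ₀ : ℝ, 0 < δ₀ ∧ ∀ δ, 0 < δ → δ ≤ δ₀ → ∃ C : ℝ, 0 < C ∧ ∀ n l : ℕ, 0 < n →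
      4 * ((l : ℝ) + 1) ≤ pos i * √n →
      |√n * pos i ^ (2 * l + 1) *
        (peakMeasure ψ n l).real (Set.Ioo (pos i - δ) (pos i + δ)) - √(2 * Real.pi / κ i)| ≤
      C * (((l : ℝ) + 1) / √n) := by
  obtain ⟨δ₁, C, hδ₁, hC, hφ⟩ := h.peak i
  set p := pos i with hp_def
  have hp : 0 < p := h.pos_pos i
  have hκ := h.κ_pos i
  set k := κ i with hk_def
  refine ⟨min (min δ₁ (p / 2)) (k / (4 * (C + 1))), by positivity, fun δ hδ hδ₀ => ?_⟩
  have hδ1 : δ ≤ δ₁ := hδ₀.trans ((min_le_left _ _).trans (min_le_left _ _))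
  have hδp : δ ≤ p / 2 := hδ₀.trans ((min_le_left _ _).trans (min_le_right _ _))
  have hδκ : C * δ ≤ k / 4 := by
    have h1 : δ ≤ k / (4 * (C + 1)) := hδ₀.trans (min_le_right _ _)
    rw [le_div_iff₀ (by positivity)] at h1
    nlinarith
  set B := (6 * C + 4 / p) * Real.exp (8 / k) + 1 / δ * Real.exp (8 / k) with hB
  have hB0 : 0 < B := by positivity
  have hgi : Integrable fun u : ℝ => Real.exp (-(k / 8) * u ^ 2) :=
    integrable_exp_neg_mul_sq (by positivity)
  refine ⟨B * (∫ u : ℝ, Real.exp (-(k / 8) * u ^ 2)), ?_, fun n l hn hl => ?_⟩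
  · rw [integral_gaussian]; positivity
  have hn0 : (0 : ℝ) < n := by exact_mod_cast hn
  set s := √(n : ℝ) with hs
  have hs0 : 0 < s := Real.sqrt_pos.2 hn0
  set I : Set ℝ := Set.Ioo (p - δ) (p + δ) with hI
  set g : ℝ → ℝ := I.indicator fun r => p ^ (2 * l + 1) * (ψ r ^ n / r ^ (2 * l + 1)) with hg
  have hgm : Measurable g :=
    ((h.measurable_density n l).const_mul _).indicator measurableSet_Ioo
  set G : ℝ → ℝ := fun u => g (p + u / s) with hG
  have hGm : Measurable G := hgm.comp (by fun_prop)
  have hGint : ∫ u, G u = s * p ^ (2 * l + 1) * (peakMeasure ψ n l).real I := by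
    have h1 : ∫ u, G u = |s| • ∫ x, g (p + x) := Measure.integral_comp_div (fun x => g (p + x)) s
    rw [h1, integral_add_left_eq_self g p, hg, integral_indicator measurableSet_Ioo,
      h.real_peakMeasure n l measurableSet_Ioo, integral_const_mul, abs_of_pos hs0, smul_eq_mul,
      ← mul_assoc]
    congr 2
    rw [Set.inter_eq_right.2]
    intro r hr
    have := hr.1
    exact lt_of_le_of_lt (by linarith) this
  have hgi2 : Integrable fun u : ℝ => Real.exp (-(k / 2) * u ^ 2) :=
    integrable_exp_neg_mul_sq (by positivity)
  have hbound : ∀ u, ‖G u - Real.exp (-(k / 2) * u ^ 2)‖ ≤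
      B * (((l : ℝ) + 1) / s) * Real.exp (-(k / 8) * u ^ 2) := by
    intro u
    rw [Real.norm_eq_abs]
    have hls : 0 ≤ ((l : ℝ) + 1) / s := by positivity
    have hE := Real.exp_pos (-(k / 8) * u ^ 2)
    by_cases hu : |u / s| < δ
    · have hmem : p + u / s ∈ I := by
        obtain ⟨h1, h2⟩ := abs_lt.1 hu
        constructor <;> linarith
      obtain ⟨φ, hφ1, hφ2⟩ := hφ (p + u / s) (by
        rw [add_sub_cancel_left]; exact hu.trans_le hδ1)
      rw [add_sub_cancel_left] at hφ2
      have h3 := abs_peak_integrand_sub_le hp hκ hC hδp hδκ hn hl hu hφ2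
      simp only [hG, hg, Set.indicator_of_mem hmem, hφ1]
      refine h3.trans ?_
      gcongr
      rw [hB]
      have : 0 < 1 / δ * Real.exp (8 / k) := by positivity
      linarith
    · have hmem : p + u / s ∉ I := by
        intro hmem
        apply hu
        rw [abs_lt]
        constructor <;> linarith [hmem.1, hmem.2]
      simp only [hG, hg, Set.indicator_of_notMem hmem, zero_sub, abs_neg, Real.abs_exp]
      have h1 : 1 ≤ |u| / (δ * s) := by
        rw [abs_div, abs_of_pos hs0, not_lt, le_div_iff₀ hs0] at hu
        rw [one_le_div (by positivity)]; exact hu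
      have h2 : |u| ≤ Real.exp |u| := by
        have := Real.add_one_le_exp |u|
        linarith
      have h3 : |u| + -(k / 2) * u ^ 2 ≤ 8 / k + -(k / 8) * u ^ 2 := by
        have h4 := two_mul_abs_le hκ u
        have h5 : 0 ≤ k * u ^ 2 := by positivity
        have := abs_nonneg u
        linarith
      calc Real.exp (-(k / 2) * u ^ 2)
          ≤ |u| / (δ * s) * Real.exp (-(k / 2) * u ^ 2) :=
            le_mul_of_one_le_left (Real.exp_pos _).le h1
        _ ≤ Real.exp |u| / (δ * s) * Real.exp (-(k / 2) * u ^ 2) := by gcongr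
        _ = 1 / δ * (1 / s) * Real.exp (|u| + -(k / 2) * u ^ 2) := by
            rw [Real.exp_add]; field_simp
        _ ≤ 1 / δ * (((l : ℝ) + 1) / s) * Real.exp (8 / k + -(k / 8) * u ^ 2) := by
            gcongr
            linarith [(Nat.cast_nonneg l : (0 : ℝ) ≤ l)]
        _ = 1 / δ * Real.exp (8 / k) * (((l : ℝ) + 1) / s) * Real.exp (-(k / 8) * u ^ 2) := by
            rw [Real.exp_add]; ring
        _ ≤ _ := by
            gcongr
            rw [hB]
            have : 0 < (6 * C + 4 / p) * Real.exp (8 / k) := by positivity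
            linarith
  have hdiff : Integrable fun u => G u - Real.exp (-(k / 2) * u ^ 2) :=
    (hgi.const_mul _).mono' (hGm.sub (by fun_prop)).aestronglyMeasurable
      (Eventually.of_forall hbound)
  have hGi : Integrable G := by
    have := hdiff.add hgi2
    refine this.congr (Eventually.of_forall fun u => ?_)
    simp
  have hgauss : ∫ u : ℝ, Real.exp (-(k / 2) * u ^ 2) = √(2 * Real.pi / k) := by
    rw [integral_gaussian]; congr 1; field_simp
  rw [← hGint, ← hgauss, ← integral_sub hGi hgi2, ← Real.norm_eq_abs]
  refine (norm_integral_le_of_norm_le (hgi.const_mul _) (Eventually.of_forall hbound)).trans ?_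
  rw [integral_const_mul]
  exact le_of_eq (by ring)

/-- Away from the peaks the mass is exponentially small. -/
theorem real_gap_le (h : PeakProfile ψ pos κ) {η : ℝ} (hη : 0 < η) :
    ∃ c A C : ℝ, 0 < c ∧ 1 ≤ A ∧ 0 < C ∧ ∀ n l : ℕ, l < n → ∀ S : Set ℝ, MeasurableSet S →
      (∀ r ∈ S, 0 < r → ∀ i, η ≤ |r - pos i|) →
      (peakMeasure ψ n l).real S ≤ C * A ^ l * Real.exp (-(c * ((n : ℝ) - 1 - l))) := by
  obtain ⟨c, hc, hgap⟩ := h.gap η hη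
  obtain ⟨A, hA, hsmall⟩ := h.small
  set J := ∫ r in Set.Ioi (0 : ℝ), ψ r / r with hJ
  have hJ0 : 0 ≤ J := setIntegral_nonneg measurableSet_Ioi fun r hr =>
    div_nonneg (h.nonneg r) (le_of_lt hr)
  refine ⟨c, A + 1, J + 1, hc, by linarith, by linarith, fun n l hl S hS hSgap => ?_⟩
  rw [h.real_peakMeasure n l hS]
  have hcast : ((n - 1 - l : ℕ) : ℝ) = (n : ℝ) - 1 - l := by
    rw [Nat.cast_sub (by omega), Nat.cast_sub (by omega)]; simp
  set E := (A + 1) ^ l * Real.exp (-(c * ((n : ℝ) - 1 - l))) with hE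
  have hE0 : 0 ≤ E := by positivity
  have hsub : Set.Ioi (0 : ℝ) ∩ S ⊆ Set.Ioi 0 := Set.inter_subset_left
  calc ∫ r in Set.Ioi (0 : ℝ) ∩ S, ψ r ^ n / r ^ (2 * l + 1)
      ≤ ∫ r in Set.Ioi (0 : ℝ) ∩ S, E * (ψ r / r) := by
        refine setIntegral_mono_on ((h.integrableOn_pow_div hl).mono_set hsub)
          ((h.integrable.mono_set hsub).const_mul E) (measurableSet_Ioi.inter hS) fun r hr => ?_
        have hr0 : 0 < r := hr.1
        have hψ := h.nonneg r
        have h1 : ψ r ^ n = ψ r ^ l * ψ r ^ (n - 1 - l) * ψ r := by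
          rw [← pow_add, ← pow_succ]; congr 1; omega
        have h2 : ψ r ^ l ≤ (A + 1) ^ l * r ^ (2 * l) := by
          calc ψ r ^ l ≤ ((A + 1) * r ^ 2) ^ l := by
                gcongr
                refine (hsmall r hr0).trans ?_
                gcongr; linarith
            _ = _ := by rw [mul_pow, ← pow_mul]
        have h3 : ψ r ^ (n - 1 - l) ≤ Real.exp (-(c * ((n : ℝ) - 1 - l))) := by
          calc ψ r ^ (n - 1 - l) ≤ Real.exp (-c) ^ (n - 1 - l) := by
                gcongr; exact hgap r hr0 (hSgap r hr.2 hr0)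
            _ = _ := by rw [← Real.exp_nat_mul, hcast]; congr 1; ring
        rw [div_le_iff₀ (by positivity), h1]
        have h4 : E * (ψ r / r) * r ^ (2 * l + 1) =
            ((A + 1) ^ l * r ^ (2 * l)) * Real.exp (-(c * ((n : ℝ) - 1 - l))) * ψ r := by
          rw [hE, pow_succ]; field_simp
        rw [h4]
        gcongr
    _ = E * ∫ r in Set.Ioi (0 : ℝ) ∩ S, ψ r / r := integral_const_mul _ _
    _ ≤ E * J := by
        refine mul_le_mul_of_nonneg_left (setIntegral_mono_set h.integrable ?_
          (LE.le.eventuallyLE hsub)) hE0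
        filter_upwards [ae_restrict_mem measurableSet_Ioi] with r hr
        exact div_nonneg (h.nonneg r) (le_of_lt hr)
    _ ≤ (J + 1) * (A + 1) ^ l * Real.exp (-(c * ((n : ℝ) - 1 - l))) := by
        have : (J + 1) * (A + 1) ^ l * Real.exp (-(c * ((n : ℝ) - 1 - l))) = E * (J + 1) := by
          rw [hE]; ring
        rw [this]
        gcongr; linarith

/-- The mass far out, relative to the total mass, decays geometrically in `l`, by monotonicity
of `r^{-2l}`. -/
theorem real_Ici_le (h : PeakProfile ψ pos κ) {β τ : ℝ} (hβ : 0 < β) (hτ : 0 < τ) {n l : ℕ}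
    (hl : l < n) :
    (peakMeasure ψ n l).real (Set.Ici τ) * (peakMeasure ψ n 0).real (Set.Iio β) ≤
      ((β / τ) ^ 2) ^ l * (peakMeasure ψ n 0).real Set.univ * (peakMeasure ψ n l).real Set.univ := by
  have hn : 0 < n := by omega
  have := h.isFiniteMeasure_peakMeasure hl
  have := h.isFiniteMeasure_peakMeasure hn
  have hi := h.integrableOn_pow_div hl
  have hi0 := h.integrableOn_pow_div hn
  have hsplit : ∀ r : ℝ, 0 < r → ψ r ^ n / r ^ (2 * l + 1) =
      (r ^ (2 * l))⁻¹ * (ψ r ^ n / r ^ (2 * 0 + 1)) := by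
    intro r hr
    rw [pow_succ, mul_zero, zero_add, pow_one]; field_simp
  have h1 : τ ^ (2 * l) * (peakMeasure ψ n l).real (Set.Ici τ) ≤
      (peakMeasure ψ n 0).real Set.univ := by
    refine le_trans ?_ (measureReal_mono (Set.subset_univ (Set.Ici τ)))
    rw [h.real_peakMeasure n l measurableSet_Ici, h.real_peakMeasure n 0 measurableSet_Ici,
      ← integral_const_mul]
    refine setIntegral_mono_on ((hi.mono_set Set.inter_subset_left).const_mul _)
      (hi0.mono_set Set.inter_subset_left) (measurableSet_Ioi.inter measurableSet_Ici)
      fun r hr => ?_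
    have hr0 : 0 < r := hr.1
    have hd := h.density_nonneg n 0 hr0
    rw [hsplit r hr0, ← mul_assoc]
    refine mul_le_of_le_one_left hd ?_
    rw [mul_inv_le_iff₀ (by positivity), one_mul]
    exact pow_le_pow_left₀ hτ.le hr.2 _
  have h2 : (peakMeasure ψ n 0).real (Set.Iio β) ≤
      β ^ (2 * l) * (peakMeasure ψ n l).real Set.univ := by
    refine le_trans ?_ (mul_le_mul_of_nonneg_left
      (measureReal_mono (Set.subset_univ (Set.Iio β))) (by positivity))
    rw [h.real_peakMeasure n l measurableSet_Iio, h.real_peakMeasure n 0 measurableSet_Iio,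
      ← integral_const_mul]
    refine setIntegral_mono_on (hi0.mono_set Set.inter_subset_left)
      ((hi.mono_set Set.inter_subset_left).const_mul _) (measurableSet_Ioi.inter measurableSet_Iio)
      fun r hr => ?_
    have hr0 : 0 < r := hr.1
    have hd := h.density_nonneg n 0 hr0
    rw [hsplit r hr0, ← mul_assoc]
    refine le_mul_of_one_le_left hd ?_
    rw [← div_eq_mul_inv, one_le_div (by positivity)]
    exact pow_le_pow_left₀ hr0.le (le_of_lt hr.2) _
  rw [← le_div_iff₀' (by positivity)] at h1
  calc (peakMeasure ψ n l).real (Set.Ici τ) * (peakMeasure ψ n 0).real (Set.Iio β)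
      ≤ (peakMeasure ψ n 0).real Set.univ / τ ^ (2 * l) *
        (β ^ (2 * l) * (peakMeasure ψ n l).real Set.univ) := by gcongr
    _ = _ := by rw [← pow_mul, div_pow]; ring

end PeakProfile

/-! ### Means of functions which are constant near the peaks -/

/-- The limiting mass `√(2π / κ i) (b / pos i)^{2l+1}` of the peak at `pos i`. -/
def peakWeight {ι : Type*} (pos κ : ι → ℝ) (b : ℝ) (i : ι) (l : ℕ) : ℝ :=
  √(2 * Real.pi / κ i) * (b / pos i) ^ (2 * l + 1)

namespace PeakProfile

variable {ι : Type*} {ψ : ℝ → ℝ} {pos κ : ι → ℝ}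

theorem peakWeight_pos (h : PeakProfile ψ pos κ) {b : ℝ} (hb : 0 < b) (i : ι) (l : ℕ) :
    0 < peakWeight pos κ b i l := by
  have := h.κ_pos i
  have := h.pos_pos i
  have := Real.pi_pos
  rw [peakWeight]; positivity

/-- Integrals of functions which are constant near each peak. -/
theorem norm_integral_sub_sum_le [Fintype ι] (h : PeakProfile ψ pos κ) {b : ℝ} (hb : 0 < b) :
    ∃ δ₀ : ℝ, 0 < δ₀ ∧ ∀ δ, 0 < δ → δ ≤ δ₀ → (∀ i j, i ≠ j → 2 * δ ≤ |pos i - pos j|) →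
      ∃ c A C : ℝ, 0 < c ∧ 1 ≤ A ∧ 0 < C ∧ ∀ n l : ℕ, l < n →
      (∀ i, 4 * ((l : ℝ) + 1) ≤ pos i * √n) → ∀ (F : ℝ → ℂ) (f : ι → ℂ) (Λ : ℝ), Measurable F →
      (∀ i r, |r - pos i| < δ → F r = f i) → (∀ r, ‖F r‖ ≤ Λ) →
      ‖((√n * b ^ (2 * l + 1) : ℝ) : ℂ) * ∫ r, F r ∂(peakMeasure ψ n l) -
        ∑ i, f i * peakWeight pos κ b i l‖ ≤
      C * (((l : ℝ) + 1) / √n) * ∑ i, ‖f i‖ * peakWeight pos κ b i l +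
        Λ * √n * (C * A ^ l * Real.exp (-(c * ((n : ℝ) - 1 - l)))) := by
  choose δ₁ hδ₁ hpeak using h.abs_real_peak_sub_le
  obtain ⟨δ₀, hδ₀, hδ₀i⟩ : ∃ δ₀ : ℝ, 0 < δ₀ ∧ ∀ i, δ₀ ≤ δ₁ i := by
    rcases isEmpty_or_nonempty ι with hι | hι
    · exact ⟨1, one_pos, fun i => isEmptyElim i⟩
    · obtain ⟨i₀, hi₀⟩ := Finite.exists_min δ₁
      exact ⟨δ₁ i₀, hδ₁ i₀, hi₀⟩
  refine ⟨δ₀, hδ₀, fun δ hδ hδδ₀ hsep => ?_⟩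
  choose C₁ hC₁ hbd using fun i => hpeak i δ hδ (hδδ₀.trans (hδ₀i i))
  obtain ⟨c, A, C₂, hc, hA, hC₂, hgap⟩ := h.real_gap_le hδ
  have hsq : ∀ i, 0 < √(2 * Real.pi / κ i) := fun i => by
    have := h.κ_pos i
    have := Real.pi_pos
    positivity
  set C₃ := ∑ i, C₁ i / √(2 * Real.pi / κ i) with hC₃
  have hC₃i : ∀ i, C₁ i / √(2 * Real.pi / κ i) ≤ C₃ := fun i =>
    Finset.single_le_sum (f := fun i => C₁ i / √(2 * Real.pi / κ i))
      (fun i _ => div_nonneg (hC₁ i).le (hsq i).le) (Finset.mem_univ i)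
  have hC₃0 : 0 ≤ C₃ := Finset.sum_nonneg fun i _ => div_nonneg (hC₁ i).le (hsq i).le
  refine ⟨c, A * (b ^ 2 + 1), C₃ + C₂ * b, hc, ?_, by positivity, fun n l hl hln F f Λ hF hFf hΛ => ?_⟩
  · nlinarith [sq_nonneg b]
  have hn : 0 < n := by omega
  have hn0 : (0 : ℝ) < n := by exact_mod_cast hn
  have hs0 : 0 < √(n : ℝ) := Real.sqrt_pos.2 hn0
  have := h.isFiniteMeasure_peakMeasure hl
  set μ := peakMeasure ψ n l with hμ
  have hFi : Integrable F μ := Integrable.of_bound hF.aestronglyMeasurable Λ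
    (Eventually.of_forall hΛ)
  set I : ι → Set ℝ := fun i => Set.Ioo (pos i - δ) (pos i + δ) with hI
  have hImem : ∀ i r, r ∈ I i ↔ |r - pos i| < δ := fun i r => by
    rw [abs_lt]
    constructor
    · rintro ⟨h1, h2⟩; constructor <;> linarith
    · rintro ⟨h1, h2⟩; constructor <;> linarith
  have hIm : ∀ i, MeasurableSet (I i) := fun i => measurableSet_Ioo
  have hdisj : Pairwise (Function.onFun Disjoint I) := by
    intro i j hij
    refine Set.disjoint_left.2 fun r hri hrj => ?_
    rw [hImem] at hri hrj
    have h1 := hsep i j hij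
    have h2 : |pos i - pos j| ≤ |r - pos i| + |r - pos j| := by
      have := abs_sub (r - pos j) (r - pos i)
      have h3 : r - pos j - (r - pos i) = pos i - pos j := by ring
      rw [h3] at this; linarith
    linarith
  set S := (⋃ i, I i)ᶜ with hS
  have hSm : MeasurableSet S := (MeasurableSet.iUnion hIm).compl
  have hdecomp : ∫ r, F r ∂μ = ∑ i, f i * (μ.real (I i) : ℂ) + ∫ r in S, F r ∂μ := by
    rw [← integral_add_compl (MeasurableSet.iUnion hIm) hFi]
    congr 1
    rw [integral_iUnion_fintype hIm hdisj fun i => hFi.integrableOn]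
    refine Finset.sum_congr rfl fun i _ => ?_
    rw [setIntegral_congr_fun (hIm i) (g := fun _ => f i) fun r hr => hFf i r ((hImem i r).1 hr),
      setIntegral_const, Complex.real_smul, mul_comm]
  have hSgap : μ.real S ≤ C₂ * A ^ l * Real.exp (-(c * ((n : ℝ) - 1 - l))) := by
    refine hgap n l hl S hSm fun r hr _ i => ?_
    by_contra hcon
    exact hr (Set.mem_iUnion.2 ⟨i, (hImem i r).2 (not_le.1 hcon)⟩)
  have hSF : ‖∫ r in S, F r ∂μ‖ ≤ Λ * μ.real S :=
    norm_setIntegral_le_of_norm_le_const (measure_lt_top _ _) fun r _ => hΛ r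
  have hΛ0 : 0 ≤ Λ := (norm_nonneg _).trans (hΛ 0)
  have hpk : ∀ i, |√n * b ^ (2 * l + 1) * μ.real (I i) - peakWeight pos κ b i l| ≤
      C₃ * (((l : ℝ) + 1) / √n) * peakWeight pos κ b i l := by
    intro i
    have hp := h.pos_pos i
    have h1 := hbd i n l hn (hln i)
    have h2 : √n * b ^ (2 * l + 1) * μ.real (I i) - peakWeight pos κ b i l =
        (b / pos i) ^ (2 * l + 1) *
          (√n * pos i ^ (2 * l + 1) * μ.real (I i) - √(2 * Real.pi / κ i)) := by
      rw [peakWeight, mul_sub, div_pow]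
      field_simp
    have hq : 0 < (b / pos i) ^ (2 * l + 1) := by positivity
    rw [h2, abs_mul, abs_of_pos hq]
    calc (b / pos i) ^ (2 * l + 1) * |√n * pos i ^ (2 * l + 1) * μ.real (I i) -
            √(2 * Real.pi / κ i)|
        ≤ (b / pos i) ^ (2 * l + 1) * (C₁ i * (((l : ℝ) + 1) / √n)) := by gcongr
      _ = C₁ i / √(2 * Real.pi / κ i) * (((l : ℝ) + 1) / √n) * peakWeight pos κ b i l := by
        have := (hsq i).ne'
        rw [peakWeight]
        generalize √(2 * Real.pi / κ i) = x at *
        field_simp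
      _ ≤ _ := by
        have := h.peakWeight_pos hb i l
        have := hC₃i i
        gcongr
  have hexp : ((√n * b ^ (2 * l + 1) : ℝ) : ℂ) * ∫ r, F r ∂μ -
      ∑ i, f i * peakWeight pos κ b i l =
      ∑ i, f i * ((√n * b ^ (2 * l + 1) * μ.real (I i) - peakWeight pos κ b i l : ℝ) : ℂ) +
        ((√n * b ^ (2 * l + 1) : ℝ) : ℂ) * ∫ r in S, F r ∂μ := by
    rw [hdecomp, mul_add, Finset.mul_sum, add_sub_right_comm, ← Finset.sum_sub_distrib]
    congr 1
    refine Finset.sum_congr rfl fun i _ => ?_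
    push_cast; ring
  rw [hexp]
  refine (norm_add_le _ _).trans (add_le_add ?_ ?_)
  · refine (norm_sum_le _ _).trans ?_
    rw [Finset.mul_sum]
    refine Finset.sum_le_sum fun i _ => ?_
    rw [norm_mul, Complex.norm_real, Real.norm_eq_abs]
    have hw := h.peakWeight_pos hb i l
    calc ‖f i‖ * |√n * b ^ (2 * l + 1) * μ.real (I i) - peakWeight pos κ b i l|
        ≤ ‖f i‖ * (C₃ * (((l : ℝ) + 1) / √n) * peakWeight pos κ b i l) := by gcongr; exact hpk i
      _ ≤ ‖f i‖ * ((C₃ + C₂ * b) * (((l : ℝ) + 1) / √n) * peakWeight pos κ b i l) := by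
          gcongr
          have : 0 ≤ C₂ * b := by positivity
          linarith
      _ = _ := by ring
  · rw [norm_mul, Complex.norm_real, Real.norm_of_nonneg (by positivity)]
    have hE := Real.exp_pos (-(c * ((n : ℝ) - 1 - l)))
    calc √n * b ^ (2 * l + 1) * ‖∫ r in S, F r ∂μ‖
        ≤ √n * b ^ (2 * l + 1) * (Λ * (C₂ * A ^ l * Real.exp (-(c * ((n : ℝ) - 1 - l))))) := by
          gcongr
          exact hSF.trans (by gcongr)
      _ = Λ * √n * ((C₂ * b) * (A * b ^ 2) ^ l * Real.exp (-(c * ((n : ℝ) - 1 - l)))) := by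
          rw [mul_pow, ← pow_mul, pow_succ]; ring
      _ ≤ _ := by
          gcongr <;> linarith

end PeakProfile

/-- The exponentially small errors are negligible for `l` below a small power of `n`. -/
theorem exists_pow_mul_exp_le (N : ℕ) {c A : ℝ} (hc : 0 < c) (hA : 1 ≤ A) :
    ∃ C : ℝ, 0 < C ∧ ∀ n l : ℕ, (l + 1) ^ 12 ≤ n →
      (n : ℝ) ^ N * (A ^ l * Real.exp (-(c * ((n : ℝ) - 1 - l)))) ≤ C := by
  set B := Real.log A + c with hB
  have hlogA : 0 ≤ Real.log A := Real.log_nonneg hA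
  have hB0 : 0 < B := by linarith
  refine ⟨N.factorial * (2 / c) ^ N * Real.exp (B ^ 2 / (2 * c) + c), by positivity,
    fun n l hl => ?_⟩
  have hl2 : (l : ℝ) ^ 2 ≤ n := by
    have h1 : l ^ 2 ≤ n := by
      calc l ^ 2 ≤ (l + 1) ^ 2 := Nat.pow_le_pow_left (by omega) 2
        _ ≤ (l + 1) ^ 12 := Nat.pow_le_pow_right (by omega) (by norm_num)
        _ ≤ n := hl
    exact_mod_cast h1
  have hn0 : (0 : ℝ) ≤ n := Nat.cast_nonneg n
  have h1 : A ^ l * Real.exp (-(c * ((n : ℝ) - 1 - l))) = Real.exp (l * B + c - c * n) := by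
    have : A ^ l = Real.exp (l * Real.log A) := by
      rw [Real.exp_nat_mul, Real.exp_log (by linarith)]
    rw [this, ← Real.exp_add]; congr 1; rw [hB]; ring
  have h2 : l * B ≤ c * n / 2 + B ^ 2 / (2 * c) := by
    have h3 : c * n / 2 + B ^ 2 / (2 * c) = (c ^ 2 * n + B ^ 2) / (2 * c) := by field_simp
    rw [h3, le_div_iff₀ (by positivity)]
    nlinarith [sq_nonneg (c * l - B), mul_le_mul_of_nonneg_left hl2 (sq_nonneg c)]
  have h3 : (n : ℝ) ^ N ≤ N.factorial * (2 / c) ^ N * Real.exp (c * n / 2) := by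
    have h4 := Real.pow_div_factorial_le_exp (c * n / 2) (by positivity) N
    have h5 : (n : ℝ) ^ N = (2 / c) ^ N * (c * n / 2) ^ N := by
      rw [← mul_pow]; congr 1; field_simp
    rw [div_le_iff₀ (by positivity)] at h4
    rw [h5]
    calc (2 / c) ^ N * (c * n / 2) ^ N ≤ (2 / c) ^ N * (Real.exp (c * n / 2) * N.factorial) := by
          gcongr
      _ = _ := by ring
  rw [h1]
  calc (n : ℝ) ^ N * Real.exp (l * B + c - c * n)
      ≤ (N.factorial * (2 / c) ^ N * Real.exp (c * n / 2)) *
        Real.exp (B ^ 2 / (2 * c) + c - c * n / 2) := by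
        refine mul_le_mul h3 (Real.exp_le_exp.2 (by linarith)) (Real.exp_pos _).le (by positivity)
    _ = _ := by
        rw [mul_assoc, ← Real.exp_add]; congr 2; ring

/-! ### Comparison with the means over the peaks -/

/-- The mean of `F` under the normalised measure `peakMeasure ψ n l`. -/
def peakMean (ψ : ℝ → ℝ) (n l : ℕ) (F : ℝ → ℂ) : ℂ :=
  (∫ r, F r ∂(peakMeasure ψ n l)) / ((peakMeasure ψ n l).real Set.univ : ℂ)

/-- The mean of `f` over the peaks, weighted by their limiting masses. -/
def limitMean {ι : Type*} [Fintype ι] (pos κ : ι → ℝ) (b : ℝ) (f : ι → ℂ) (l : ℕ) : ℂ :=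
  (∑ i, f i * peakWeight pos κ b i l) / ((∑ i, peakWeight pos κ b i l : ℝ) : ℂ)

/-- Propagation of the errors of numerator and denominator to a quotient; here `S` bounds the size of
the numerator, which may be much smaller than `S`. -/
theorem norm_div_sub_div_le {x X : ℂ} {y Y S η : ℝ} (hY : 0 < Y) (hη : η ≤ 1 / 2) (hη0 : 0 ≤ η)
    (hx : ‖x - X‖ ≤ η * S) (hy : |y - Y| ≤ η * Y) (hX : ‖X‖ ≤ S) :
    ‖x / (y : ℂ) - X / (Y : ℂ)‖ ≤ 4 * η * (S / Y) := by
  have hy2 : Y / 2 ≤ y := by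
    have := (abs_le.1 hy).1
    nlinarith
  have hy0 : 0 < y := by linarith
  have hyc : (y : ℂ) ≠ 0 := by exact_mod_cast hy0.ne'
  have hYc : (Y : ℂ) ≠ 0 := by exact_mod_cast hY.ne'
  have hS : 0 ≤ S := (norm_nonneg _).trans hX
  have h1 : x / (y : ℂ) - X / (Y : ℂ) = ((x - X) * Y + X * ((Y - y : ℝ) : ℂ)) / ((y * Y : ℝ) : ℂ) := by
    push_cast
    field_simp
    ring
  rw [h1, norm_div, Complex.norm_real, Real.norm_eq_abs, abs_of_pos (by positivity),
    div_le_iff₀ (by positivity)]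
  refine (norm_add_le _ _).trans ?_
  rw [norm_mul, norm_mul, Complex.norm_real, Complex.norm_real, Real.norm_eq_abs, Real.norm_eq_abs,
    abs_of_pos hY, abs_sub_comm]
  calc ‖x - X‖ * Y + ‖X‖ * |y - Y| ≤ (η * S) * Y + S * (η * Y) := by gcongr
    _ = 4 * η * (S / Y) * (Y / 2 * Y) := by field_simp; ring
    _ ≤ _ := by gcongr

/-- The threshold `(l + 1)^12 ≤ n`, in terms of the fourth root of `n`. -/
theorem succ_pow_three_le_sqrt_sqrt {n l : ℕ} (hl : (l + 1) ^ 12 ≤ n) :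
    ((l : ℝ) + 1) ^ 3 ≤ √√(n : ℝ) := by
  refine le_of_pow_le_pow_left₀ (n := 4) (by norm_num) (by positivity) ?_
  have h1 : √√(n : ℝ) ^ 4 = n := by
    rw [show 4 = 2 * 2 by norm_num, pow_mul, Real.sq_sqrt (by positivity),
      Real.sq_sqrt (by positivity)]
  rw [h1, ← pow_mul]
  exact_mod_cast hl

namespace PeakProfile

variable {ι : Type*} [Fintype ι] {ψ : ℝ → ℝ} {pos κ : ι → ℝ}

theorem sum_peakWeight_pos [Nonempty ι] (h : PeakProfile ψ pos κ) {b : ℝ} (hb : 0 < b) (l : ℕ) :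
    0 < ∑ i, peakWeight pos κ b i l :=
  Finset.sum_pos (fun i _ => h.peakWeight_pos hb i l) Finset.univ_nonempty

/-- For `l` small compared with `n`, means are close to the means over the peaks. -/
theorem norm_peakMean_sub_limitMean_le (h : PeakProfile ψ pos κ) (i₀ : ι) {ε : ℝ} (hε : 0 < ε)
    (hsep : ∀ i j, i ≠ j → 2 * ε ≤ |pos i - pos j|) (N : ℕ) :
    ∃ C : ℝ, 0 < C ∧ ∀ᶠ n : ℕ in atTop, ∀ l : ℕ, (l + 1) ^ 12 ≤ n →
      ∀ (F : ℝ → ℂ) (f : ι → ℂ), Measurable F → (∀ i r, |r - pos i| < ε → F r = f i) →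
      f i₀ = 1 → (∀ r, ‖F r‖ ≤ (n : ℝ) ^ N) →
      ‖peakMean ψ n l F - limitMean pos κ (pos i₀) f l‖ ≤
        C / (√√(n : ℝ) * ((l : ℝ) + 1) ^ 2) *
          ((∑ i, ‖f i‖ * peakWeight pos κ (pos i₀) i l) / ∑ i, peakWeight pos κ (pos i₀) i l) := by
  have : Nonempty ι := ⟨i₀⟩
  set b := pos i₀ with hb_def
  have hb : 0 < b := h.pos_pos i₀
  obtain ⟨δ₀, hδ₀, H⟩ := h.norm_integral_sub_sum_le hb
  obtain ⟨c, A, C, hc, hA, hC, H⟩ := H (min δ₀ ε) (lt_min hδ₀ hε) (min_le_left _ _)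
    fun i j hij => le_trans (by have := min_le_right δ₀ ε; linarith) (hsep i j hij)
  obtain ⟨C', hC', H'⟩ := exists_pow_mul_exp_le (N + 2) hc hA
  set w₀ := √(2 * Real.pi / κ i₀) with hw₀
  have hw₀pos : 0 < w₀ := by
    have := h.κ_pos i₀
    have := Real.pi_pos
    positivity
  have hw₀eq : ∀ l, peakWeight pos κ b i₀ l = w₀ := fun l => by
    rw [peakWeight, ← hb_def, div_self hb.ne', one_pow, mul_one]
  set K := C + C * C' / w₀ with hK
  have hK0 : 0 < K := by positivity
  have hq : Tendsto (fun n : ℕ => √√(n : ℝ)) atTop atTop :=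
    Real.tendsto_sqrt_atTop.comp (Real.tendsto_sqrt_atTop.comp tendsto_natCast_atTop_atTop)
  have hev : ∀ᶠ n : ℕ in atTop, ∀ i, 4 / pos i ≤ √√(n : ℝ) :=
    eventually_all.2 fun i => hq.eventually_ge_atTop _
  refine ⟨4 * K, by positivity, ?_⟩
  filter_upwards [hev, hq.eventually_ge_atTop (2 * K), eventually_ge_atTop 1] with
    n hn1 hn2 hn3 l hl F f hF hFf hf hFb
  set q := √√(n : ℝ) with hq_def
  have hn0 : (0 : ℝ) < n := by exact_mod_cast hn3
  have hn1' : (1 : ℝ) ≤ n := by exact_mod_cast hn3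
  have hq0 : 0 < q := Real.sqrt_pos.2 (Real.sqrt_pos.2 hn0)
  have hqq : √(n : ℝ) = q ^ 2 := (Real.sq_sqrt (by positivity)).symm
  have hlq := succ_pow_three_le_sqrt_sqrt hl
  rw [← hq_def] at hlq
  have hl1 : (1 : ℝ) ≤ (l : ℝ) + 1 := by linarith [(Nat.cast_nonneg l : (0 : ℝ) ≤ l)]
  have hln : l < n := by
    have : l + 1 ≤ (l + 1) ^ 12 := Nat.le_self_pow (by norm_num) _
    omega
  have hlpos : ∀ i, 4 * ((l : ℝ) + 1) ≤ pos i * √(n : ℝ) := fun i => by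
    have h1 := hn1 i
    rw [div_le_iff₀ (h.pos_pos i)] at h1
    have h2 : (l : ℝ) + 1 ≤ q := (le_self_pow₀ hl1 (by norm_num)).trans hlq
    calc 4 * ((l : ℝ) + 1) ≤ (q * pos i) * q := by gcongr
      _ = _ := by rw [hqq]; ring
  have hls : ((l : ℝ) + 1) / √(n : ℝ) ≤ 1 / (q * ((l : ℝ) + 1) ^ 2) := by
    rw [hqq, div_le_div_iff₀ (by positivity) (by positivity)]
    calc ((l : ℝ) + 1) * (q * ((l : ℝ) + 1) ^ 2) = q * ((l : ℝ) + 1) ^ 3 := by ring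
      _ ≤ q * q := by gcongr
      _ = _ := by ring
  -- the combined relative error
  set η := K / (q * ((l : ℝ) + 1) ^ 2) with hη
  have hη0 : 0 ≤ η := by positivity
  have hη2 : η ≤ 1 / 2 := by
    rw [hη, div_le_iff₀ (by positivity)]
    have : 1 ≤ ((l : ℝ) + 1) ^ 2 := one_le_pow₀ hl1
    nlinarith
  have key : ∀ (F : ℝ → ℂ) (f : ι → ℂ), Measurable F → (∀ i r, |r - pos i| < ε → F r = f i) →
      f i₀ = 1 → (∀ r, ‖F r‖ ≤ (n : ℝ) ^ N) →
      ‖((√(n : ℝ) * b ^ (2 * l + 1) : ℝ) : ℂ) * ∫ r, F r ∂(peakMeasure ψ n l) -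
        ∑ i, f i * peakWeight pos κ b i l‖ ≤ η * ∑ i, ‖f i‖ * peakWeight pos κ b i l := by
    intro F f hF hFf hf hFb
    set S := ∑ i, ‖f i‖ * peakWeight pos κ b i l with hS
    have hwS : w₀ ≤ S := by
      have h1 := Finset.single_le_sum (f := fun i => ‖f i‖ * peakWeight pos κ b i l)
        (fun i _ => mul_nonneg (norm_nonneg _) (h.peakWeight_pos hb i l).le) (Finset.mem_univ i₀)
      simpa [hf, hw₀eq] using h1
    have h1 := H n l hln hlpos F f _ hF
      (fun i r hr => hFf i r (hr.trans_le (min_le_right _ _))) hFb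
    refine h1.trans ?_
    set X := A ^ l * Real.exp (-(c * ((n : ℝ) - 1 - l))) with hX
    have hX0 : 0 ≤ X := by positivity
    have h2 := H' n l hl
    have h3 : (n : ℝ) ^ N * √(n : ℝ) * (C * A ^ l * Real.exp (-(c * ((n : ℝ) - 1 - l)))) ≤
        C * C' / √(n : ℝ) := by
      rw [le_div_iff₀ (by positivity)]
      have h4 : √(n : ℝ) * √(n : ℝ) ≤ n ^ 2 := by
        rw [Real.mul_self_sqrt hn0.le]; nlinarith
      calc (n : ℝ) ^ N * √(n : ℝ) * (C * A ^ l * Real.exp (-(c * ((n : ℝ) - 1 - l)))) * √(n : ℝ)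
          = C * ((n : ℝ) ^ N * (√(n : ℝ) * √(n : ℝ)) * X) := by rw [hX]; ring
        _ ≤ C * ((n : ℝ) ^ N * n ^ 2 * X) := by gcongr
        _ ≤ C * C' := by
            rw [← pow_add]; gcongr
    have h5 : C * C' / √(n : ℝ) ≤ C * C' / w₀ * (((l : ℝ) + 1) / √(n : ℝ)) * S := by
      calc C * C' / √(n : ℝ) = C * C' / w₀ * (1 / √(n : ℝ)) * w₀ := by field_simp
        _ ≤ _ := by gcongr
    have hS0 : 0 ≤ S := hw₀pos.le.trans hwS
    calc _ ≤ C * (((l : ℝ) + 1) / √(n : ℝ)) * S +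
          C * C' / w₀ * (((l : ℝ) + 1) / √(n : ℝ)) * S := by
          exact add_le_add le_rfl (h3.trans h5)
      _ = K * (((l : ℝ) + 1) / √(n : ℝ)) * S := by rw [hK]; ring
      _ ≤ K * (1 / (q * ((l : ℝ) + 1) ^ 2)) * S := by gcongr
      _ = _ := by rw [hη]; ring
  have k1 := key F f hF hFf hf hFb
  have k2 := key (fun _ => 1) (fun _ => 1) measurable_const (fun _ _ _ => rfl) rfl
    (fun r => by simpa using one_le_pow₀ hn1')
  have hYpos := h.sum_peakWeight_pos hb l
  set Y := ∑ i, peakWeight pos κ b i l with hY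
  set M := (peakMeasure ψ n l).real Set.univ with hM
  set a := √(n : ℝ) * b ^ (2 * l + 1) with ha
  have ha0 : 0 < a := by
    have := Real.sqrt_pos.2 hn0
    positivity
  have k3 : |a * M - Y| ≤ η * Y := by
    simp only [integral_const, norm_one, one_mul] at k2
    rw [← Real.norm_eq_abs, ← Complex.norm_real]
    refine le_trans (le_of_eq ?_) k2
    congr 1
    rw [hY, hM]
    push_cast
    simp
  have hfin := norm_div_sub_div_le hYpos hη2 hη0 k1 k3
    ((norm_sum_le _ _).trans (Finset.sum_le_sum fun i _ => by
      rw [norm_mul, Complex.norm_real, Real.norm_eq_abs, abs_of_pos (h.peakWeight_pos hb i l)]))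
  have hrw : peakMean ψ n l F = (a : ℂ) * (∫ r, F r ∂(peakMeasure ψ n l)) / ((a * M : ℝ) : ℂ) := by
    rw [peakMean, Complex.ofReal_mul a M, mul_div_mul_left]
    exact_mod_cast ha0.ne'
  rw [hrw, limitMean]
  refine hfin.trans (le_of_eq ?_)
  rw [hη]; ring

end PeakProfile

/-! ### Geometric decay in the degree -/

theorem tendsto_sqrt_sqrt_natCast : Tendsto (fun n : ℕ => √√(n : ℝ)) atTop atTop :=
  Real.tendsto_sqrt_atTop.comp (Real.tendsto_sqrt_atTop.comp tendsto_natCast_atTop_atTop)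

/-- The peak at `pos i₀` is the innermost one, and the peaks are `2ε`-separated. -/
structure PeaksSeparated {ι : Type*} (pos : ι → ℝ) (i₀ : ι) (ε : ℝ) : Prop where
  eps_pos : 0 < ε
  sep : ∀ i j, i ≠ j → 2 * ε ≤ |pos i - pos j|
  far : ∀ i, i ≠ i₀ → pos i₀ + 2 * ε ≤ pos i

/-- The test functions: constant near every peak, and equal to `1` in a disc around the innermost
peak. -/
structure PeakTest {ι : Type*} (pos : ι → ℝ) (i₀ : ι) (ε : ℝ) (F : ℝ → ℂ) (f : ι → ℂ)
    (Λ : ℝ) : Prop where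
  measurable : Measurable F
  eq_near : ∀ i r, |r - pos i| < ε → F r = f i
  eq_one : f i₀ = 1
  eq_one_of_lt : ∀ r, r < pos i₀ + 2 * ε → F r = 1
  norm_le : ∀ r, ‖F r‖ ≤ Λ

theorem PeakTest.norm_apply_le {ι : Type*} {pos : ι → ℝ} {i₀ : ι} {ε : ℝ} {F : ℝ → ℂ} {f : ι → ℂ}
    {Λ : ℝ} (hF : PeakTest pos i₀ ε F f Λ) (hε : 0 < ε) (i : ι) : ‖f i‖ ≤ Λ := by
  rw [← hF.eq_near i (pos i) (by simpa using hε)]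
  exact hF.norm_le _

/-- The geometric rate `θ < 1` at which the influence of the outer peaks decays. -/
def decayRate (b ε : ℝ) : ℝ := ((b + ε) / (b + 2 * ε)) ^ 2

theorem decayRate_nonneg (b ε : ℝ) : 0 ≤ decayRate b ε := sq_nonneg _

theorem decayRate_lt_one {b ε : ℝ} (hb : 0 < b) (hε : 0 < ε) : decayRate b ε < 1 := by
  have h1 : (b + ε) / (b + 2 * ε) < 1 := by rw [div_lt_one (by positivity)]; linarith
  exact pow_lt_one₀ (by positivity) h1 (by norm_num)

namespace PeakProfile

variable {ι : Type*} {ψ : ℝ → ℝ} {pos κ : ι → ℝ}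

theorem peakWeight_self (h : PeakProfile ψ pos κ) (i₀ : ι) (l : ℕ) :
    peakWeight pos κ (pos i₀) i₀ l = √(2 * Real.pi / κ i₀) := by
  rw [peakWeight, div_self (h.pos_pos i₀).ne', one_pow, mul_one]

theorem peakWeight_le (h : PeakProfile ψ pos κ) {i₀ : ι} {ε : ℝ} (hs : PeaksSeparated pos i₀ ε)
    {i : ι} (hi : i ≠ i₀) (l : ℕ) :
    peakWeight pos κ (pos i₀) i l ≤ √(2 * Real.pi / κ i) * decayRate (pos i₀) ε ^ l := by
  have hb := h.pos_pos i₀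
  have hε := hs.eps_pos
  have hfar := hs.far i hi
  rw [peakWeight]
  gcongr
  have h1 : pos i₀ / pos i ≤ (pos i₀ + ε) / (pos i₀ + 2 * ε) := by
    rw [div_le_div_iff₀ (h.pos_pos i) (by positivity)]
    nlinarith
  have h0 : 0 ≤ pos i₀ / pos i := div_nonneg hb.le (h.pos_pos i).le
  have h2 : pos i₀ / pos i ≤ 1 := by
    rw [div_le_one (h.pos_pos i)]; linarith
  rw [pow_succ, pow_mul, decayRate]
  calc ((pos i₀ / pos i) ^ 2) ^ l * (pos i₀ / pos i) ≤ ((pos i₀ / pos i) ^ 2) ^ l * 1 := by gcongr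
    _ ≤ _ := by rw [mul_one]; gcongr

/-- The innermost peak carries a fixed proportion of the total weight. -/
theorem exists_mul_sum_peakWeight_le [Fintype ι] (h : PeakProfile ψ pos κ) {i₀ : ι} {ε : ℝ}
    (hs : PeaksSeparated pos i₀ ε) :
    ∃ c : ℝ, 0 < c ∧ ∀ l, c * ∑ i, peakWeight pos κ (pos i₀) i l ≤
      peakWeight pos κ (pos i₀) i₀ l := by
  have hw : ∀ i, 0 < √(2 * Real.pi / κ i) := fun i => by
    have := h.κ_pos i
    have := Real.pi_pos
    positivity
  have hS : 0 < ∑ i, √(2 * Real.pi / κ i) :=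
    Finset.sum_pos (fun i _ => hw i) ⟨i₀, Finset.mem_univ _⟩
  refine ⟨√(2 * Real.pi / κ i₀) / ∑ i, √(2 * Real.pi / κ i), div_pos (hw i₀) hS, fun l => ?_⟩
  rw [h.peakWeight_self, div_mul_eq_mul_div, div_le_iff₀ hS]
  gcongr with i
  by_cases hi : i = i₀
  · rw [hi, h.peakWeight_self]
  · refine (h.peakWeight_le hs hi l).trans (mul_le_of_le_one_right (hw i).le ?_)
    exact pow_le_one₀ (decayRate_nonneg _ _) (decayRate_lt_one (h.pos_pos i₀) hs.eps_pos).le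

/-- The limiting factors tend to `1` geometrically. -/
theorem norm_limitMean_sub_one_le [Fintype ι] (h : PeakProfile ψ pos κ) {i₀ : ι} {ε : ℝ}
    (hs : PeaksSeparated pos i₀ ε) :
    ∃ C : ℝ, 0 < C ∧ ∀ (F : ℝ → ℂ) (f : ι → ℂ) (Λ : ℝ), PeakTest pos i₀ ε F f Λ → ∀ l,
      ‖limitMean pos κ (pos i₀) f l - 1‖ ≤ (Λ + 1) * C * decayRate (pos i₀) ε ^ l := by
  have : Nonempty ι := ⟨i₀⟩
  have hb := h.pos_pos i₀
  have hw : ∀ i, 0 < √(2 * Real.pi / κ i) := fun i => by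
    have := h.κ_pos i
    have := Real.pi_pos
    positivity
  have hS : 0 < ∑ i, √(2 * Real.pi / κ i) :=
    Finset.sum_pos (fun i _ => hw i) ⟨i₀, Finset.mem_univ _⟩
  refine ⟨(∑ i, √(2 * Real.pi / κ i)) / √(2 * Real.pi / κ i₀), div_pos hS (hw i₀),
    fun F f Λ hF l => ?_⟩
  have hθ := decayRate_nonneg (pos i₀) ε
  set θ := decayRate (pos i₀) ε
  have hYpos := h.sum_peakWeight_pos hb l
  have hΛ : 0 ≤ Λ := (norm_nonneg _).trans (hF.norm_le 0)
  set Y := ∑ i, peakWeight pos κ (pos i₀) i l with hY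
  have hYw : √(2 * Real.pi / κ i₀) ≤ Y := by
    rw [← h.peakWeight_self i₀ l]
    exact Finset.single_le_sum (f := fun i => peakWeight pos κ (pos i₀) i l)
      (fun i _ => (h.peakWeight_pos hb i l).le) (Finset.mem_univ i₀)
  have hYc : (Y : ℂ) ≠ 0 := by exact_mod_cast hYpos.ne'
  have h1 : limitMean pos κ (pos i₀) f l - 1 =
      (∑ i, (f i - 1) * peakWeight pos κ (pos i₀) i l) / (Y : ℂ) := by
    rw [limitMean, ← hY, div_sub_one hYc]
    congr 1
    simp only [sub_mul, Finset.sum_sub_distrib, one_mul]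
    rw [hY]; push_cast; rfl
  have h2 : ‖∑ i, (f i - 1) * peakWeight pos κ (pos i₀) i l‖ ≤
      (Λ + 1) * ((∑ i, √(2 * Real.pi / κ i)) * θ ^ l) := by
    rw [Finset.sum_mul, Finset.mul_sum]
    refine (norm_sum_le _ _).trans (Finset.sum_le_sum fun i _ => ?_)
    by_cases hi : i = i₀
    · rw [hi, hF.eq_one]; simp; positivity
    · rw [norm_mul, Complex.norm_real, Real.norm_eq_abs, abs_of_pos (h.peakWeight_pos hb i l)]
      have h3 : ‖f i - 1‖ ≤ Λ + 1 := by
        refine (norm_sub_le _ _).trans ?_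
        rw [norm_one]
        gcongr
        exact hF.norm_apply_le hs.eps_pos i
      have h4 := h.peakWeight_le hs hi l
      have h5 := h.peakWeight_pos hb i l
      gcongr
  rw [h1, norm_div, Complex.norm_real, Real.norm_eq_abs, abs_of_pos hYpos, div_le_iff₀ hYpos]
  refine h2.trans ?_
  have h6 : (Λ + 1) * ((∑ i, √(2 * Real.pi / κ i)) * θ ^ l) =
    (Λ + 1) * ((∑ i, √(2 * Real.pi / κ i)) / √(2 * Real.pi / κ i₀)) * θ ^ l *
      √(2 * Real.pi / κ i₀) := by
    have := (hw i₀).ne'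
    field_simp
  rw [h6]
  gcongr

/-- The proportion of mass outside the droplet decays geometrically, uniformly in `n`. -/
theorem exists_real_Ici_le [Fintype ι] (h : PeakProfile ψ pos κ) {i₀ : ι} {ε : ℝ}
    (hs : PeaksSeparated pos i₀ ε) :
    ∃ C : ℝ, 0 < C ∧ ∀ᶠ n : ℕ in atTop, ∀ l, l < n →
      (peakMeasure ψ n l).real (Set.Ici (pos i₀ + 2 * ε)) ≤
        C * decayRate (pos i₀) ε ^ l * (peakMeasure ψ n l).real Set.univ := by
  have : Nonempty ι := ⟨i₀⟩
  have hb := h.pos_pos i₀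
  have hε := hs.eps_pos
  -- at `l = 0`, Laplace's method for the indicator of `r < β` bounds the mass of the droplet below
  obtain ⟨C, hC, hev⟩ := h.norm_peakMean_sub_limitMean_le i₀ hε hs.sep 0
  obtain ⟨c, hc, hcl⟩ := h.exists_mul_sum_peakWeight_le hs
  set β := pos i₀ + ε with hβ
  classical
  set F : ℝ → ℂ := (Set.Iio β).indicator fun _ => 1 with hF
  set f : ι → ℂ := fun i => if i = i₀ then 1 else 0 with hf
  have hFm : Measurable F := measurable_const.indicator measurableSet_Iio
  have hFf : ∀ i r, |r - pos i| < ε → F r = f i := by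
    intro i r hr
    obtain ⟨h1, h2⟩ := abs_lt.1 hr
    by_cases hi : i = i₀
    · subst hi
      simp only [hF, hf, if_true]
      rw [Set.indicator_of_mem]
      show r < β
      linarith
    · have := hs.far i hi
      simp only [hF, hf, if_neg hi]
      rw [Set.indicator_of_notMem]
      show ¬ r < β
      linarith
  have hFb : ∀ r, ‖F r‖ ≤ 1 := fun r => by
    simp only [hF]
    refine (norm_indicator_le_norm_self _ _).trans (by simp)
  refine ⟨2 / c, by positivity, ?_⟩
  filter_upwards [hev, tendsto_sqrt_sqrt_natCast.eventually_ge_atTop (2 * C / c),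
    eventually_ge_atTop 1] with n hn hq hn1 l hl
  have hn0 : (0 : ℝ) < n := by exact_mod_cast hn1
  have hq0 : 0 < √√(n : ℝ) := Real.sqrt_pos.2 (Real.sqrt_pos.2 hn0)
  have hmain := hn 0 (by simpa using hn1) F f hFm hFf (by simp [hf]) (by simpa using hFb)
  have hY := h.sum_peakWeight_pos hb 0
  have hcl0 := hcl 0
  set Y := ∑ i, peakWeight pos κ (pos i₀) i 0 with hYdef
  set w := peakWeight pos κ (pos i₀) i₀ 0 with hw
  have hfin := h.isFiniteMeasure_peakMeasure (show 0 < n by omega)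
  have hU := h.real_univ_pos (show 0 < n by omega)
  set U := (peakMeasure ψ n 0).real Set.univ with hUdef
  set V := (peakMeasure ψ n 0).real (Set.Iio β) with hV
  have hw0 : 0 < w := h.peakWeight_pos hb _ _
  have hwY : w ≤ Y := Finset.single_le_sum (f := fun i => peakWeight pos κ (pos i₀) i 0)
      (fun i _ => (h.peakWeight_pos hb i 0).le) (Finset.mem_univ i₀)
  have e1 : peakMean ψ n 0 F = ((V / U : ℝ) : ℂ) := by
    rw [peakMean, hF, integral_indicator measurableSet_Iio]
    simp [hV, hUdef, measureReal_def]
  have e2 : limitMean pos κ (pos i₀) f 0 = ((w / Y : ℝ) : ℂ) := by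
    rw [limitMean]
    simp [hf, hw, hYdef]
  have e3 : ∑ i, ‖f i‖ * peakWeight pos κ (pos i₀) i 0 = w := by
    simp [hf, hw, apply_ite]
  rw [e1, e2, e3, ← Complex.ofReal_sub, Complex.norm_real, Real.norm_eq_abs] at hmain
  have h1 : C / (√√(n : ℝ) * (((0 : ℕ) : ℝ) + 1) ^ 2) ≤ c / 2 := by
    rw [div_le_iff₀ (by positivity)]
    rw [div_le_iff₀ hc] at hq
    simp only [Nat.cast_zero, zero_add, one_pow, mul_one]
    linarith
  have h2 : w / Y ≤ 1 := (div_le_one hY).2 hwY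
  have h3 : c ≤ w / Y := by rwa [le_div_iff₀ hY]
  have h4 : C / (√√(n : ℝ) * (((0 : ℕ) : ℝ) + 1) ^ 2) * (w / Y) ≤ c / 2 := by
    have : 0 ≤ w / Y := by positivity
    calc _ ≤ c / 2 * 1 := by gcongr
      _ = _ := mul_one _
  have h5 : c / 2 ≤ V / U := by
    have := (abs_le.1 hmain).1
    linarith
  rw [le_div_iff₀ hU] at h5
  have hV0 : 0 < V := lt_of_lt_of_le (by positivity) h5
  have h6 := h.real_Ici_le (β := β) (τ := pos i₀ + 2 * ε) (by positivity) (by positivity) hl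
  have hUl : 0 ≤ (peakMeasure ψ n l).real Set.univ := measureReal_nonneg
  have hθ := decayRate_nonneg (pos i₀) ε
  refine le_of_mul_le_mul_right (h6.trans ?_) hV0
  change decayRate (pos i₀) ε ^ l * U * _ ≤ _
  calc decayRate (pos i₀) ε ^ l * U * (peakMeasure ψ n l).real Set.univ
      = 2 / c * decayRate (pos i₀) ε ^ l * (peakMeasure ψ n l).real Set.univ * (c / 2 * U) := by
        field_simp
    _ ≤ _ := by gcongr

/-- The factors at finite `n` are close to `1`, with a bound which is geometric in `l` and uniform in `n`. -/
theorem norm_peakMean_sub_one_le [Fintype ι] (h : PeakProfile ψ pos κ) {i₀ : ι} {ε : ℝ}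
    (hs : PeaksSeparated pos i₀ ε) :
    ∃ C : ℝ, 0 < C ∧ ∀ᶠ n : ℕ in atTop, ∀ l, l < n →
      ∀ (F : ℝ → ℂ) (f : ι → ℂ) (Λ : ℝ), PeakTest pos i₀ ε F f Λ →
      ‖peakMean ψ n l F - 1‖ ≤ (Λ + 1) * C * decayRate (pos i₀) ε ^ l := by
  have : Nonempty ι := ⟨i₀⟩
  obtain ⟨C, hC, hev⟩ := h.exists_real_Ici_le hs
  refine ⟨C, hC, ?_⟩
  filter_upwards [hev] with n hn l hl F f Λ hF
  have hI := hn l hl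
  have hfin := h.isFiniteMeasure_peakMeasure hl
  have hU := h.real_univ_pos hl
  have hΛ : 0 ≤ Λ := (norm_nonneg _).trans (hF.norm_le 0)
  set μ := peakMeasure ψ n l
  set U := μ.real Set.univ with hUdef
  set τ := pos i₀ + 2 * ε with hτ
  have hFi : Integrable F μ := Integrable.of_bound hF.measurable.aestronglyMeasurable Λ
    (Eventually.of_forall hF.norm_le)
  have hUc : (U : ℂ) ≠ 0 := by exact_mod_cast hU.ne'
  have h1 : peakMean ψ n l F - 1 = (∫ r, (F r - 1) ∂μ) / (U : ℂ) := by
    rw [peakMean, integral_sub hFi (integrable_const _)]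
    simp only [integral_const, Complex.real_smul, mul_one]
    rw [sub_div, div_self hUc]
  have h2 : ‖∫ r, (F r - 1) ∂μ‖ ≤ ∫ r, (Set.Ici τ).indicator (fun _ => Λ + 1) r ∂μ := by
    refine norm_integral_le_of_norm_le ((integrable_const _).indicator measurableSet_Ici)
      (Eventually.of_forall fun r => ?_)
    by_cases hr : r ∈ Set.Ici τ
    · rw [Set.indicator_of_mem hr]
      refine (norm_sub_le _ _).trans ?_
      rw [norm_one]
      gcongr
      exact hF.norm_le r
    · rw [Set.indicator_of_notMem hr, hF.eq_one_of_lt r (not_le.1 hr), sub_self, norm_zero]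
  rw [integral_indicator measurableSet_Ici, setIntegral_const, smul_eq_mul] at h2
  rw [h1, norm_div, Complex.norm_real, Real.norm_eq_abs, abs_of_pos hU, div_le_iff₀ hU]
  refine h2.trans ?_
  calc μ.real (Set.Ici τ) * (Λ + 1) ≤ (C * decayRate (pos i₀) ε ^ l * U) * (Λ + 1) := by gcongr
    _ = _ := by ring

end PeakProfile

/-! ### Convergence of the products -/

namespace PeakProfile

variable {ι : Type*} [Fintype ι] {ψ : ℝ → ℝ} {pos κ : ι → ℝ}

theorem limitMean_ofReal (f : ι → ℝ) (b : ℝ) (l : ℕ) :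
    limitMean pos κ b (fun i => (f i : ℂ)) l =
      (((∑ i, f i * peakWeight pos κ b i l) / ∑ i, peakWeight pos κ b i l : ℝ) : ℂ) := by
  rw [limitMean]; push_cast; rfl

/-- For positive test values the relative error of replacing `peakMean` by `limitMean` is
dominated by a summable sequence times a negative power of `n`, even for polynomially large test
functions. -/
theorem exists_summable_relative_error (h : PeakProfile ψ pos κ) {i₀ : ι} {ε : ℝ}
    (hs : PeaksSeparated pos i₀ ε) (N : ℕ) :
    ∃ D : ℕ → ℝ, Summable D ∧ ∀ᶠ n : ℕ in atTop, ∀ (F : ℝ → ℂ) (f : ι → ℝ),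
      (∀ i, 0 < f i) → PeakTest pos i₀ ε F (fun i => (f i : ℂ)) ((n : ℝ) ^ N) → ∀ l,
      ‖(if l < n then peakMean ψ n l F else 1) / limitMean pos κ (pos i₀) (fun i => (f i : ℂ)) l - 1‖
        ≤ D l / √√(n : ℝ) := by
  have : Nonempty ι := ⟨i₀⟩
  have hb := h.pos_pos i₀
  obtain ⟨C₁, hC₁, h1⟩ := h.norm_peakMean_sub_limitMean_le i₀ hs.eps_pos hs.sep N
  obtain ⟨C₂, hC₂, h2⟩ := h.norm_peakMean_sub_one_le hs
  obtain ⟨C₃, hC₃, h3⟩ := h.norm_limitMean_sub_one_le hs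
  obtain ⟨c, hc, hcl⟩ := h.exists_mul_sum_peakWeight_le hs
  have hθ0 := decayRate_nonneg (pos i₀) ε
  have hθ1 := decayRate_lt_one hb hs.eps_pos
  set θ := decayRate (pos i₀) ε with hθ
  set M := 12 * (N + 1) with hM
  set K := 2 * (C₂ + C₃) / c with hK
  have hK0 : 0 < K := by positivity
  refine ⟨fun l => C₁ / ((l : ℝ) + 1) ^ 2 + K * (((l : ℝ) + 1) ^ M * θ ^ l), ?_, ?_⟩
  · refine Summable.add ?_ (Summable.mul_left _ ?_)
    · have hsum := (summable_nat_add_iff 1).2 (Real.summable_one_div_nat_pow.2 one_lt_two)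
      simpa [div_eq_mul_inv] using hsum.mul_left C₁
    · rcases hθ0.eq_or_lt with h0 | h0
      · refine summable_of_ne_finset_zero (s := {0}) fun l hl => ?_
        rw [← h0, zero_pow (by simpa using hl), mul_zero]
      · have hsum := (summable_nat_add_iff 1).2 (summable_pow_mul_geometric_of_norm_lt_one M
          (r := θ) (by rwa [Real.norm_eq_abs, abs_of_nonneg hθ0]))
        refine (hsum.mul_left θ⁻¹).congr fun l => ?_
        push_cast
        rw [pow_succ]
        field_simp
  filter_upwards [h1, h2, eventually_ge_atTop 1] with n hn1 hn2 hn3 F f hfpos hF l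
  have hn0 : (0 : ℝ) < n := by exact_mod_cast hn3
  have hn1' : (1 : ℝ) ≤ n := by exact_mod_cast hn3
  have hq0 : 0 < √√(n : ℝ) := Real.sqrt_pos.2 (Real.sqrt_pos.2 hn0)
  have hqn : √√(n : ℝ) ≤ n := by
    rw [Real.sqrt_le_left hn0.le, Real.sqrt_le_left (by positivity)]
    have : (1 : ℝ) ≤ n ^ 3 := one_le_pow₀ hn1'
    nlinarith
  have hYpos := h.sum_peakWeight_pos hb l
  have hcl' := hcl l
  have hLim := limitMean_ofReal (pos := pos) (κ := κ) f (pos i₀) l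
  set L := limitMean pos κ (pos i₀) (fun i => (f i : ℂ)) l with hL
  set Y := ∑ i, peakWeight pos κ (pos i₀) i l with hY
  set X := ∑ i, f i * peakWeight pos κ (pos i₀) i l with hX
  have hwX : peakWeight pos κ (pos i₀) i₀ l ≤ X := by
    have h1 := Finset.single_le_sum (f := fun i => f i * peakWeight pos κ (pos i₀) i l)
      (fun i _ => mul_nonneg (hfpos i).le (h.peakWeight_pos hb i l).le) (Finset.mem_univ i₀)
    have h2 : f i₀ = 1 := by
      have := hF.eq_one
      exact_mod_cast this
    simpa [h2] using h1
  have hXpos : 0 < X := (h.peakWeight_pos hb i₀ l).trans_le hwX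
  have hLnorm : ‖L‖ = X / Y := by
    rw [hLim, Complex.norm_real, Real.norm_eq_abs, abs_of_pos (by positivity)]
  have hLpos : 0 < ‖L‖ := by rw [hLnorm]; positivity
  have hLc : c ≤ ‖L‖ := by rw [hLnorm, le_div_iff₀ hYpos]; exact hcl'.trans hwX
  have hL0 : L ≠ 0 := norm_pos_iff.1 hLpos
  have hl1 : (1 : ℝ) ≤ (l : ℝ) + 1 := by linarith [(Nat.cast_nonneg l : (0 : ℝ) ≤ l)]
  rw [div_sub_one hL0, norm_div, div_le_iff₀ hLpos]
  have hA0 : 0 ≤ C₁ / ((l : ℝ) + 1) ^ 2 := by positivity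
  have hB0 : 0 ≤ K * (((l : ℝ) + 1) ^ M * θ ^ l) := by positivity
  -- Laplace's method for small `l`; for large `l` both means are geometrically close to `1`
  by_cases hl : (l + 1) ^ 12 ≤ n
  · have hln : l < n := by
      have : l + 1 ≤ (l + 1) ^ 12 := Nat.le_self_pow (by norm_num) _
      omega
    rw [if_pos hln]
    refine (hn1 l hl F _ hF.measurable hF.eq_near hF.eq_one hF.norm_le).trans ?_
    have hS : ∑ i, ‖(f i : ℂ)‖ * peakWeight pos κ (pos i₀) i l = X := by
      refine Finset.sum_congr rfl fun i _ => ?_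
      rw [Complex.norm_real, Real.norm_eq_abs, abs_of_pos (hfpos i)]
    rw [hS, hLnorm]
    have : C₁ / (√√(n : ℝ) * ((l : ℝ) + 1) ^ 2) = C₁ / ((l : ℝ) + 1) ^ 2 / √√(n : ℝ) := by
      field_simp
    rw [this]
    have hXY : 0 ≤ X / Y := by positivity
    gcongr
    linarith
  · have hE : ‖(if l < n then peakMean ψ n l F else 1) - 1‖ ≤ ((n : ℝ) ^ N + 1) * C₂ * θ ^ l := by
      split_ifs with hln
      · exact hn2 l hln F _ _ hF
      · rw [sub_self, norm_zero]; positivity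
    have hE2 := h3 F _ _ hF l
    have hnl : (n : ℝ) ≤ ((l : ℝ) + 1) ^ 12 := by exact_mod_cast (not_le.1 hl).le
    have hpow : (n : ℝ) ^ N * √√(n : ℝ) ≤ ((l : ℝ) + 1) ^ M := by
      calc (n : ℝ) ^ N * √√(n : ℝ) ≤ (n : ℝ) ^ N * n := by gcongr
        _ = (n : ℝ) ^ (N + 1) := (pow_succ _ _).symm
        _ ≤ (((l : ℝ) + 1) ^ 12) ^ (N + 1) := by gcongr
        _ = _ := by rw [← pow_mul]
    have hone : (1 : ℝ) ≤ (n : ℝ) ^ N := one_le_pow₀ hn1'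
    calc ‖(if l < n then peakMean ψ n l F else 1) - L‖
        ≤ ‖(if l < n then peakMean ψ n l F else 1) - 1‖ + ‖L - 1‖ := by
          rw [norm_sub_rev L 1]
          exact norm_sub_le_norm_sub_add_norm_sub _ _ _
      _ ≤ ((n : ℝ) ^ N + 1) * C₂ * θ ^ l + ((n : ℝ) ^ N + 1) * C₃ * θ ^ l := add_le_add hE hE2
      _ = ((n : ℝ) ^ N + 1) * ((C₂ + C₃) * θ ^ l) := by ring
      _ ≤ (2 * (n : ℝ) ^ N) * ((C₂ + C₃) * θ ^ l) := by gcongr; linarith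
      _ = K * (((n : ℝ) ^ N * √√(n : ℝ)) * θ ^ l) / √√(n : ℝ) * c := by
          rw [hK]; field_simp
      _ ≤ K * (((l : ℝ) + 1) ^ M * θ ^ l) / √√(n : ℝ) * ‖L‖ := by gcongr
      _ ≤ _ := by gcongr; linarith

/-- The product of the means is relatively close to the limiting product. -/
theorem norm_prod_peakMean_sub_le (h : PeakProfile ψ pos κ) {i₀ : ι} {ε : ℝ}
    (hs : PeaksSeparated pos i₀ ε) (N : ℕ) {δ : ℝ} (hδ : 0 < δ) :
    ∀ᶠ n : ℕ in atTop, ∀ (F : ℝ → ℂ) (f : ι → ℝ) (G : ℂ), (∀ i, 0 < f i) →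
      PeakTest pos i₀ ε F (fun i => (f i : ℂ)) ((n : ℝ) ^ N) →
      Tendsto (fun k => ∏ l ∈ Finset.range k, limitMean pos κ (pos i₀) (fun i => (f i : ℂ)) l)
        atTop (𝓝 G) →
      ‖∏ l ∈ Finset.range n, peakMean ψ n l F - G‖ ≤ δ * ‖G‖ := by
  have : Nonempty ι := ⟨i₀⟩
  have hb := h.pos_pos i₀
  obtain ⟨D, hD, hev⟩ := h.exists_summable_relative_error hs N
  have hlim : Tendsto (fun n : ℕ => Real.exp ((∑' l, |D l|) / √√(n : ℝ)) - 1) atTop (𝓝 0) := by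
    have h1 : Tendsto (fun n : ℕ => (∑' l, |D l|) / √√(n : ℝ)) atTop (𝓝 0) :=
      tendsto_const_nhds.div_atTop tendsto_sqrt_sqrt_natCast
    have h2 := (Real.continuous_exp.tendsto 0).comp h1
    have h3 := h2.sub_const 1
    simpa using h3
  filter_upwards [hev, hlim.eventually (gt_mem_nhds hδ)] with n hn hnδ F f G hf hF hG
  -- the product at finite `n`, continued by factors `1`
  set a : ℕ → ℂ := fun l => if l < n then peakMean ψ n l F else 1 with ha
  set L : ℕ → ℂ := limitMean pos κ (pos i₀) (fun i => (f i : ℂ)) with hL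
  have hL0 : ∀ l, L l ≠ 0 := fun l => by
    rw [hL, limitMean_ofReal]
    have hX : 0 < ∑ i, f i * peakWeight pos κ (pos i₀) i l :=
      Finset.sum_pos (fun i _ => mul_pos (hf i) (h.peakWeight_pos hb i l)) Finset.univ_nonempty
    have hY := h.sum_peakWeight_pos hb l
    exact_mod_cast (div_pos hX hY).ne'
  have ha_prod : ∀ k, n ≤ k → ∏ l ∈ Finset.range k, a l = ∏ l ∈ Finset.range n, peakMean ψ n l F := by
    intro k hk
    rw [← Finset.prod_range_mul_prod_Ico _ hk]
    rw [Finset.prod_eq_one (s := Finset.Ico n k), mul_one]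
    · refine Finset.prod_congr rfl fun l hl => ?_
      simp only [ha, if_pos (Finset.mem_range.1 hl)]
    · intro l hl
      simp only [ha, if_neg (not_lt.2 (Finset.mem_Ico.1 hl).1)]
  refine le_of_tendsto_of_tendsto (tendsto_const_nhds.sub hG).norm (hG.norm.const_mul δ) ?_
  filter_upwards [eventually_ge_atTop n] with k hk
  have h1 := Finset.norm_prod_one_add_sub_one_le (Finset.range k) fun l => a l / L l - 1
  have h2 : ∑ l ∈ Finset.range k, ‖a l / L l - 1‖ ≤ (∑' l, |D l|) / √√(n : ℝ) := by
    calc ∑ l ∈ Finset.range k, ‖a l / L l - 1‖ ≤ ∑ l ∈ Finset.range k, |D l| / √√(n : ℝ) := by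
          refine Finset.sum_le_sum fun l _ => (hn F f hf hF l).trans ?_
          gcongr; exact le_abs_self _
      _ = (∑ l ∈ Finset.range k, |D l|) / √√(n : ℝ) := (Finset.sum_div _ _ _).symm
      _ ≤ _ := by
          gcongr
          exact hD.abs.sum_le_tsum _ fun _ _ => abs_nonneg _
  have h3 : ∏ l ∈ Finset.range k, (1 + (a l / L l - 1)) =
      (∏ l ∈ Finset.range n, peakMean ψ n l F) / ∏ l ∈ Finset.range k, L l := by
    rw [← ha_prod k hk, ← Finset.prod_div_distrib]
    exact Finset.prod_congr rfl fun l _ => by ring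
  have hPL : ∏ l ∈ Finset.range k, L l ≠ 0 := Finset.prod_ne_zero_iff.2 fun l _ => hL0 l
  rw [h3, div_sub_one hPL, norm_div, div_le_iff₀ (norm_pos_iff.2 hPL)] at h1
  refine h1.trans ?_
  gcongr
  have := Real.exp_le_exp.2 h2
  linarith

/-- For bounded test functions the product of the means converges. -/
theorem tendsto_prod_peakMean (h : PeakProfile ψ pos κ) {i₀ : ι} {ε : ℝ}
    (hs : PeaksSeparated pos i₀ ε) {F : ℝ → ℂ} {f : ι → ℂ} (hF : PeakTest pos i₀ ε F f 1) :
    Tendsto (fun n => ∏ l ∈ Finset.range n, peakMean ψ n l F) atTop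
      (𝓝 (∏' l, limitMean pos κ (pos i₀) f l)) := by
  have : Nonempty ι := ⟨i₀⟩
  have hb := h.pos_pos i₀
  obtain ⟨C₁, hC₁, h1⟩ := h.norm_peakMean_sub_limitMean_le i₀ hs.eps_pos hs.sep 0
  obtain ⟨C₂, hC₂, h2⟩ := h.norm_peakMean_sub_one_le hs
  have hθ0 := decayRate_nonneg (pos i₀) ε
  have hθ1 := decayRate_lt_one hb hs.eps_pos
  set θ := decayRate (pos i₀) ε with hθ
  have key := tendsto_tprod_one_add_of_dominated_convergence
    (f := fun (n l : ℕ) => (if l < n then peakMean ψ n l F else 1) - 1)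
    (g := fun l => limitMean pos κ (pos i₀) f l - 1) (𝓕 := atTop)
    (bound := fun l => (1 + 1) * C₂ * θ ^ l)
    ((summable_geometric_of_lt_one hθ0 hθ1).mul_left _) ?_ ?_
  · simp only [add_sub_cancel] at key
    refine key.congr fun n => ?_
    rw [tprod_eq_prod (s := Finset.range n)]
    · exact Finset.prod_congr rfl fun l hl => if_pos (Finset.mem_range.1 hl)
    · intro l hl
      exact if_neg (by simpa using hl)
  · intro l
    refine Tendsto.sub_const ?_ 1
    rw [tendsto_iff_norm_sub_tendsto_zero]
    set W := (∑ i, ‖f i‖ * peakWeight pos κ (pos i₀) i l) / ∑ i, peakWeight pos κ (pos i₀) i l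
    have hz : Tendsto (fun n : ℕ => C₁ * W / ((l : ℝ) + 1) ^ 2 / √√(n : ℝ)) atTop (𝓝 0) :=
      tendsto_const_nhds.div_atTop tendsto_sqrt_sqrt_natCast
    refine squeeze_zero' (Eventually.of_forall fun _ => norm_nonneg _) ?_ hz
    filter_upwards [h1, eventually_ge_atTop ((l + 1) ^ 12), eventually_gt_atTop l] with n hn1 hn2 hn3
    rw [if_pos hn3]
    refine (hn1 l hn2 F f hF.measurable hF.eq_near hF.eq_one
      (by simpa using hF.norm_le)).trans (le_of_eq ?_)
    have : 0 < √√(n : ℝ) := Real.sqrt_pos.2 (Real.sqrt_pos.2 (by exact_mod_cast (by omega : 0 < n)))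
    field_simp
    rfl
  · filter_upwards [h2] with n hn l
    split_ifs with hl
    · exact hn l hl F f 1 hF
    · rw [sub_self, norm_zero]; positivity

end PeakProfile

/-! ### Convergence of the generating functions -/

theorem continuous_cutoff (ε t : ℝ) : Continuous (cutoff ε t) := by
  unfold cutoff
  exact (Real.smoothTransition.continuous.comp (by fun_prop)).mul
    (Real.smoothTransition.continuous.comp (by fun_prop))

theorem cutoff_nonneg (ε t r : ℝ) : 0 ≤ cutoff ε t r :=
  mul_nonneg (Real.smoothTransition.nonneg _) (Real.smoothTransition.nonneg _)

theorem cutoff_le_one (ε t r : ℝ) : cutoff ε t r ≤ 1 :=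
  mul_le_one₀ (Real.smoothTransition.le_one _) (Real.smoothTransition.nonneg _)
    (Real.smoothTransition.le_one _)

theorem cutoff_eq_one {ε t r : ℝ} (hε : 0 < ε) (hr : |r - t| < ε / 2) : cutoff ε t r = 1 := by
  obtain ⟨h1, h2⟩ := abs_lt.1 hr
  rw [cutoff, Real.smoothTransition.one_of_one_le, Real.smoothTransition.one_of_one_le, one_mul]
  · rw [one_le_div (by positivity)]; linarith
  · rw [one_le_div (by positivity)]; linarith

theorem cutoff_eq_zero {ε t r : ℝ} (hε : 0 < ε) (hr : ε ≤ |r - t|) : cutoff ε t r = 0 := by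
  rw [cutoff]
  rcases le_abs.1 hr with h | h
  · rw [Real.smoothTransition.zero_of_nonpos (x := (t + ε - r) / (ε / 2)), mul_zero]
    exact div_nonpos_of_nonpos_of_nonneg (by linarith) (by positivity)
  · rw [Real.smoothTransition.zero_of_nonpos (x := (r - (t - ε)) / (ε / 2)), zero_mul]
    exact div_nonpos_of_nonpos_of_nonneg (by linarith) (by positivity)

/-- The one-particle function `exp (∑_k c_k χ_k)` whose product over the particles is
`exp (∑_k c_k N_{n,k})`. -/
def testFun {m : ℕ} (ε : ℝ) (t : Fin m → ℝ) (c : Fin m → ℂ) (r : ℝ) : ℂ :=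
  Complex.exp (∑ k, c k * (cutoff ε (t k) r : ℂ))

/-- The values of `testFun` at the peaks. -/
def testValue {m : ℕ} (c : Fin m → ℂ) : Option (Fin m) → ℂ := fun i =>
  i.elim 1 fun k => Complex.exp (c k)

theorem measurable_outpostCount {m : ℕ} (ε : ℝ) (t : Fin m → ℝ) (n : ℕ) :
    Measurable (outpostCount ε t n) := by
  refine measurable_pi_lambda _ fun k => Finset.measurable_sum _ fun j _ => ?_
  exact (continuous_cutoff ε (t k)).measurable.comp (measurable_pi_apply j).norm

namespace OutpostPotential

variable {Q : ℂ → EReal} {m : ℕ} {a₀ b₀ : ℝ} {t : Fin m → ℝ} {ε : ℝ}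

theorem four_mul_eps_le (h : OutpostPotential Q a₀ b₀ t ε) {k l : Fin m} (hkl : k ≠ l) :
    4 * ε ≤ |t k - t l| := by
  rcases lt_or_gt_of_ne hkl with h1 | h1
  · have := h.sep_t k l h1
    rw [abs_sub_comm]
    exact le_trans (by linarith) (le_abs_self _)
  · have := h.sep_t l k h1
    exact le_trans (by linarith) (le_abs_self _)

theorem peaksSeparated (h : OutpostPotential Q a₀ b₀ t ε) :
    PeaksSeparated (peakPos b₀ t) none (ε / 2) where
  eps_pos := half_pos h.eps_pos
  sep i j hij := by
    have hε := h.eps_pos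
    rcases i with _ | k <;> rcases j with _ | l
    · exact absurd rfl hij
    · have := h.sep_b l
      simp only [peakPos, Option.elim]
      rw [abs_sub_comm]
      exact le_trans (by linarith) (le_abs_self _)
    · have := h.sep_b k
      simp only [peakPos, Option.elim]
      exact le_trans (by linarith) (le_abs_self _)
    · have := h.four_mul_eps_le (k := k) (l := l) fun hkl => hij (by rw [hkl])
      simp only [peakPos, Option.elim]
      linarith
  far i hi := by
    have hε := h.eps_pos
    rcases i with _ | k
    · exact absurd rfl hi
    · have := h.sep_b k
      simp only [peakPos, Option.elim]
      linarith

theorem testFun_eq_of_near (h : OutpostPotential Q a₀ b₀ t ε) (c : Fin m → ℂ) {k : Fin m} {r : ℝ}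
    (hr : |r - t k| < ε / 2) : testFun ε t c r = Complex.exp (c k) := by
  have hε := h.eps_pos
  rw [testFun, Finset.sum_eq_single k, cutoff_eq_one hε hr, Complex.ofReal_one, mul_one]
  · intro l _ hl
    rw [cutoff_eq_zero hε, Complex.ofReal_zero, mul_zero]
    have h1 := h.four_mul_eps_le hl
    have h2 : |t l - t k| ≤ |r - t k| + |r - t l| := by
      have := abs_sub_le (t l) r (t k)
      rw [abs_sub_comm (t l) r] at this
      linarith
    linarith
  · exact fun hk => absurd (Finset.mem_univ k) hk

theorem testFun_eq_one (h : OutpostPotential Q a₀ b₀ t ε) (c : Fin m → ℂ) {r : ℝ}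
    (hr : r < b₀ + ε) : testFun ε t c r = 1 := by
  rw [testFun, Finset.sum_eq_zero, Complex.exp_zero]
  intro k _
  rw [cutoff_eq_zero h.eps_pos, Complex.ofReal_zero, mul_zero]
  have := h.sep_b k
  rw [abs_sub_comm]
  exact le_trans (by linarith) (le_abs_self _)

theorem norm_testFun_le (ε : ℝ) (t : Fin m → ℝ) (c : Fin m → ℂ) (r : ℝ) :
    ‖testFun ε t c r‖ ≤ Real.exp (∑ k, |(c k).re|) := by
  rw [testFun, Complex.norm_exp, Complex.re_sum]
  refine Real.exp_le_exp.2 (Finset.sum_le_sum fun k _ => ?_)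
  rw [Complex.re_mul_ofReal]
  refine (le_abs_self _).trans ?_
  rw [abs_mul, abs_of_nonneg (cutoff_nonneg _ _ _)]
  exact mul_le_of_le_one_right (abs_nonneg _) (cutoff_le_one _ _ _)

theorem measurable_testFun (ε : ℝ) (t : Fin m → ℝ) (c : Fin m → ℂ) :
    Measurable (testFun ε t c) := by
  have := fun k => continuous_cutoff ε (t k)
  unfold testFun
  fun_prop

theorem peakTest_testFun (h : OutpostPotential Q a₀ b₀ t ε) (c : Fin m → ℂ) {Λ : ℝ}
    (hΛ : Real.exp (∑ k, |(c k).re|) ≤ Λ) :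
    PeakTest (peakPos b₀ t) none (ε / 2) (testFun ε t c) (testValue c) Λ where
  measurable := measurable_testFun ε t c
  eq_near i r hr := by
    rcases i with _ | k
    · refine h.testFun_eq_one c ?_
      have h1 := (abs_lt.1 hr).2
      have h2 := h.eps_pos
      simp only [peakPos, Option.elim] at h1
      linarith
    · exact h.testFun_eq_of_near c hr
  eq_one := rfl
  eq_one_of_lt r hr := by
    refine h.testFun_eq_one c ?_
    simp only [peakPos, Option.elim] at hr
    linarith
  norm_le r := (norm_testFun_le ε t c r).trans hΛ

/-- Exponential moments of the counts factorise into means over the peaks. -/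
theorem integral_exp_outpostCount (h : OutpostPotential Q a₀ b₀ t ε) (n : ℕ) (c : Fin m → ℂ) :
    ∫ z, Complex.exp (∑ k, c k * (outpostCount ε t n z k : ℂ)) ∂(gasLaw Q n) =
      ∏ l ∈ Finset.range n, peakMean (profile Q b₀) n l (testFun ε t c) := by
  simp only [peakMean]
  rw [← h.integral_prod_gasLaw n (measurable_testFun ε t c) (norm_testFun_le ε t c)]
  congr 1
  funext z
  simp only [testFun]
  rw [← Complex.exp_sum, Finset.sum_comm]
  congr 1
  refine Finset.sum_congr rfl fun k _ => ?_
  rw [outpostCount, Complex.ofReal_sum, Finset.mul_sum]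

/-- The ratio of the masses of an outpost and of the boundary `b₀` is `ϑ_k ρ_k^{2l+1}`. -/
theorem peakWeight_some (h : OutpostPotential Q a₀ b₀ t ε) (k : Fin m) (l : ℕ) :
    peakWeight (peakPos b₀ t) (fun i => 4 * quarterLaplacian Q (peakPos b₀ t i : ℂ)) b₀ (some k) l =
      √(2 * Real.pi / (4 * quarterLaplacian Q (b₀ : ℂ))) *
        (vartheta Q b₀ (t k) * (b₀ / t k) ^ (2 * l + 1)) := by
  have h1 := h.lap_pos _ h.b_mem
  have h2 := h.lap_pos _ (h.t_mem k)
  have hpi := Real.pi_pos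
  rw [peakWeight, vartheta, ← mul_assoc, ← Real.sqrt_mul (by positivity)]
  simp only [peakPos, Option.elim]
  congr 2
  field_simp

/-- The limiting means are the factors of the limiting generating function. -/
theorem limitMean_testValue (h : OutpostPotential Q a₀ b₀ t ε) (c : Fin m → ℂ) (l : ℕ) :
    limitMean (peakPos b₀ t) (fun i => 4 * quarterLaplacian Q (peakPos b₀ t i : ℂ))
      (peakPos b₀ t none) (testValue c) l =
      (1 + ∑ k, Complex.exp (c k) * ((vartheta Q b₀ (t k) * (b₀ / t k) ^ (2 * l + 1) : ℝ) : ℂ)) /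
        ((1 + ∑ k, vartheta Q b₀ (t k) * (b₀ / t k) ^ (2 * l + 1) : ℝ) : ℂ) := by
  change limitMean (peakPos b₀ t) (fun i => 4 * quarterLaplacian Q (peakPos b₀ t i : ℂ)) b₀
    (testValue c) l = _
  have hpos := h.lap_pos _ h.b_mem
  have hpi := Real.pi_pos
  set w := √(2 * Real.pi / (4 * quarterLaplacian Q (b₀ : ℂ))) with hw
  have hw0 : 0 < w := by positivity
  have hnone : peakWeight (peakPos b₀ t)
      (fun i => 4 * quarterLaplacian Q (peakPos b₀ t i : ℂ)) b₀ none l = w := by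
    rw [peakWeight]
    simp only [peakPos, Option.elim]
    rw [div_self h.b_pos.ne', one_pow, mul_one]
  have hwc : (w : ℂ) ≠ 0 := by exact_mod_cast hw0.ne'
  rw [limitMean, Fintype.sum_option, Fintype.sum_option, hnone]
  simp only [h.peakWeight_some, ← hw, testValue, Option.elim, one_mul]
  rw [← mul_div_mul_left (1 + ∑ k, Complex.exp (c k) * _) _ hwc, mul_add, Finset.mul_sum, mul_one]
  congr 1
  · congr 1
    refine Finset.sum_congr rfl fun k _ => ?_
    push_cast; ring
  · rw [← Complex.ofReal_mul, mul_add, Finset.mul_sum, mul_one]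

theorem vartheta_pos (h : OutpostPotential Q a₀ b₀ t ε) (k : Fin m) : 0 < vartheta Q b₀ (t k) :=
  Real.sqrt_pos.2 (div_pos (h.lap_pos _ h.b_mem) (h.lap_pos _ (h.t_mem k)))

theorem ratio_pos (h : OutpostPotential Q a₀ b₀ t ε) (k : Fin m) : 0 < b₀ / t k :=
  div_pos h.b_pos (h.t_pos k)

theorem ratio_lt_one (h : OutpostPotential Q a₀ b₀ t ε) (k : Fin m) : b₀ / t k < 1 :=
  (div_lt_one (h.t_pos k)).2 (h.b_lt k)

end OutpostPotential

/-! ### The limiting generating function -/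

section LimitMGF

variable {m : ℕ} {ϑ ρ : Fin m → ℝ}

theorem summable_sum_mul_pow (c : Fin m → ℝ) (hρ0 : ∀ k, 0 < ρ k) (hρ1 : ∀ k, ρ k < 1) :
    Summable fun j : ℕ => ∑ k, c k * ρ k ^ (2 * j + 1) := by
  refine summable_sum fun k _ => Summable.mul_left _ ?_
  have h1 : ρ k ^ 2 < 1 := pow_lt_one₀ (hρ0 k).le (hρ1 k) two_ne_zero
  refine ((summable_geometric_of_lt_one (sq_nonneg _) h1).mul_right (ρ k)).congr fun j => ?_
  rw [pow_succ (ρ k) (2 * j), pow_mul]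

theorem one_add_sum_pos (hϑ : ∀ k, 0 < ϑ k) (hρ0 : ∀ k, 0 < ρ k) (j : ℕ) :
    0 < 1 + ∑ k, ϑ k * ρ k ^ (2 * j + 1) :=
  add_pos_of_pos_of_nonneg one_pos
    (Finset.sum_nonneg fun k _ => mul_nonneg (hϑ k).le (pow_nonneg (hρ0 k).le _))

theorem tendsto_prod_limitMGF (hϑ : ∀ k, 0 < ϑ k) (hρ0 : ∀ k, 0 < ρ k) (hρ1 : ∀ k, ρ k < 1)
    (s : Fin m → ℝ) :
    Tendsto (fun N => ∏ j ∈ Finset.range N, (1 + ∑ k, Real.exp (s k) * ϑ k * ρ k ^ (2 * j + 1)) /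
      (1 + ∑ k, ϑ k * ρ k ^ (2 * j + 1))) atTop (𝓝 (limitMGF ϑ ρ s)) := by
  have h1 := Real.multipliable_one_add_of_summable
    (summable_sum_mul_pow (fun k => Real.exp (s k) * ϑ k) hρ0 hρ1)
  have h2 := Real.multipliable_one_add_of_summable (summable_sum_mul_pow ϑ hρ0 hρ1)
  have hmul : Multipliable fun j : ℕ => (1 + ∑ k, Real.exp (s k) * ϑ k * ρ k ^ (2 * j + 1)) /
      (1 + ∑ k, ϑ k * ρ k ^ (2 * j + 1)) := by
    have hsum : Summable fun j : ℕ => (∑ k, (Real.exp (s k) - 1) * ϑ k * ρ k ^ (2 * j + 1)) /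
        (1 + ∑ k, ϑ k * ρ k ^ (2 * j + 1)) := by
      have hs := (summable_sum_mul_pow (fun k => |Real.exp (s k) - 1| * ϑ k) hρ0 hρ1)
      refine hs.of_norm_bounded fun j => ?_
      have hpos := one_add_sum_pos hϑ hρ0 j
      rw [norm_div, Real.norm_eq_abs, Real.norm_eq_abs, abs_of_pos hpos, div_le_iff₀ hpos]
      have hle : 1 ≤ 1 + ∑ k, ϑ k * ρ k ^ (2 * j + 1) := le_add_of_nonneg_right
        (Finset.sum_nonneg fun k _ => mul_nonneg (hϑ k).le (pow_nonneg (hρ0 k).le _))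
      have hnn : 0 ≤ ∑ k, |Real.exp (s k) - 1| * ϑ k * ρ k ^ (2 * j + 1) :=
        Finset.sum_nonneg fun k _ =>
          mul_nonneg (mul_nonneg (abs_nonneg _) (hϑ k).le) (pow_nonneg (hρ0 k).le _)
      refine le_trans ?_ (le_mul_of_one_le_right hnn hle)
      refine (Finset.abs_sum_le_sum_abs _ _).trans (le_of_eq (Finset.sum_congr rfl fun k _ => ?_))
      rw [abs_mul, abs_mul, abs_of_pos (hϑ k), abs_of_pos (pow_pos (hρ0 k) _)]
    refine (Real.multipliable_one_add_of_summable hsum).congr fun j => ?_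
    have hpos := one_add_sum_pos hϑ hρ0 j
    rw [eq_div_iff hpos.ne', add_mul, div_mul_cancel₀ _ hpos.ne', one_mul, add_assoc,
      ← Finset.sum_add_distrib]
    congr 1
    exact Finset.sum_congr rfl fun k _ => by ring
  exact hmul.hasProd.tendsto_prod_nat

theorem limitMGF_nonneg (hϑ : ∀ k, 0 < ϑ k) (hρ0 : ∀ k, 0 < ρ k) (hρ1 : ∀ k, ρ k < 1)
    (s : Fin m → ℝ) : 0 ≤ limitMGF ϑ ρ s := by
  refine ge_of_tendsto' (tendsto_prod_limitMGF hϑ hρ0 hρ1 s) fun N => Finset.prod_nonneg fun j _ => ?_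
  refine div_nonneg ?_ (one_add_sum_pos hϑ hρ0 j).le
  exact (one_add_sum_pos (fun k => mul_pos (Real.exp_pos (s k)) (hϑ k)) hρ0 j).le

/-- The limiting generating function is bounded on bounded sets. -/
theorem limitMGF_le (hϑ : ∀ k, 0 < ϑ k) (hρ0 : ∀ k, 0 < ρ k) (hρ1 : ∀ k, ρ k < 1) {R : ℝ}
    {s : Fin m → ℝ} (hs : ∀ k, s k ≤ R) :
    limitMGF ϑ ρ s ≤ Real.exp (∑' j : ℕ, ∑ k, Real.exp R * ϑ k * ρ k ^ (2 * j + 1)) := by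
  refine le_of_tendsto' (tendsto_prod_limitMGF hϑ hρ0 hρ1 s) fun N => ?_
  have hsum := summable_sum_mul_pow (fun k => Real.exp R * ϑ k) hρ0 hρ1
  have hnn : ∀ j : ℕ, 0 ≤ ∑ k, Real.exp R * ϑ k * ρ k ^ (2 * j + 1) := fun j =>
    Finset.sum_nonneg fun k _ => mul_nonneg (mul_nonneg (Real.exp_pos _).le (hϑ k).le)
      (pow_nonneg (hρ0 k).le _)
  refine le_trans ?_ (Real.exp_le_exp.2 (hsum.sum_le_tsum (Finset.range N) fun j _ => hnn j))
  rw [Real.exp_sum]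
  have hnum : ∀ j : ℕ, 0 < 1 + ∑ k, Real.exp (s k) * ϑ k * ρ k ^ (2 * j + 1) := fun j =>
    one_add_sum_pos (fun k => mul_pos (Real.exp_pos (s k)) (hϑ k)) hρ0 j
  refine Finset.prod_le_prod (fun j _ => div_nonneg (hnum j).le (one_add_sum_pos hϑ hρ0 j).le)
    fun j _ => ?_
  have hle : 1 ≤ 1 + ∑ k, ϑ k * ρ k ^ (2 * j + 1) := le_add_of_nonneg_right
    (Finset.sum_nonneg fun k _ => mul_nonneg (hϑ k).le (pow_nonneg (hρ0 k).le _))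
  refine (div_le_self (hnum j).le hle).trans ?_
  refine le_trans ?_ (Real.add_one_le_exp _)
  rw [add_comm]
  gcongr with k
  · exact pow_nonneg (hρ0 k).le _
  · exact (hϑ k).le
  · exact hs k

end LimitMGF

namespace OutpostPotential

variable {Q : ℂ → EReal} {m : ℕ} {a₀ b₀ : ℝ} {t : Fin m → ℝ} {ε : ℝ}

theorem ofReal_outpostMGF (Q : ℂ → EReal) (ε : ℝ) (t : Fin m → ℝ) (n : ℕ) (s : Fin m → ℝ) :
    (outpostMGF Q ε t n s : ℂ) =
      ∫ z, Complex.exp (∑ k, (s k : ℂ) * (outpostCount ε t n z k : ℂ)) ∂(gasLaw Q n) := by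
  rw [outpostMGF, ← integral_complex_ofReal]
  congr 1
  funext z
  rw [← Real.exp_sum]
  push_cast
  rfl

/-- Convergence of the generating functions with small relative error on the cubes
`|s_k| ≤ log n`. -/
theorem eventually_abs_outpostMGF_sub_le (h : OutpostPotential Q a₀ b₀ t ε) {δ : ℝ} (hδ : 0 < δ) :
    ∀ᶠ n : ℕ in atTop, ∀ s : Fin m → ℝ, (∀ k, |s k| ≤ Real.log n) →
      |outpostMGF Q ε t n s - limitMGF (fun k => vartheta Q b₀ (t k)) (fun k => b₀ / t k) s| ≤
        δ * limitMGF (fun k => vartheta Q b₀ (t k)) (fun k => b₀ / t k) s := by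
  filter_upwards [h.peakProfile.norm_prod_peakMean_sub_le h.peaksSeparated m hδ,
    eventually_ge_atTop 1] with n hn hn1 s hs
  have hn0 : (0 : ℝ) < n := by exact_mod_cast hn1
  set G := limitMGF (fun k => vartheta Q b₀ (t k)) (fun k => b₀ / t k) s with hG
  have hG0 : 0 ≤ G := limitMGF_nonneg h.vartheta_pos h.ratio_pos h.ratio_lt_one s
  set f : Option (Fin m) → ℝ := fun i => i.elim 1 fun k => Real.exp (s k) with hf
  have hfpos : ∀ i, 0 < f i := fun i => by
    rcases i with _ | k
    · exact one_pos
    · exact Real.exp_pos _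
  have hfc : (fun i => (f i : ℂ)) = testValue fun k => (s k : ℂ) := by
    funext i
    rcases i with _ | k
    · exact Complex.ofReal_one
    · exact Complex.ofReal_exp _
  have hΛ : Real.exp (∑ k, |((s k : ℝ) : ℂ).re|) ≤ (n : ℝ) ^ m := by
    simp only [Complex.ofReal_re]
    calc Real.exp (∑ k, |s k|) ≤ Real.exp (∑ _k : Fin m, Real.log n) :=
          Real.exp_le_exp.2 (Finset.sum_le_sum fun k _ => hs k)
      _ = _ := by
          rw [Finset.sum_const, Finset.card_univ, Fintype.card_fin, nsmul_eq_mul, Real.exp_nat_mul,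
            Real.exp_log hn0]
  have hmain := hn (testFun ε t fun k => (s k : ℂ)) f G hfpos
    (by rw [hfc]; exact h.peakTest_testFun _ hΛ) ?_
  · rw [← h.integral_exp_outpostCount, ← ofReal_outpostMGF, ← Complex.ofReal_sub,
      Complex.norm_real, Complex.norm_real, Real.norm_eq_abs, Real.norm_eq_abs,
      abs_of_nonneg hG0] at hmain
    exact hmain
  · have h1 := (Complex.continuous_ofReal.tendsto _).comp
      (tendsto_prod_limitMGF h.vartheta_pos h.ratio_pos h.ratio_lt_one s)
    refine h1.congr fun N => ?_
    simp only [Function.comp]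
    rw [Complex.ofReal_prod]
    refine Finset.prod_congr rfl fun l _ => ?_
    rw [hfc, h.limitMean_testValue]
    push_cast
    simp only [mul_assoc]

theorem tendstoLocallyUniformly_outpostMGF (h : OutpostPotential Q a₀ b₀ t ε) :
    TendstoLocallyUniformly (fun n => outpostMGF Q ε t n)
      (limitMGF (fun k => vartheta Q b₀ (t k)) (fun k => b₀ / t k)) atTop := by
  rw [Metric.tendstoLocallyUniformly_iff]
  intro η hη x
  refine ⟨Metric.ball x 1, Metric.ball_mem_nhds x one_pos, ?_⟩
  set R := ‖x‖ + 1 with hR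
  set B := Real.exp (∑' j : ℕ, ∑ k, Real.exp R * vartheta Q b₀ (t k) * (b₀ / t k) ^ (2 * j + 1))
  have hB : 0 < B := Real.exp_pos _
  have hlog : Tendsto (fun n : ℕ => Real.log n) atTop atTop :=
    Real.tendsto_log_atTop.comp tendsto_natCast_atTop_atTop
  filter_upwards [h.eventually_abs_outpostMGF_sub_le (δ := η / (2 * B)) (by positivity),
    hlog.eventually_ge_atTop R] with n hn hnR y hy
  have hyR : ∀ k, |y k| ≤ R := fun k => by
    have h1 : ‖y‖ ≤ R := by
      have h2 : ‖y - x‖ < 1 := by rwa [← dist_eq_norm]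
      have h3 : ‖y‖ ≤ ‖x‖ + ‖y - x‖ := by simpa using norm_add_le x (y - x)
      linarith
    exact (norm_le_pi_norm y k).trans h1
  have h1 := hn y fun k => (hyR k).trans hnR
  have h2 : limitMGF (fun k => vartheta Q b₀ (t k)) (fun k => b₀ / t k) y ≤ B :=
    limitMGF_le h.vartheta_pos h.ratio_pos h.ratio_lt_one fun k => (le_abs_self _).trans (hyR k)
  rw [dist_comm, Real.dist_eq]
  calc _ ≤ η / (2 * B) * limitMGF (fun k => vartheta Q b₀ (t k)) (fun k => b₀ / t k) y := h1
    _ ≤ η / (2 * B) * B := by gcongr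
    _ = η / 2 := by field_simp
    _ < η := half_lt_self hη

/-- Convergence of the characteristic functions. -/
theorem tendsto_integral_exp_outpostCount (h : OutpostPotential Q a₀ b₀ t ε) (c : Fin m → ℂ)
    (hc : ∀ k, (c k).re = 0) :
    Tendsto (fun n => ∫ z, Complex.exp (∑ k, c k * (outpostCount ε t n z k : ℂ)) ∂(gasLaw Q n))
      atTop (𝓝 (∏' l : ℕ,
        (1 + ∑ k, Complex.exp (c k) * ((vartheta Q b₀ (t k) * (b₀ / t k) ^ (2 * l + 1) : ℝ) : ℂ)) /
        ((1 + ∑ k, vartheta Q b₀ (t k) * (b₀ / t k) ^ (2 * l + 1) : ℝ) : ℂ))) := by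
  have h1 := h.peakProfile.tendsto_prod_peakMean h.peaksSeparated
    (h.peakTest_testFun c (Λ := 1) (by simp [hc]))
  simp only [h.limitMean_testValue] at h1
  simpa only [h.integral_exp_outpostCount] using h1

end OutpostPotential

/-! ### The Heine distribution -/

section DisjointFamilies

variable {m : ℕ}

/-- The colour classes of a colouring of a finite set. -/
def colourClass (s : Finset ℕ) (c : s → Fin m) (k : Fin m) : Finset ℕ :=
  (Finset.univ.filter fun j => c j = k).map (Function.Embedding.subtype _)

theorem mem_colourClass {s : Finset ℕ} {c : s → Fin m} {k : Fin m} {j : ℕ} :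
    j ∈ colourClass s c k ↔ ∃ h : j ∈ s, c ⟨j, h⟩ = k := by
  simp [colourClass]

theorem disjoint_colourClass (s : Finset ℕ) (c : s → Fin m) {k l : Fin m} (hkl : k ≠ l) :
    Disjoint (colourClass s c k) (colourClass s c l) := by
  rw [Finset.disjoint_left]
  intro j hk hl
  obtain ⟨h1, h2⟩ := mem_colourClass.1 hk
  obtain ⟨h3, h4⟩ := mem_colourClass.1 hl
  exact hkl (h2.symm.trans h4)

/-- Finite sets with a colouring by `m` colours are the same as families of `m` pairwise disjoint
finite sets. -/
def colouringEquiv (m : ℕ) : (Σ s : Finset ℕ, s → Fin m) ≃ Σ α : Fin m → ℕ, DisjointFamily α := by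
  refine (Equiv.ofBijective (fun p : Σ s : Finset ℕ, s → Fin m =>
    (⟨colourClass p.1 p.2, fun k l => disjoint_colourClass p.1 p.2⟩ :
      {J : Fin m → Finset ℕ // ∀ k l, k ≠ l → Disjoint (J k) (J l)})) ⟨?_, ?_⟩).trans
    { toFun := fun J => ⟨fun k => (J.1 k).card, J.1, fun _ => rfl, J.2⟩
      invFun := fun p => ⟨p.2.1, p.2.2.2⟩
      left_inv := fun _ => rfl
      right_inv := ?_ }
  · rintro ⟨s, c⟩ ⟨s', c'⟩ h
    have h0 : colourClass s c = colourClass s' c' := congrArg Subtype.val h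
    have h1 : ∀ k j, j ∈ colourClass s c k ↔ j ∈ colourClass s' c' k := fun k j => by
      rw [h0]
    obtain rfl : s = s' := by
      ext j
      constructor
      · intro hj
        exact (mem_colourClass.1 ((h1 (c ⟨j, hj⟩) j).1 (mem_colourClass.2 ⟨hj, rfl⟩))).1
      · intro hj
        exact (mem_colourClass.1 ((h1 (c' ⟨j, hj⟩) j).2 (mem_colourClass.2 ⟨hj, rfl⟩))).1
    obtain rfl : c = c' := by
      funext ⟨j, hj⟩
      obtain ⟨_, h2⟩ := mem_colourClass.1 ((h1 (c ⟨j, hj⟩) j).1 (mem_colourClass.2 ⟨hj, rfl⟩))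
      exact h2.symm
    rfl
  · rintro ⟨J, hJ⟩
    have hex : ∀ j : (Finset.univ.biUnion J : Finset ℕ), ∃ k, (j : ℕ) ∈ J k := fun j => by
      obtain ⟨k, -, hk⟩ := Finset.mem_biUnion.1 j.2
      exact ⟨k, hk⟩
    choose c hc using hex
    refine ⟨⟨Finset.univ.biUnion J, c⟩, Subtype.ext (funext fun k => ?_)⟩
    ext j
    rw [mem_colourClass]
    constructor
    · rintro ⟨h, rfl⟩
      exact hc ⟨j, h⟩
    · intro hj
      have hmem : j ∈ Finset.univ.biUnion J := Finset.mem_biUnion.2 ⟨k, Finset.mem_univ _, hj⟩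
      refine ⟨hmem, ?_⟩
      by_contra hne
      exact (Finset.disjoint_left.1 (hJ _ _ hne)) (hc ⟨j, hmem⟩) hj
  · rintro ⟨α, J, hα, hd⟩
    obtain rfl : (fun k => (J k).card) = α := funext hα
    rfl

theorem colouringEquiv_apply (s : Finset ℕ) (c : s → Fin m) :
    (colouringEquiv m ⟨s, c⟩).2.1 = colourClass s c := rfl

theorem prod_colourClass (g : Fin m → ℕ → ℂ) (s : Finset ℕ) (c : s → Fin m) :
    ∏ k, ∏ j ∈ colourClass s c k, g k j = ∏ j : s, g (c j) j := by
  rw [← Finset.prod_fiberwise Finset.univ c]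
  refine Finset.prod_congr rfl fun k _ => ?_
  rw [colourClass, Finset.prod_map]
  refine Finset.prod_congr rfl fun j hj => ?_
  rw [(Finset.mem_filter.1 hj).2]
  rfl

/-- Expanding the product `∏_j (1 + ∑_k g_k(j))` over families of disjoint sets. -/
theorem hasSum_disjointFamily {g : Fin m → ℕ → ℂ} (hg : Summable fun j => ∑ k, ‖g k j‖) :
    HasSum (fun p : Σ α : Fin m → ℕ, DisjointFamily α => ∏ k, ∏ j ∈ p.2.1 k, g k j)
      (∏' j, (1 + ∑ k, g k j)) := by
  rw [← (colouringEquiv m).hasSum_iff]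
  have hfun : ((fun p : Σ α : Fin m → ℕ, DisjointFamily α => ∏ k, ∏ j ∈ p.2.1 k, g k j) ∘
      colouringEquiv m) = fun p => ∏ j : p.1, g (p.2 j) j := by
    funext ⟨s, c⟩
    simp only [Function.comp, colouringEquiv_apply]
    exact prod_colourClass g s c
  rw [hfun]
  have hexp : ∀ s : Finset ℕ, ∏ j ∈ s, ∑ k, g k j = ∑ c : s → Fin m, ∏ j : s, g (c j) j := by
    intro s
    rw [← Finset.prod_coe_sort, Finset.prod_univ_sum, Fintype.piFinset_univ]
  have hexp' : ∀ s : Finset ℕ, ∏ j ∈ s, ∑ k, ‖g k j‖ =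
      ∑ c : s → Fin m, ‖∏ j : s, g (c j) j‖ := by
    intro s
    rw [← Finset.prod_coe_sort, Finset.prod_univ_sum, Fintype.piFinset_univ]
    simp only [norm_prod]
  have hsum : Summable fun p : Σ s : Finset ℕ, s → Fin m => ∏ j : p.1, g (p.2 j) j := by
    refine Summable.of_norm ?_
    rw [summable_sigma_of_nonneg fun _ => norm_nonneg _]
    refine ⟨fun s => Summable.of_finite, ?_⟩
    simp only [tsum_fintype, ← hexp']
    exact summable_finsetProd_of_summable_nonneg
      (fun j => Finset.sum_nonneg fun k _ => norm_nonneg _) hg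
  have hnorm : Summable fun j => ‖∑ k, g k j‖ :=
    hg.of_nonneg_of_le (fun _ => norm_nonneg _) fun j => norm_sum_le _ _
  have h1 := hsum.hasSum
  rwa [hsum.tsum_sigma' fun s => Summable.of_finite, tsum_congr (fun s => by
    rw [tsum_fintype, ← hexp s]), ← tprod_one_add (summable_finsetProd_of_summable_norm hnorm)] at h1

end DisjointFamilies

section Heine

variable {m : ℕ} {θ q : Fin m → ℝ}

/-- The normalising constant of the Heine distribution. -/
def heineConst (θ q : Fin m → ℝ) : ℝ := ∏' j : ℕ, (1 + ∑ k, θ k * q k ^ j)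

theorem summable_sum_mul_geometric (c : Fin m → ℝ) (hq0 : ∀ k, 0 < q k) (hq1 : ∀ k, q k < 1) :
    Summable fun j : ℕ => ∑ k, c k * q k ^ j :=
  summable_sum fun k _ => (summable_geometric_of_lt_one (hq0 k).le (hq1 k)).mul_left _

theorem hasProd_heineConst (θ : Fin m → ℝ) (hq0 : ∀ k, 0 < q k) (hq1 : ∀ k, q k < 1) :
    HasProd (fun j : ℕ => 1 + ∑ k, θ k * q k ^ j) (heineConst θ q) :=
  (Real.multipliable_one_add_of_summable (summable_sum_mul_geometric θ hq0 hq1)).hasProd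

theorem one_le_heineConst (hθ : ∀ k, 0 < θ k) (hq0 : ∀ k, 0 < q k) (hq1 : ∀ k, q k < 1) :
    1 ≤ heineConst θ q := by
  refine ge_of_tendsto' (hasProd_heineConst θ hq0 hq1) fun s => ?_
  refine Finset.one_le_prod fun j _ => le_add_of_nonneg_right
    (Finset.sum_nonneg fun k _ => mul_nonneg (hθ k).le (pow_nonneg (hq0 k).le _))

theorem hasProd_ofReal_heineConst (θ : Fin m → ℝ) (hq0 : ∀ k, 0 < q k) (hq1 : ∀ k, q k < 1) :
    HasProd (fun j : ℕ => ((1 + ∑ k, θ k * q k ^ j : ℝ) : ℂ)) (heineConst θ q : ℂ) :=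
  (hasProd_heineConst θ hq0 hq1).map Complex.ofRealHom Complex.continuous_ofReal

/-- The generating function of the Heine distribution. -/
theorem hasSum_heineMass (hθ : ∀ k, 0 < θ k) (hq0 : ∀ k, 0 < q k) (hq1 : ∀ k, q k < 1)
    (z : Fin m → ℂ) :
    HasSum (fun α : Fin m → ℕ => (heineMass θ q α : ℂ) * ∏ k, z k ^ α k)
      ((∏' j : ℕ, (1 + ∑ k, z k * ((θ k * q k ^ j : ℝ) : ℂ))) / (heineConst θ q : ℂ)) := by
  have hZ := one_le_heineConst hθ hq0 hq1
  set g : Fin m → ℕ → ℂ := fun k j => z k * ((θ k * q k ^ j : ℝ) : ℂ) with hgdef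
  have hg : Summable fun j => ∑ k, ‖g k j‖ := by
    refine (summable_sum_mul_geometric (fun k => ‖z k‖ * θ k) hq0 hq1).congr fun j => ?_
    refine Finset.sum_congr rfl fun k _ => ?_
    rw [hgdef]
    simp only [norm_mul, Complex.norm_real, Real.norm_eq_abs]
    rw [← abs_mul, abs_of_pos (mul_pos (hθ k) (pow_pos (hq0 k) _)), mul_assoc]
  have hmain := (hasSum_disjointFamily hg)
  have h1 := HasSum.sigma hmain (g := fun α => ∑' J : DisjointFamily α, ∏ k, ∏ j ∈ J.1 k, g k j)
    fun α => (hmain.summable.sigma_factor α).hasSum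
  refine (h1.div_const (heineConst θ q : ℂ)).congr_fun fun α => ?_
  rw [heineMass]
  change (((∏ k, θ k ^ α k) * (∑' J : DisjointFamily α, ∏ k, q k ^ (∑ j ∈ J.1 k, j)) /
    heineConst θ q : ℝ) : ℂ) * _ = _
  rw [Complex.ofReal_div, div_mul_eq_mul_div, Complex.ofReal_mul, Complex.ofReal_tsum]
  congr 1
  rw [mul_right_comm, ← tsum_mul_left]
  refine tsum_congr fun J => ?_
  rw [Complex.ofReal_prod, Complex.ofReal_prod, ← Finset.prod_mul_distrib,
    ← Finset.prod_mul_distrib]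
  refine Finset.prod_congr rfl fun k _ => ?_
  rw [hgdef]
  simp only [Complex.ofReal_mul, Finset.prod_mul_distrib, Finset.prod_const, J.2.1 k]
  rw [← Complex.ofReal_prod, Finset.prod_pow_eq_pow_sum]
  push_cast
  ring

theorem heineMass_nonneg (hθ : ∀ k, 0 < θ k) (hq0 : ∀ k, 0 < q k) (hq1 : ∀ k, q k < 1)
    (α : Fin m → ℕ) : 0 ≤ heineMass θ q α := by
  refine div_nonneg (mul_nonneg (Finset.prod_nonneg fun k _ => pow_nonneg (hθ k).le _)
    (tsum_nonneg fun J => Finset.prod_nonneg fun k _ => pow_nonneg (hq0 k).le _)) ?_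
  exact zero_le_one.trans (one_le_heineConst hθ hq0 hq1)

theorem hasSum_heineMass_one (hθ : ∀ k, 0 < θ k) (hq0 : ∀ k, 0 < q k) (hq1 : ∀ k, q k < 1) :
    HasSum (heineMass θ q) 1 := by
  have h1 := hasSum_heineMass hθ hq0 hq1 fun _ => 1
  have hZ := one_le_heineConst hθ hq0 hq1
  have h2 : ∏' j : ℕ, (1 + ∑ k, (1 : ℂ) * ((θ k * q k ^ j : ℝ) : ℂ)) = (heineConst θ q : ℂ) := by
    rw [← (hasProd_ofReal_heineConst θ hq0 hq1).tprod_eq]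
    refine tprod_congr fun j => ?_
    push_cast
    simp only [one_mul]
  rw [h2, div_self (by exact_mod_cast (zero_lt_one.trans_le hZ).ne')] at h1
  simp only [one_pow, Finset.prod_const_one, mul_one] at h1
  exact Complex.hasSum_ofReal.1 (by rwa [Complex.ofReal_one])

theorem isProbabilityMeasure_heineLaw (hθ : ∀ k, 0 < θ k) (hq0 : ∀ k, 0 < q k)
    (hq1 : ∀ k, q k < 1) : IsProbabilityMeasure (heineLaw θ q) := by
  have h := hasSum_heineMass_one hθ hq0 hq1
  constructor
  rw [heineLaw, Measure.sum_apply _ MeasurableSet.univ]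
  simp only [Measure.smul_apply, measure_univ, smul_eq_mul, mul_one]
  rw [← ENNReal.ofReal_tsum_of_nonneg (heineMass_nonneg hθ hq0 hq1) h.summable, h.tsum_eq,
    ENNReal.ofReal_one]

theorem integral_heineLaw (hθ : ∀ k, 0 < θ k) (hq0 : ∀ k, 0 < q k) (hq1 : ∀ k, q k < 1)
    {f : (Fin m → ℕ) → ℂ} {C : ℝ} (hf : ∀ α, ‖f α‖ ≤ C) :
    ∫ α, f α ∂(heineLaw θ q) = ∑' α, (heineMass θ q α : ℂ) * f α := by
  have := isProbabilityMeasure_heineLaw hθ hq0 hq1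
  have hint : Integrable f (heineLaw θ q) :=
    Integrable.of_bound (measurable_of_countable f).aestronglyMeasurable C
      (Eventually.of_forall hf)
  rw [heineLaw] at hint ⊢
  rw [integral_sum_measure hint]
  refine tsum_congr fun α => ?_
  rw [integral_smul_measure, integral_dirac,
    ENNReal.toReal_ofReal (heineMass_nonneg hθ hq0 hq1 α), Complex.real_smul]

end Heine

/-! ### Convergence in distribution -/

theorem charFun_map_toLp {m : ℕ} {α : Type*} [MeasurableSpace α] (ν : Measure α)
    {Y : α → Fin m → ℝ} (hY : Measurable Y) (u : EuclideanSpace ℝ (Fin m)) :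
    charFun (ν.map fun ω => (WithLp.toLp 2 (Y ω) : EuclideanSpace ℝ (Fin m))) u =
      ∫ ω, Complex.exp (∑ k, (u k * Complex.I) * (Y ω k : ℂ)) ∂ν := by
  have hY' : Measurable fun ω => (WithLp.toLp 2 (Y ω) : EuclideanSpace ℝ (Fin m)) :=
    (PiLp.continuous_toLp 2 _).measurable.comp hY
  rw [charFun_apply, integral_map hY'.aemeasurable (by fun_prop)]
  congr 1
  funext ω
  rw [PiLp.inner_apply]
  push_cast
  rw [Finset.sum_mul]
  congr 1
  refine Finset.sum_congr rfl fun k _ => ?_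
  simp
  ring

/-- Lévy's continuity theorem for random vectors indexed by `Fin m`, in coordinates. -/
theorem tendstoInDistribution_of_charFun {m : ℕ} {Ω : ℕ → Type*} [∀ n, MeasurableSpace (Ω n)]
    {Ω' : Type*} [MeasurableSpace Ω'] {μ : ∀ n, Measure (Ω n)} [∀ n, IsProbabilityMeasure (μ n)]
    {μ' : Measure Ω'} [IsProbabilityMeasure μ'] {X : ∀ n, Ω n → Fin m → ℝ} {Z : Ω' → Fin m → ℝ}
    (hX : ∀ n, Measurable (X n)) (hZ : Measurable Z)
    (hlim : ∀ u : Fin m → ℝ, Tendsto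
      (fun n => ∫ ω, Complex.exp (∑ k, (u k * Complex.I) * (X n ω k : ℂ)) ∂(μ n)) atTop
      (𝓝 (∫ ω, Complex.exp (∑ k, (u k * Complex.I) * (Z ω k : ℂ)) ∂μ'))) :
    TendstoInDistribution X atTop Z μ μ' := by
  have htoLp : Measurable (WithLp.toLp 2 : (Fin m → ℝ) → EuclideanSpace ℝ (Fin m)) :=
    (PiLp.continuous_toLp 2 _).measurable
  have hX' : ∀ n, Measurable fun ω => (WithLp.toLp 2 (X n ω) : EuclideanSpace ℝ (Fin m)) :=
    fun n => htoLp.comp (hX n)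
  have hZ' : Measurable fun ω => (WithLp.toLp 2 (Z ω) : EuclideanSpace ℝ (Fin m)) :=
    htoLp.comp hZ
  have hE : TendstoInDistribution (fun n ω => (WithLp.toLp 2 (X n ω) : EuclideanSpace ℝ (Fin m)))
      atTop (fun ω => WithLp.toLp 2 (Z ω)) μ μ' := by
    refine ⟨fun n => (hX' n).aemeasurable, hZ'.aemeasurable, ?_⟩
    refine ProbabilityMeasure.tendsto_of_tendsto_charFun (E := EuclideanSpace ℝ (Fin m)) fun u => ?_
    simp only [ProbabilityMeasure.coe_mk]
    rw [charFun_map_toLp μ' hZ u]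
    simp only [charFun_map_toLp (μ _) (hX _) u]
    exact hlim fun k => u k
  exact hE.continuous_comp (g := WithLp.ofLp) (PiLp.continuous_ofLp 2 _)

namespace OutpostPotential

variable {Q : ℂ → EReal} {m : ℕ} {a₀ b₀ : ℝ} {t : Fin m → ℝ} {ε : ℝ}

theorem isProbabilityMeasure_heineLaw (h : OutpostPotential Q a₀ b₀ t ε) :
    IsProbabilityMeasure (heineLaw (fun k => vartheta Q b₀ (t k) * (b₀ / t k))
      (fun k => (b₀ / t k) ^ 2)) :=
  Coulomb.isProbabilityMeasure_heineLaw (fun k => mul_pos (h.vartheta_pos k) (h.ratio_pos k))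
    (fun k => pow_pos (h.ratio_pos k) 2)
    (fun k => pow_lt_one₀ (h.ratio_pos k).le (h.ratio_lt_one k) two_ne_zero)

/-- The characteristic function of the limiting Heine distribution, as the infinite product which also
arises from the gas. Here `θ_k q_k^l = ϑ_k ρ_k^{2l+1}`. -/
theorem integral_exp_heineLaw (h : OutpostPotential Q a₀ b₀ t ε) (c : Fin m → ℂ)
    (hc : ∀ k, (c k).re = 0) :
    ∫ α, Complex.exp (∑ k, c k * ((α k : ℝ) : ℂ)) ∂(heineLaw
      (fun k => vartheta Q b₀ (t k) * (b₀ / t k)) (fun k => (b₀ / t k) ^ 2)) =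
      ∏' l : ℕ,
        (1 + ∑ k, Complex.exp (c k) * ((vartheta Q b₀ (t k) * (b₀ / t k) ^ (2 * l + 1) : ℝ) : ℂ)) /
        ((1 + ∑ k, vartheta Q b₀ (t k) * (b₀ / t k) ^ (2 * l + 1) : ℝ) : ℂ) := by
  set θ : Fin m → ℝ := fun k => vartheta Q b₀ (t k) * (b₀ / t k) with hθdef
  set q : Fin m → ℝ := fun k => (b₀ / t k) ^ 2 with hqdef
  have hθ : ∀ k, 0 < θ k := fun k => mul_pos (h.vartheta_pos k) (h.ratio_pos k)
  have hq0 : ∀ k, 0 < q k := fun k => pow_pos (h.ratio_pos k) 2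
  have hq1 : ∀ k, q k < 1 := fun k =>
    pow_lt_one₀ (h.ratio_pos k).le (h.ratio_lt_one k) two_ne_zero
  have hθq : ∀ k (l : ℕ), vartheta Q b₀ (t k) * (b₀ / t k) ^ (2 * l + 1) = θ k * q k ^ l := by
    intro k l
    rw [hθdef, hqdef]
    simp only
    rw [pow_succ, pow_mul]; ring
  simp only [hθq]
  have hnorm : ∀ α : Fin m → ℕ, ‖Complex.exp (∑ k, c k * ((α k : ℝ) : ℂ))‖ ≤ 1 := fun α => by
    rw [Complex.norm_exp, Complex.re_sum]
    simp [hc]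
  rw [integral_heineLaw hθ hq0 hq1 hnorm]
  have hexp : ∀ α : Fin m → ℕ, Complex.exp (∑ k, c k * ((α k : ℝ) : ℂ)) =
      ∏ k, Complex.exp (c k) ^ α k := fun α => by
    rw [Complex.exp_sum]
    refine Finset.prod_congr rfl fun k _ => ?_
    rw [← Complex.exp_nat_mul, mul_comm, Complex.ofReal_natCast]
  simp only [hexp]
  rw [(hasSum_heineMass hθ hq0 hq1 fun k => Complex.exp (c k)).tsum_eq]
  symm
  -- the quotient of the two convergent products
  have hden := hasProd_ofReal_heineConst θ hq0 hq1
  have hZ : (heineConst θ q : ℂ) ≠ 0 := by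
    exact_mod_cast (zero_lt_one.trans_le (one_le_heineConst hθ hq0 hq1)).ne'
  have hnum : HasProd (fun l : ℕ => 1 + ∑ k, Complex.exp (c k) * ((θ k * q k ^ l : ℝ) : ℂ))
      (∏' l : ℕ, (1 + ∑ k, Complex.exp (c k) * ((θ k * q k ^ l : ℝ) : ℂ))) := by
    refine (multipliable_one_add_of_summable ?_).hasProd
    refine (summable_sum_mul_geometric θ hq0 hq1).of_nonneg_of_le (fun _ => norm_nonneg _)
      fun l => (norm_sum_le _ _).trans (Finset.sum_le_sum fun k _ => ?_)
    rw [norm_mul, Complex.norm_exp, hc, Real.exp_zero, one_mul, Complex.norm_real,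
      Real.norm_eq_abs, abs_of_pos (mul_pos (hθ k) (pow_pos (hq0 k) _))]
  have hquot : HasProd (fun l : ℕ => (1 + ∑ k, Complex.exp (c k) * ((θ k * q k ^ l : ℝ) : ℂ)) /
      ((1 + ∑ k, θ k * q k ^ l : ℝ) : ℂ))
      ((∏' l : ℕ, (1 + ∑ k, Complex.exp (c k) * ((θ k * q k ^ l : ℝ) : ℂ))) /
        (heineConst θ q : ℂ)) := by
    refine (Tendsto.div hnum hden hZ).congr fun s => ?_
    simp only [Finset.prod_div_distrib, Pi.div_apply]
  exact hquot.tprod_eq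

theorem tendstoInDistribution_outpostCount (h : OutpostPotential Q a₀ b₀ t ε)
    [∀ n, IsProbabilityMeasure (gasLaw Q n)]
    [IsProbabilityMeasure (heineLaw (fun k => vartheta Q b₀ (t k) * (b₀ / t k))
      (fun k => (b₀ / t k) ^ 2))] :
    TendstoInDistribution (fun n => outpostCount ε t n) atTop
      (fun (α : Fin m → ℕ) (k : Fin m) => (α k : ℝ)) (fun n => gasLaw Q n)
      (heineLaw (fun k => vartheta Q b₀ (t k) * (b₀ / t k)) (fun k => (b₀ / t k) ^ 2)) := by
  refine tendstoInDistribution_of_charFun (measurable_outpostCount ε t)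
    (measurable_of_countable _) fun u => ?_
  have hc : ∀ k, ((u k : ℂ) * Complex.I).re = 0 := fun k => by simp
  rw [h.integral_exp_heineLaw (fun k => u k * Complex.I) hc]
  exact h.tendsto_integral_exp_outpostCount (fun k => u k * Complex.I) hc

end OutpostPotential

end

end Coulomb

theorem mainTheorem1 (Q : ℂ → EReal)
    -- the potential: values in `ℝ ∪ {+∞}`, rotation invariant, lower semicontinuous, confining
    (hbot : ∀ z, Q z ≠ ⊥)
    (hrad : ∃ q : ℝ → EReal, ∀ z, Q z = q ‖z‖)
    (hlsc : LowerSemicontinuous Q)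
    (hconf : 1 < Filter.liminf (fun z : ℂ => Q z / ((2 * Real.log ‖z‖ : ℝ) : EReal))
      (Bornology.cobounded ℂ))
    -- the coincidence set is one annulus (or disc) together with `m` circles outside it
    (m : ℕ) (a₀ b₀ : ℝ) (t : Fin m → ℝ) (ha₀ : 0 ≤ a₀) (hab : a₀ < b₀)
    (ht : StrictMono t) (hbt : ∀ k, b₀ < t k)
    (hS : Coulomb.coincidenceSet Q =
      {z : ℂ | a₀ ≤ ‖z‖ ∧ ‖z‖ ≤ b₀} ∪ ⋃ k, {z : ℂ | ‖z‖ = t k})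
    -- `Q` is smooth and strictly subharmonic near the coincidence set
    (hC6 : Coulomb.IsC6Near Q (Coulomb.coincidenceSet Q))
    (hsub : ∀ z ∈ Coulomb.coincidenceSet Q, 0 < Coulomb.quarterLaplacian Q z)
    -- the `2ε`-neighbourhoods of the outposts meet neither each other nor the annulus
    (ε : ℝ) (hε : 0 < ε) (hεb : ∀ k, b₀ + 2 * ε ≤ t k)
    (hεt : ∀ k l, k < l → t k + 2 * ε ≤ t l - 2 * ε)
    (ϑ ρ : Fin m → ℝ) (hϑ : ∀ k, ϑ k = Coulomb.vartheta Q b₀ (t k))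
    (hρ : ∀ k, ρ k = b₀ / t k) :
    -- convergence of the moment generating functions, locally uniformly on `ℝ^m` ...
    TendstoLocallyUniformly (fun n => Coulomb.outpostMGF Q ε t n) (Coulomb.limitMGF ϑ ρ) atTop ∧
    -- ... and, with uniformly small relative error, on the growing cubes `|s_k| ≤ log n`
    (∀ δ : ℝ, 0 < δ → ∀ᶠ n : ℕ in atTop, ∀ s : Fin m → ℝ, (∀ k, |s k| ≤ Real.log n) →
      |Coulomb.outpostMGF Q ε t n s - Coulomb.limitMGF ϑ ρ s| ≤ δ * Coulomb.limitMGF ϑ ρ s) ∧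
    -- convergence in distribution of the counts to the multi-dimensional Heine distribution
    ∃ (_ : ∀ n, IsProbabilityMeasure (Coulomb.gasLaw Q n))
      (_ : IsProbabilityMeasure (Coulomb.heineLaw (fun k => ϑ k * ρ k) (fun k => ρ k ^ 2))),
      TendstoInDistribution (fun n => Coulomb.outpostCount ε t n) atTop
        (fun (α : Fin m → ℕ) (k : Fin m) => (α k : ℝ)) (fun n => Coulomb.gasLaw Q n)
        (Coulomb.heineLaw (fun k => ϑ k * ρ k) (fun k => ρ k ^ 2)) := by
  obtain rfl : ϑ = fun k => Coulomb.vartheta Q b₀ (t k) := funext hϑ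
  obtain rfl : ρ = fun k => b₀ / t k := funext hρ
  have hrad' : ∀ z w : ℂ, ‖z‖ = ‖w‖ → Q z = Q w := by
    obtain ⟨q, hq⟩ := hrad
    intro z w hzw
    rw [hq z, hq w, hzw]
  have h : Coulomb.OutpostPotential Q a₀ b₀ t ε :=
    ⟨hbot, hrad', hlsc, hconf, ha₀, hab, hbt, hS, hC6, hsub, hε, hεb, hεt⟩
  have := h.isProbabilityMeasure_gasLaw
  have := h.isProbabilityMeasure_heineLaw
  exact ⟨h.tendstoLocallyUniformly_outpostMGF, fun δ hδ => h.eventually_abs_outpostMGF_sub_le hδ,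
    h.isProbabilityMeasure_gasLaw, h.isProbabilityMeasure_heineLaw,
    h.tendstoInDistribution_outpostCount⟩
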